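/- For $a_1,a_2>0$ let $\mathcal E(a_1,a_2)=\{(z_1,z_2)\in\mathbb C^2 : \pi|z_1|^2/a_1+\pi|z_2|^2/a_2\le 1\}$ be the closed ellipsoid, and let $\omega=dx_1\wedge dy_1+dx_2\wedge dy_2$ be the standard symplectic form of $\mathbb C^2$. Let $a>0$, put $\mathcal E_a:=\mathcal E(1,a)$ and let $D:=\mathcal E_a\cap\{z_2=0\}$ be its Hopf disc. Let $U$ be an open neighbourhood of $D$ in $\mathcal E_a$ (for the relative topology), and let $\psi:U\to\mathbb C^2$ be a smooth symplectic embedding (smooth up to the boundary points $U\cap\partial\mathcal E_a$) with $\psi|_D=\mathrm{Id}$. 1. There is a symplectic isotopy $(\Phi_t)_{t\in[0,1]}$ of $\mathbb C^2$, that is, a family of symplectomorphisms of $(\mathbb C^2,\omega)$ depending smoothly on $(t,z)\in[0,1]\times\mathbb C^2$ with $\Phi_0=\mathrm{Id}$, such that $\Phi_t|_D=\mathrm{Id}$ for all $t\in[0,1]$ and $\Phi_1\circ\psi=\mathrm{Id}$ on some neighbourhood of $D$ in $U$. 2. (Relative version.) If moreover $\psi=\mathrm{Id}$ on $U\cap\partial\mathcal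 E_a$, then $(\Phi_t)$ in 1 can be chosen such that in addition $\Phi_t|_{\partial\mathcal E_a}=\mathrm{Id}$ for all $t\in[0,1]$. -/

import Mathlib

open Set
open scoped ContDiff

/-- `ω = dx₁ ∧ dy₁ + dx₂ ∧ dy₂` on `ℂ² = ℂ × ℂ`, evaluated on the tangent vectors `u`, `v`;
here `Im (conj u * v) = u.re * v.im - u.im * v.re`. -/
noncomputable def stdSymplecticForm (u v : ℂ × ℂ) : ℝ :=
  (starRingEnd ℂ u.1 * v.1).im + (starRingEnd ℂ u.2 * v.2).im

/-- The closed ellipsoid `E(a₁, a₂)` in `ℂ²`. -/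
def ellipsoid (a₁ a₂ : ℝ) : Set (ℂ × ℂ) :=
  {z | Real.pi * ‖z.1‖ ^ 2 / a₁ + Real.pi * ‖z.2‖ ^ 2 / a₂ ≤ 1}

/-- The Hopf disc `{z₂ = 0}` of the ellipsoid `E(1, a)`. -/
def hopfDisc (a : ℝ) : Set (ℂ × ℂ) :=
  {z | z ∈ ellipsoid 1 a ∧ z.2 = 0}

/-- Smoothness of a map on a subset `A` of `ℂ²` (for instance on a domain with boundary):
near every point of `A` the map coincides on `A` with a smooth map defined on an open set. -/
def SmoothOnSubset (f : ℂ × ℂ → ℂ × ℂ) (A : Set (ℂ × ℂ)) : Prop :=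
  ∀ x ∈ A, ∃ (W : Set (ℂ × ℂ)) (F : ℂ × ℂ → ℂ × ℂ),
    IsOpen W ∧ x ∈ W ∧ ContDiffOn ℝ ∞ F W ∧ EqOn f F (A ∩ W)

/-- `ψ` restricts to a symplectic embedding of `U` into `ℂ²`. It is meant for relatively open
subsets `U` of an ellipsoid, where the derivative within `U` is unique. -/
structure IsSymplecticEmbeddingOn (ψ : ℂ × ℂ → ℂ × ℂ) (U : Set (ℂ × ℂ)) : Prop where
  smooth : SmoothOnSubset ψ U
  embedding : Topology.IsEmbedding (fun x : U => ψ x)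
  symplectic : ∀ x ∈ U, ∀ u v : ℂ × ℂ,
    stdSymplecticForm (fderivWithin ℝ ψ U x u) (fderivWithin ℝ ψ U x v) = stdSymplecticForm u v

/-- `ψ` is a local symplectic embedding of `(E(1, a), D)` with domain `U`: the set `U` is an open
neighbourhood of the Hopf disc in `E(1, a)` on which `ψ` is a symplectic embedding. -/
structure IsLocalSymplecticEmbedding (a : ℝ) (U : Set (ℂ × ℂ)) (ψ : ℂ × ℂ → ℂ × ℂ) : Prop where
  nhd : ∃ V : Set (ℂ × ℂ), IsOpen V ∧ hopfDisc a ⊆ V ∧ U = ellipsoid 1 a ∩ V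
  symplecticEmbedding : IsSymplecticEmbeddingOn ψ U

/-- Symplectomorphisms of `ℂ²`. -/
structure IsSymplectomorphism (f : ℂ × ℂ → ℂ × ℂ) : Prop where
  smooth : ContDiff ℝ ∞ f
  smoothInverse : ∃ g : ℂ × ℂ → ℂ × ℂ,
    ContDiff ℝ ∞ g ∧ Function.LeftInverse g f ∧ Function.RightInverse g f
  symplectic : ∀ x u v : ℂ × ℂ,
    stdSymplecticForm (fderiv ℝ f x u) (fderiv ℝ f x v) = stdSymplecticForm u v

/-- Symplectic isotopies `(Φ_t)`, `t ∈ [0, 1]`, of `ℂ²` that start at the identity. -/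
structure IsSymplecticIsotopy (Φ : ℝ → ℂ × ℂ → ℂ × ℂ) : Prop where
  smooth : ContDiffOn ℝ ∞ (fun p : ℝ × (ℂ × ℂ) => Φ p.1 p.2) (Icc (0 : ℝ) 1 ×ˢ univ)
  symplecto : ∀ t ∈ Icc (0 : ℝ) 1, IsSymplectomorphism (Φ t)
  start : ∀ z, Φ 0 z = z

/-- `(Φ_t)` is a symplectic isotopy of `ℂ²` that is the identity on the Hopf disc `D` for all
times and isotops `ψ` to the identity: `Φ₁ ∘ ψ = Id` on a neighbourhood of `D` in the domain `U`
of `ψ`. -/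
structure IsotopsToId (a : ℝ) (U : Set (ℂ × ℂ)) (ψ : ℂ × ℂ → ℂ × ℂ)
    (Φ : ℝ → ℂ × ℂ → ℂ × ℂ) : Prop where
  isotopy : IsSymplecticIsotopy Φ
  id_on_disc : ∀ t ∈ Icc (0 : ℝ) 1, ∀ z ∈ hopfDisc a, Φ t z = z
  comp_eq_id : ∃ W : Set (ℂ × ℂ), IsOpen W ∧ hopfDisc a ⊆ W ∧ ∀ z ∈ U ∩ W, Φ 1 (ψ z) = z

open Filter Topology

/-! Extend `ψ` to a smooth map F of ℂ² which, at points of the ellipsoid near the disc D, is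
symplectic and fixes a prescribed set P ⊇ D. Two kinds of correction by isotopies fixing P turn F
into the identity near D.

Normal correction. Along D the derivative of F fixes the tangent plane, hence preserves the
ω-orthogonal normal plane, and so defines a map from D to SL(2, ℝ). Since the disc is star-shaped,
the first column of this matrix has a smooth logarithm; the matrix is therefore a rotation times an
upper triangular matrix, and both are products of elementary shears
(`IsSymplecticNearDisc.isNormalMatrix`). A shear with coefficient b(z₁) comes from a generating
function that equals b(z₁) ℓ(z₂)² / 2 near z₂ = 0 and is cut off away from it; dividing by a large
integer n makes it small enough, and the result is iterated n times (`isNormalDerivative_shear`).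

Tangent correction. Suppose dF = id on a closed K ⊆ D, and let h = F − id. The map μ = id + i Im h
passes to mixed coordinates, the 1-form ω(h, dμ) is closed where F is symplectic, and a primitive f
of it gives the generating function S₀ = f ∘ μ⁻¹ of F. It vanishes to second order on K, so by
Taylor's formula it can be cut off near K with arbitrarily small second derivative
(`HasCutoffs.exists_cutoff`). A generating function S with small Hessian defines a global symplectic
isotopy through the functions σ(t) S (`exists_isotopy_of_generatingFunction`), and critical points
of S stay fixed. This yields an isotopy fixing P and ending at F near K
(`IsSymplecticNearDisc.exists_isotopy`).

For the absolute statement take P = D, apply the normal correction, then the tangent correction with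
K = D. For the relative statement take P = D ∪ ∂E. Shears can fix ∂E only over compact subsets of
the open disc, because ∂E meets D in its boundary circle. But on that circle dF is already the
identity, as the tangent spaces of D and ∂E together span. So a tangent correction with K = the
circle makes F the identity near the circle; the normal matrix is then 1 on an annulus, the shears
can be supported inside the open disc, and a last tangent correction with K = D finishes. -/

/-! ### Calculus: smooth inverses, parameter integrals, a Poincaré lemma -/

/-- A smooth bijection whose derivative is everywhere invertible has a smooth inverse. -/
theorem contDiff_inverse_of_hasFDerivAt_equiv {E F : Type*} [NormedAddCommGroup E]
    [NormedSpace ℝ E] [CompleteSpace E] [NormedAddCommGroup F] [NormedSpace ℝ F]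
    {f : E → F} {g : F → E} (hf : ContDiff ℝ ∞ f)
    (hgf : Function.LeftInverse g f) (hfg : Function.RightInverse g f)
    (h : ∀ x, ∃ e : E ≃L[ℝ] F, HasFDerivAt f (e : E →L[ℝ] F) x) : ContDiff ℝ ∞ g := by
  rw [contDiff_iff_contDiffAt]
  intro y
  obtain ⟨x, rfl⟩ : ∃ x, f x = y := ⟨g y, hfg y⟩
  obtain ⟨e, he⟩ := h x
  have hn : (∞ : WithTop ℕ∞) ≠ 0 := by simp
  have hloc := (hf.contDiffAt (x := x)).to_localInverse he hn
  refine hloc.congr_of_eventuallyEq ?_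
  have hs := ((hf.contDiffAt (x := x)).hasStrictFDerivAt' he hn)
  filter_upwards [hs.eventually_right_inverse] with z hz
  have : f (hs.localInverse f e x z) = f (g z) := by rw [hz, hfg z]
  have h2 := hgf.injective this
  rw [← h2]; rfl

/-- Compactness of the unit ball about `x` times [0, 1] bounds the partial derivative, which
provides the domination for differentiating under the integral. -/
theorem hasFDerivAt_intervalIntegral_of_contDiff {E H : Type*} [NormedAddCommGroup E]
    [NormedSpace ℝ E] [FiniteDimensional ℝ E] [NormedAddCommGroup H] [NormedSpace ℝ H]
    [CompleteSpace H] {G : E → ℝ → H} (hG : ContDiff ℝ 1 (fun p : E × ℝ => G p.1 p.2)) (x : E) :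
    HasFDerivAt (fun x => ∫ t in (0 : ℝ)..1, G x t)
      (∫ t in (0 : ℝ)..1, (fderiv ℝ (fun p : E × ℝ => G p.1 p.2) (x, t)).comp
        (ContinuousLinearMap.inl ℝ E ℝ)) x := by
  have hd : ∀ x t, HasFDerivAt (fun x => G x t)
      ((fderiv ℝ (fun p : E × ℝ => G p.1 p.2) (x, t)).comp (ContinuousLinearMap.inl ℝ E ℝ)) x := by
    intro x t
    have h1 : HasFDerivAt (fun p : E × ℝ => G p.1 p.2)
        (fderiv ℝ (fun p : E × ℝ => G p.1 p.2) (x, t)) (x, t) :=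
      (hG.differentiable (by simp) _).hasFDerivAt
    exact HasFDerivAt.comp (f := fun e : E => (e, t)) x h1 (hasFDerivAt_prodMk_left x t)
  have hc : Continuous (fun p : E × ℝ =>
      (fderiv ℝ (fun p : E × ℝ => G p.1 p.2) (p.1, p.2)).comp (ContinuousLinearMap.inl ℝ E ℝ)) :=
    (hG.continuous_fderiv (by simp)).clm_comp continuous_const
  obtain ⟨C, hC⟩ := ((isCompact_closedBall x (1 : ℝ)).prod
    (isCompact_Icc (a := (0 : ℝ)) (b := 1))).exists_bound_of_continuousOn hc.continuousOn
  refine intervalIntegral.hasFDerivAt_integral_of_dominated_of_fderiv_le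
    (𝕜 := ℝ) (F := G) (F' := fun x t => (fderiv ℝ (fun p : E × ℝ => G p.1 p.2) (x, t)).comp
      (ContinuousLinearMap.inl ℝ E ℝ)) (bound := fun _ => C)
      (Metric.closedBall_mem_nhds x one_pos) ?_ ?_ ?_ ?_ ?_ ?_
  · refine Eventually.of_forall fun y => ?_
    exact (hG.continuous.comp (by fun_prop : Continuous fun t : ℝ => (y, t))).aestronglyMeasurable
  · exact (hG.continuous.comp
      (by fun_prop : Continuous fun t : ℝ => (x, t))).intervalIntegrable 0 1
  · exact (hc.comp (by fun_prop : Continuous fun t : ℝ => (x, t))).aestronglyMeasurable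
  · refine Eventually.of_forall fun t ht y hy => ?_
    rw [uIoc_of_le zero_le_one] at ht
    exact hC (y, t) ⟨hy, ht.1.le, ht.2⟩
  · exact intervalIntegrable_const
  · exact Eventually.of_forall fun t _ y _ => hd y t

/-- The derivative of the integral is again such an integral, with values in `E →L[ℝ] H`; hence `H`
is quantified inside the induction, and all spaces live in `Type` so that the universe does not
change. -/
theorem contDiff_intervalIntegral_nat {E : Type} [NormedAddCommGroup E] [NormedSpace ℝ E]
    [FiniteDimensional ℝ E] (n : ℕ) :
    ∀ {H : Type} [NormedAddCommGroup H] [NormedSpace ℝ H] [CompleteSpace H] {G : E → ℝ → H},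
    ContDiff ℝ n (fun p : E × ℝ => G p.1 p.2) →
    ContDiff ℝ n (fun x => ∫ t in (0 : ℝ)..1, G x t) := by
  induction n with
  | zero =>
    intro H _ _ _ G hG
    rw [Nat.cast_zero, contDiff_zero] at hG ⊢
    exact intervalIntegral.continuous_parametric_intervalIntegral_of_continuous' hG 0 1
  | succ n ih =>
    intro H _ _ _ G hG
    have hG' : ContDiff ℝ n (fun p : E × ℝ =>
        (fderiv ℝ (fun p : E × ℝ => G p.1 p.2) (p.1, p.2)).comp (ContinuousLinearMap.inl ℝ E ℝ)) := by
      have : ContDiff ℝ n (fderiv ℝ (fun p : E × ℝ => G p.1 p.2)) :=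
        hG.fderiv_right (by norm_cast)
      exact this.clm_comp contDiff_const
    push_cast
    rw [contDiff_succ_iff_hasFDerivAt]
    exact ⟨_, ih (G := fun (x : E) (t : ℝ) => (fderiv ℝ (fun p : E × ℝ => G p.1 p.2) (x, t)).comp
      (ContinuousLinearMap.inl ℝ E ℝ)) hG', fun x =>
        hasFDerivAt_intervalIntegral_of_contDiff (hG.of_le (by norm_cast; omega)) x⟩

theorem contDiff_intervalIntegral {E H : Type} [NormedAddCommGroup E] [NormedSpace ℝ E]
    [FiniteDimensional ℝ E] [NormedAddCommGroup H] [NormedSpace ℝ H] [CompleteSpace H]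
    {G : E → ℝ → H} (hG : ContDiff ℝ ∞ (fun p : E × ℝ => G p.1 p.2)) :
    ContDiff ℝ ∞ (fun x => ∫ t in (0 : ℝ)..1, G x t) := by
  rw [contDiff_infty] at hG ⊢
  exact fun n => contDiff_intervalIntegral_nat n (hG n)


/-- The Poincaré lemma along a single ray. -/
theorem hasFDerivAt_integral_of_closed_on_ray {E : Type*} [NormedAddCommGroup E]
    [NormedSpace ℝ E] [FiniteDimensional ℝ E] {β : E → E →L[ℝ] ℝ} (hβ : ContDiff ℝ ∞ β) {z : E}
    (hz : ∀ t ∈ Icc (0 : ℝ) 1, ∀ u v, fderiv ℝ β (t • z) u v = fderiv ℝ β (t • z) v u) :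
    HasFDerivAt (fun x => ∫ t in (0 : ℝ)..1, β (t • x) x) (β z) z := by
  have hG : ContDiff ℝ ∞ (fun p : E × ℝ => β (p.2 • p.1) p.1) :=
    (hβ.comp (contDiff_snd.smul contDiff_fst)).clm_apply contDiff_fst
  have h := hasFDerivAt_intervalIntegral_of_contDiff (G := fun x t => β (t • x) x)
    (hG.of_le (by exact_mod_cast le_top)) z
  have hβd : ∀ y, HasFDerivAt β (fderiv ℝ β y) y := fun y =>
    (hβ.differentiable (by simp) y).hasFDerivAt
  suffices heq : β z = ∫ t in (0 : ℝ)..1,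
      (fderiv ℝ (fun p : E × ℝ => β (p.2 • p.1) p.1) (z, t)).comp
        (ContinuousLinearMap.inl ℝ E ℝ) by
    rw [heq]; exact h
  ext v
  have hc : Continuous (fun t : ℝ => (fderiv ℝ (fun p : E × ℝ => β (p.2 • p.1) p.1) (z, t)).comp
      (ContinuousLinearMap.inl ℝ E ℝ)) := by
    have : Continuous (fderiv ℝ (fun p : E × ℝ => β (p.2 • p.1) p.1)) :=
      hG.continuous_fderiv (by simp)
    exact (this.comp (by fun_prop : Continuous fun t : ℝ => (z, t))).clm_comp continuous_const
  rw [ContinuousLinearMap.intervalIntegral_apply (hc.intervalIntegrable 0 1)]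
  -- Symmetry of dβ along the ray makes the integrand the t-derivative of t β(tz) v, so the integral
  -- telescopes to β(z) v.
  have hval : ∀ t ∈ Icc (0 : ℝ) 1,
      HasDerivAt (fun t : ℝ => t • β (t • z) v)
        (((fderiv ℝ (fun p : E × ℝ => β (p.2 • p.1) p.1) (z, t)).comp
          (ContinuousLinearMap.inl ℝ E ℝ)) v) t := by
    intro t ht
    have e1 : HasFDerivAt (fun x : E => β (t • x) x)
        ((fderiv ℝ (fun p : E × ℝ => β (p.2 • p.1) p.1) (z, t)).comp
          (ContinuousLinearMap.inl ℝ E ℝ)) z :=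
      HasFDerivAt.comp (f := fun e : E => (e, t)) (g := fun p : E × ℝ => β (p.2 • p.1) p.1) z
        ((hG.differentiable (by simp) _).hasFDerivAt) (hasFDerivAt_prodMk_left z t)
    have e2 : HasFDerivAt (fun x : E => β (t • x)) ((fderiv ℝ β (t • z)).comp
        (t • ContinuousLinearMap.id ℝ E)) z :=
      (hβd (t • z)).comp z ((hasFDerivAt_id z).const_smul t)
    rw [e1.unique (e2.clm_apply (hasFDerivAt_id z))]
    have e3 : HasDerivAt (fun t : ℝ => β (t • z)) (fderiv ℝ β (t • z) z) t := by
      have := (hβd (t • z)).comp_hasDerivAt t ((hasDerivAt_id t).smul_const z)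
      rw [one_smul] at this
      exact this
    have e4 := (hasDerivAt_id t).smul (e3.clm_apply (hasDerivAt_const t v))
    have e5 : HasDerivAt (fun t : ℝ => t • β (t • z) v)
        (t • (fderiv ℝ β (t • z) z v + β (t • z) 0) + (1 : ℝ) • β (t • z) v) t := e4
    refine e5.congr_deriv ?_
    simp only [map_zero, add_zero, smul_eq_mul, one_mul, _root_.add_apply,
      ContinuousLinearMap.comp_apply, ContinuousLinearMap.flip_apply, _root_.smul_apply,
      ContinuousLinearMap.coe_id', id_eq, map_smul, ← hz t ht v z]
    ring
  rw [intervalIntegral.integral_eq_sub_of_hasDerivAt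
    (fun t ht => hval t (by rwa [uIcc_of_le zero_le_one] at ht))
    ((hc.clm_apply continuous_const).intervalIntegrable 0 1)]
  simp

/-- A smooth family of small perturbations of the identity has a smooth family of inverses. -/
theorem exists_contDiff_inverse_family {E : Type*} [NormedAddCommGroup E] [NormedSpace ℝ E]
    [FiniteDimensional ℝ E] {h : ℝ → E → E} (hh : ContDiff ℝ ∞ (fun p : ℝ × E => h p.1 p.2))
    (hs : ∀ t x, ‖fderiv ℝ (h t) x‖ ≤ 1 / 2) :
    ∃ ν : ℝ → E → E, ContDiff ℝ ∞ (fun p : ℝ × E => ν p.1 p.2) ∧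
      (∀ t x, ν t (x + h t x) = x) ∧ ∀ t x, ν t x + h t (ν t x) = x := by
  have : CompleteSpace E := FiniteDimensional.complete ℝ E
  have hht : ∀ t, ContDiff ℝ ∞ (h t) := fun t =>
    hh.comp (contDiff_const.prodMk contDiff_id : ContDiff ℝ ∞ fun x : E => (t, x))
  have hdt : ∀ t, Differentiable ℝ (h t) := fun t => (hht t).differentiable (by simp)
  have hlip : ∀ t, LipschitzWith (1 / 2) (h t) := fun t => by
    refine lipschitzWith_of_nnnorm_fderiv_le (𝕜 := ℝ) (hdt t) fun x => ?_
    rw [← NNReal.coe_le_coe]; simpa using hs t x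
  have happ : ∀ t, ApproximatesLinearOn (fun x => x + h t x)
      ((ContinuousLinearEquiv.refl ℝ E : E ≃L[ℝ] E) : E →L[ℝ] E) univ (1 / 2) := fun t x _ y _ => by
    have := (hlip t).dist_le_mul x y
    rw [dist_eq_norm, dist_eq_norm] at this
    have he : x + h t x - (y + h t y) - (x - y) = h t x - h t y := by abel
    change ‖x + h t x - (y + h t y) - (x - y)‖ ≤ _
    rw [he]
    exact this
  have hc : Subsingleton E ∨ (1 / 2 : NNReal) <
      ‖(((ContinuousLinearEquiv.refl ℝ E).symm : E ≃L[ℝ] E) : E →L[ℝ] E)‖₊⁻¹ := by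
    rcases subsingleton_or_nontrivial E with h1 | h1
    · exact Or.inl h1
    · right
      have : ‖(((ContinuousLinearEquiv.refl ℝ E).symm : E ≃L[ℝ] E) : E →L[ℝ] E)‖₊ = 1 := by
        rw [ContinuousLinearEquiv.refl_symm, ContinuousLinearEquiv.coe_refl]
        exact ContinuousLinearMap.nnnorm_id
      rw [this]
      rw [← NNReal.coe_lt_coe]; norm_num
  let Φ : ∀ t, E ≃ₜ E := fun t => (happ t).toHomeomorph _ hc
  have hΦ : ∀ t x, Φ t x = x + h t x := fun t x => rfl
  refine ⟨fun t => (Φ t).symm, ?_, fun t x => ?_, fun t x => ?_⟩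
  rotate_left
  · rw [← hΦ]; exact (Φ t).symm_apply_apply x
  · rw [← hΦ]; exact (Φ t).apply_symm_apply x
  -- With the parameter as an extra coordinate, joint smoothness of the inverses is smoothness of a
  -- single inverse map.
  let f : ℝ × E → ℝ × E := fun p => (p.1, p.2 + h p.1 p.2)
  let g : ℝ × E → ℝ × E := fun p => (p.1, (Φ p.1).symm p.2)
  have hf : ContDiff ℝ ∞ f := contDiff_fst.prodMk (contDiff_snd.add hh)
  have hg : ContDiff ℝ ∞ g := by
    refine contDiff_inverse_of_hasFDerivAt_equiv hf (fun p => ?_) (fun p => ?_) (fun p => ?_)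
    · simp only [f, g]; rw [← hΦ, Homeomorph.symm_apply_apply]
    · simp only [f, g]; rw [← hΦ, Homeomorph.apply_symm_apply]
    · set L := fderiv ℝ (fun p : ℝ × E => h p.1 p.2) p with hL
      have hLd : HasFDerivAt (fun p : ℝ × E => h p.1 p.2) L p :=
        (hh.differentiable (by simp) p).hasFDerivAt
      have hfd : HasFDerivAt f ((ContinuousLinearMap.fst ℝ ℝ E).prod
          (ContinuousLinearMap.snd ℝ ℝ E + L)) p :=
        hasFDerivAt_fst.prodMk (hasFDerivAt_snd.add hLd)
      have hLp : fderiv ℝ (h p.1) p.2 = L.comp (ContinuousLinearMap.inr ℝ ℝ E) := by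
        have : HasFDerivAt (fun x => h p.1 x) (L.comp (ContinuousLinearMap.inr ℝ ℝ E)) p.2 :=
          HasFDerivAt.comp (f := fun x : E => (p.1, x)) p.2 hLd (hasFDerivAt_prodMk_right p.1 p.2)
        exact this.fderiv
      set T := (ContinuousLinearMap.fst ℝ ℝ E).prod (ContinuousLinearMap.snd ℝ ℝ E + L) with hT
      -- The derivative is block triangular, and its block on `E` differs from the identity by an
      -- operator of norm at most 1/2.
      have hinj : Function.Injective T.toLinearMap := by
        rw [← LinearMap.ker_eq_bot, LinearMap.ker_eq_bot']
        rintro ⟨s, v⟩ hv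
        have h1 : s = 0 := congrArg Prod.fst hv
        subst h1
        have h2 : v + L (0, v) = 0 := congrArg Prod.snd hv
        have h3 : ‖L (0, v)‖ ≤ 1 / 2 * ‖v‖ := by
          have := (fderiv ℝ (h p.1) p.2).le_of_opNorm_le (hs p.1 p.2) v
          rwa [hLp] at this
        have h4 : ‖v‖ = ‖L (0, v)‖ := by
          rw [eq_neg_of_add_eq_zero_left h2, norm_neg]
          rw [← eq_neg_of_add_eq_zero_left h2]
        have h5 : ‖v‖ = 0 := by
          have := norm_nonneg v
          linarith
        rw [norm_eq_zero] at h5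
        rw [h5]; rfl
      have hsurj : Function.Surjective T.toLinearMap := LinearMap.injective_iff_surjective.mp hinj
      refine ⟨ContinuousLinearEquiv.ofBijective T (LinearMap.ker_eq_bot.mpr hinj)
        (LinearMap.range_eq_top.mpr hsurj), ?_⟩
      rw [ContinuousLinearEquiv.coe_ofBijective]
      exact hfd
  exact contDiff_snd.comp hg

/-! ### Symplectic linear algebra and symplectic gradients -/

/-- The standard symplectic form as a continuous bilinear map. -/
noncomputable def symplecticBilin : (ℂ × ℂ) →L[ℝ] (ℂ × ℂ) →L[ℝ] ℝ :=
  let p₁ := ContinuousLinearMap.fst ℝ ℂ ℂ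
  let p₂ := ContinuousLinearMap.snd ℝ ℂ ℂ
  (Complex.reCLM.comp p₁).smulRight (Complex.imCLM.comp p₁)
    - (Complex.imCLM.comp p₁).smulRight (Complex.reCLM.comp p₁)
    + ((Complex.reCLM.comp p₂).smulRight (Complex.imCLM.comp p₂)
    - (Complex.imCLM.comp p₂).smulRight (Complex.reCLM.comp p₂))

theorem stdSymplecticForm_eq (u v : ℂ × ℂ) : stdSymplecticForm u v =
    (u.1.re * v.1.im - u.1.im * v.1.re) + (u.2.re * v.2.im - u.2.im * v.2.re) := by
  simp [stdSymplecticForm]; ring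

theorem symplecticBilin_apply (u v : ℂ × ℂ) : symplecticBilin u v = stdSymplecticForm u v := by
  rw [stdSymplecticForm_eq]
  simp [symplecticBilin]

/-- The projection of `ℂ²` onto its real coordinates `x`. -/
noncomputable def projRe : (ℂ × ℂ) →L[ℝ] ℂ × ℂ :=
  (Complex.ofRealCLM.comp Complex.reCLM).prodMap (Complex.ofRealCLM.comp Complex.reCLM)

/-- The projection of `ℂ²` onto its imaginary coordinates `y`. -/
noncomputable def projIm : (ℂ × ℂ) →L[ℝ] ℂ × ℂ :=
  ContinuousLinearMap.id ℝ (ℂ × ℂ) - projRe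

theorem projRe_apply (v : ℂ × ℂ) : projRe v = (↑v.1.re, ↑v.2.re) := rfl

theorem projIm_apply (v : ℂ × ℂ) : projIm v = (↑v.1.im * Complex.I, ↑v.2.im * Complex.I) := by
  have h (z : ℂ) : z - (z.re : ℂ) = z.im * Complex.I := by
    linear_combination -(Complex.re_add_im z)
  exact Prod.ext (h v.1) (h v.2)

theorem projRe_add_projIm (v : ℂ × ℂ) : projRe v + projIm v = v := by
  simp [projIm]

theorem norm_projRe_le : ‖projRe‖ ≤ 1 := by
  refine ContinuousLinearMap.opNorm_le_bound _ zero_le_one fun v => ?_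
  rw [projRe_apply, one_mul, Prod.norm_def, Prod.norm_def]
  refine max_le_max ?_ ?_ <;> simp only [Complex.norm_real, Real.norm_eq_abs] <;>
    exact Complex.abs_re_le_norm _

theorem norm_projIm_le : ‖projIm‖ ≤ 1 := by
  refine ContinuousLinearMap.opNorm_le_bound _ zero_le_one fun v => ?_
  rw [projIm_apply, one_mul, Prod.norm_def, Prod.norm_def]
  refine max_le_max ?_ ?_ <;>
    simp only [norm_mul, Complex.norm_I, mul_one, Complex.norm_real, Real.norm_eq_abs] <;>
    exact Complex.abs_im_le_norm _

/-- The inverse of the isomorphism `u ↦ ω(u, ·)`. -/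
noncomputable def symplecticSharp : ((ℂ × ℂ) →L[ℝ] ℝ) →L[ℝ] ℂ × ℂ :=
  let e (w : ℂ × ℂ) (c : ℂ) : ((ℂ × ℂ) →L[ℝ] ℝ) →L[ℝ] ℂ :=
    (ContinuousLinearMap.apply ℝ ℝ w).smulRight c
  (e (Complex.I, 0) 1 - e (1, 0) Complex.I).prod (e (0, Complex.I) 1 - e (0, 1) Complex.I)

theorem symplecticSharp_apply (L : (ℂ × ℂ) →L[ℝ] ℝ) : symplecticSharp L =
    (L (Complex.I, 0) - L (1, 0) * Complex.I, L (0, Complex.I) - L (0, 1) * Complex.I) := by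
  simp [symplecticSharp]

theorem stdSymplecticForm_sharp (L : (ℂ × ℂ) →L[ℝ] ℝ) (v : ℂ × ℂ) :
    stdSymplecticForm (symplecticSharp L) v = L v := by
  have hv : v = v.1.re • ((1, 0) : ℂ × ℂ) + v.1.im • ((Complex.I, 0) : ℂ × ℂ)
      + v.2.re • ((0, 1) : ℂ × ℂ) + v.2.im • ((0, Complex.I) : ℂ × ℂ) := by
    ext <;> simp
  conv_rhs => rw [hv]
  simp only [map_add, map_smul, smul_eq_mul]
  rw [stdSymplecticForm_eq, symplecticSharp_apply]
  simp
  ring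

theorem eq_of_stdSymplecticForm_eq {u u' : ℂ × ℂ}
    (h : ∀ v, stdSymplecticForm u v = stdSymplecticForm u' v) : u = u' := by
  have h1 := h (1, 0)
  have h2 := h (Complex.I, 0)
  have h3 := h (0, 1)
  have h4 := h (0, Complex.I)
  simp only [stdSymplecticForm_eq] at h1 h2 h3 h4
  norm_num at h1 h2 h3 h4
  exact Prod.ext (Complex.ext h2 h1) (Complex.ext h4 h3)

/-- The symplectic gradient (Hamiltonian vector field) `X` of `S`, with `ω(X, ·) = dS`. -/
noncomputable def symplecticGradient (S : ℂ × ℂ → ℝ) (z : ℂ × ℂ) : ℂ × ℂ :=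
  symplecticSharp (fderiv ℝ S z)

theorem stdSymplecticForm_gradient (S : ℂ × ℂ → ℝ) (z v : ℂ × ℂ) :
    stdSymplecticForm (symplecticGradient S z) v = fderiv ℝ S z v :=
  stdSymplecticForm_sharp _ _

theorem ContDiff.symplecticGradient {S : ℂ × ℂ → ℝ} (hS : ContDiff ℝ ∞ S) :
    ContDiff ℝ ∞ (symplecticGradient S) :=
  symplecticSharp.contDiff.comp (hS.fderiv_right (by simp))

theorem fderiv_symplecticGradient {S : ℂ × ℂ → ℝ} (hS : ContDiff ℝ ∞ S) (z : ℂ × ℂ) :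
    fderiv ℝ (symplecticGradient S) z = symplecticSharp.comp (fderiv ℝ (fderiv ℝ S) z) := by
  have h1 : DifferentiableAt ℝ (fderiv ℝ S) z :=
    (hS.fderiv_right (m := ∞) (by simp)).differentiable (by simp) z
  exact (symplecticSharp.hasFDerivAt.comp z h1.hasFDerivAt).fderiv

/-- This is the symmetry of the Hessian of `S`: the derivative of the gradient is infinitesimally
symplectic. -/
theorem stdSymplecticForm_fderiv_gradient_comm {S : ℂ × ℂ → ℝ} (hS : ContDiff ℝ ∞ S)
    (z u v : ℂ × ℂ) : stdSymplecticForm (fderiv ℝ (symplecticGradient S) z u) v =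
      stdSymplecticForm (fderiv ℝ (symplecticGradient S) z v) u := by
  rw [fderiv_symplecticGradient hS]
  simp only [ContinuousLinearMap.comp_apply, stdSymplecticForm_sharp]
  have : IsSymmSndFDerivAt ℝ S z :=
    hS.contDiffAt.isSymmSndFDerivAt (by simp only [minSmoothness_of_isRCLikeNormedField]; exact WithTop.coe_le_coe.mpr le_top)
  exact this.eq u v

/-! ### Symplectic isotopies and generating functions -/

/-- An isotopy of symplectomorphisms `Φ` of `ℂ²`, parametrized by `ℝ` and starting at the identity,
with inverse isotopy `Ψ`, that fixes the points of `P`. -/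
structure IsSymplecticIsotopyFixing (P : Set (ℂ × ℂ)) (Φ Ψ : ℝ → ℂ × ℂ → ℂ × ℂ) : Prop where
  smooth : ContDiff ℝ ∞ (fun p : ℝ × (ℂ × ℂ) => Φ p.1 p.2)
  smooth_inv : ContDiff ℝ ∞ (fun p : ℝ × (ℂ × ℂ) => Ψ p.1 p.2)
  left_inv : ∀ t z, Ψ t (Φ t z) = z
  right_inv : ∀ t z, Φ t (Ψ t z) = z
  symplectic : ∀ t x u v,
    stdSymplecticForm (fderiv ℝ (Φ t) x u) (fderiv ℝ (Φ t) x v) = stdSymplecticForm u v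
  start : ∀ z, Φ 0 z = z
  fixes : ∀ t, ∀ z ∈ P, Φ t z = z

namespace IsSymplecticIsotopyFixing

variable {P : Set (ℂ × ℂ)} {Φ Ψ Φ' Ψ' : ℝ → ℂ × ℂ → ℂ × ℂ}

theorem contDiff_apply (h : IsSymplecticIsotopyFixing P Φ Ψ) (t : ℝ) : ContDiff ℝ ∞ (Φ t) :=
  h.smooth.comp (contDiff_const.prodMk contDiff_id : ContDiff ℝ ∞ fun z : ℂ × ℂ => (t, z))

theorem contDiff_inv_apply (h : IsSymplecticIsotopyFixing P Φ Ψ) (t : ℝ) : ContDiff ℝ ∞ (Ψ t) :=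
  h.smooth_inv.comp (contDiff_const.prodMk contDiff_id : ContDiff ℝ ∞ fun z : ℂ × ℂ => (t, z))

theorem differentiableAt (h : IsSymplecticIsotopyFixing P Φ Ψ) (t : ℝ) (z : ℂ × ℂ) :
    DifferentiableAt ℝ (Φ t) z := (h.contDiff_apply t).differentiable (by simp) z

theorem differentiableAt_inv (h : IsSymplecticIsotopyFixing P Φ Ψ) (t : ℝ) (z : ℂ × ℂ) :
    DifferentiableAt ℝ (Ψ t) z := (h.contDiff_inv_apply t).differentiable (by simp) z

theorem fderiv_comp_fderiv_inv (h : IsSymplecticIsotopyFixing P Φ Ψ) (t : ℝ) (z u : ℂ × ℂ) :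
    fderiv ℝ (Φ t) (Ψ t z) (fderiv ℝ (Ψ t) z u) = u := by
  have h1 := ((h.differentiableAt t (Ψ t z)).hasFDerivAt.comp z
    (h.differentiableAt_inv t z).hasFDerivAt)
  have h2 : Φ t ∘ Ψ t = id := funext fun z => h.right_inv t z
  rw [h2] at h1
  have h3 := h1.unique (hasFDerivAt_id z)
  exact congrArg (fun L : (ℂ × ℂ) →L[ℝ] ℂ × ℂ => L u) h3

theorem symm (h : IsSymplecticIsotopyFixing P Φ Ψ) : IsSymplecticIsotopyFixing P Ψ Φ where
  smooth := h.smooth_inv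
  smooth_inv := h.smooth
  left_inv := h.right_inv
  right_inv := h.left_inv
  symplectic t x u v := by
    rw [← h.symplectic t (Ψ t x), h.fderiv_comp_fderiv_inv, h.fderiv_comp_fderiv_inv]
  start z := by conv_lhs => rw [← h.start z, h.left_inv]
  fixes t z hz := by conv_lhs => rw [← h.fixes t z hz, h.left_inv]

theorem comp (h : IsSymplecticIsotopyFixing P Φ Ψ) (h' : IsSymplecticIsotopyFixing P Φ' Ψ') :
    IsSymplecticIsotopyFixing P (fun t z => Φ t (Φ' t z)) (fun t z => Ψ' t (Ψ t z)) where
  smooth := h.smooth.comp (contDiff_fst.prodMk h'.smooth)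
  smooth_inv := h'.smooth_inv.comp (contDiff_fst.prodMk h.smooth_inv)
  left_inv t z := by rw [h.left_inv, h'.left_inv]
  right_inv t z := by rw [h'.right_inv, h.right_inv]
  symplectic t x u v := by
    have h1 : fderiv ℝ (fun z => Φ t (Φ' t z)) x =
        (fderiv ℝ (Φ t) (Φ' t x)).comp (fderiv ℝ (Φ' t) x) :=
      fderiv_comp x (h.differentiableAt t _) (h'.differentiableAt t x)
    rw [h1]
    simp only [ContinuousLinearMap.comp_apply, h.symplectic, h'.symplectic]
  start z := by rw [h'.start, h.start]
  fixes t z hz := by rw [h'.fixes t z hz, h.fixes t z hz]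

protected theorem refl (P : Set (ℂ × ℂ)) :
    IsSymplecticIsotopyFixing P (fun _ z => z) (fun _ z => z) where
  smooth := contDiff_snd
  smooth_inv := contDiff_snd
  left_inv _ _ := rfl
  right_inv _ _ := rfl
  symplectic t x u v := by simp
  start _ := rfl
  fixes _ _ _ := rfl

theorem isSymplecticIsotopy (h : IsSymplecticIsotopyFixing P Φ Ψ) : IsSymplecticIsotopy Φ where
  smooth := h.smooth.contDiffOn
  symplecto t _ := ⟨h.contDiff_apply t, ⟨Ψ t, h.contDiff_inv_apply t, h.left_inv t, h.right_inv t⟩,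
    h.symplectic t⟩
  start := h.start

end IsSymplecticIsotopyFixing

/-- The real and imaginary planes are Lagrangian, so the two sides differ by ω(Au, v) + ω(u, Av),
which vanishes by `hA`. -/
theorem stdSymplecticForm_add_projRe {A : (ℂ × ℂ) →L[ℝ] ℂ × ℂ}
    (hA : ∀ u v, stdSymplecticForm (A u) v = stdSymplecticForm (A v) u) (u v : ℂ × ℂ) :
    stdSymplecticForm (u + projRe (A u)) (v + projRe (A v)) =
      stdSymplecticForm (u - projIm (A u)) (v - projIm (A v)) := by
  have h := hA u v
  simp only [stdSymplecticForm_eq, projRe_apply, projIm_apply] at h ⊢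
  simp
  linarith

/-- A function `S` with small second derivative is the generating function of a symplectic
isotopy. -/
theorem exists_isotopy_of_generatingFunction {P : Set (ℂ × ℂ)} {S : ℂ × ℂ → ℝ}
    (hS : ContDiff ℝ ∞ S) (hsmall : ∀ z, ‖fderiv ℝ (symplecticGradient S) z‖ ≤ 1 / 2)
    (hP : ∀ z ∈ P, symplecticGradient S z = 0) :
    ∃ Φ Ψ, IsSymplecticIsotopyFixing P Φ Ψ ∧
      ∀ w, Φ 1 (w - projIm (symplecticGradient S w)) =
        w + projRe (symplecticGradient S w) := by
  set X := symplecticGradient S with hX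
  have hXs : ContDiff ℝ ∞ X := hS.symplecticGradient
  have hXd : ∀ z, HasFDerivAt X (fderiv ℝ X z) z := fun z =>
    (hXs.differentiable (by simp) z).hasFDerivAt
  -- The time function takes values in [0, 1], so the scaled generating function stays small for
  -- every real time.
  let σ : ℝ → ℝ := Real.smoothTransition
  have hσ : ContDiff ℝ ∞ σ := Real.smoothTransition.contDiff
  have hσ1 : ∀ t, |σ t| ≤ 1 := fun t => by
    rw [abs_of_nonneg (Real.smoothTransition.nonneg t)]; exact Real.smoothTransition.le_one t
  let h₁ : ℝ → ℂ × ℂ → ℂ × ℂ := fun t z => -(σ t • projIm (X z))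
  let h₂ : ℝ → ℂ × ℂ → ℂ × ℂ := fun t z => σ t • projRe (X z)
  have h₁s : ContDiff ℝ ∞ (fun p : ℝ × (ℂ × ℂ) => h₁ p.1 p.2) :=
    ((hσ.comp contDiff_fst).smul (projIm.contDiff.comp (hXs.comp contDiff_snd))).neg
  have h₂s : ContDiff ℝ ∞ (fun p : ℝ × (ℂ × ℂ) => h₂ p.1 p.2) :=
    (hσ.comp contDiff_fst).smul (projRe.contDiff.comp (hXs.comp contDiff_snd))
  have h₁d : ∀ t z, HasFDerivAt (h₁ t) (-(σ t • projIm.comp (fderiv ℝ X z))) z := fun t z =>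
    ((projIm.hasFDerivAt.comp z (hXd z)).const_smul (σ t)).neg
  have h₂d : ∀ t z, HasFDerivAt (h₂ t) (σ t • projRe.comp (fderiv ℝ X z)) z := fun t z =>
    (projRe.hasFDerivAt.comp z (hXd z)).const_smul (σ t)
  have key : ∀ (t : ℝ) (z : ℂ × ℂ) (L : (ℂ × ℂ) →L[ℝ] ℂ × ℂ), ‖L‖ ≤ 1 →
      ‖σ t • L.comp (fderiv ℝ X z)‖ ≤ 1 / 2 := fun t z L hL => by
    rw [norm_smul, Real.norm_eq_abs]
    calc |σ t| * ‖L.comp (fderiv ℝ X z)‖ ≤ 1 * (‖L‖ * ‖fderiv ℝ X z‖) := by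
          gcongr
          · exact hσ1 t
          · exact ContinuousLinearMap.opNorm_comp_le _ _
      _ ≤ 1 * (1 * (1 / 2)) := by
          gcongr
          exact hsmall z
      _ = 1 / 2 := by norm_num
  obtain ⟨ν₁, ν₁s, ν₁l, ν₁r⟩ := exists_contDiff_inverse_family h₁s fun t z => by
    rw [(h₁d t z).fderiv, norm_neg]; exact key t z _ norm_projIm_le
  obtain ⟨ν₂, ν₂s, ν₂l, ν₂r⟩ := exists_contDiff_inverse_family h₂s fun t z => by
    rw [(h₂d t z).fderiv]; exact key t z _ norm_projRe_le
  have hσ0 : σ 0 = 0 := Real.smoothTransition.zero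
  have hσ11 : σ 1 = 1 := Real.smoothTransition.one
  -- The isotopy is (id + σ Re X) ∘ (id − σ i Im X)⁻¹. The inverse exchanges the two factors, and
  -- both fix the zeros of X.
  refine ⟨fun t z => ν₁ t z + h₂ t (ν₁ t z), fun t z => ν₂ t z + h₁ t (ν₂ t z), ?_, ?_⟩
  · refine ⟨?_, ?_, ?_, ?_, ?_, ?_, ?_⟩
    · exact ν₁s.add (h₂s.comp (contDiff_fst.prodMk ν₁s))
    · exact ν₂s.add (h₁s.comp (contDiff_fst.prodMk ν₂s))
    · intro t z; simp only [ν₂l, ν₁r]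
    · intro t z; simp only [ν₁l, ν₂r]
    · intro t x u v
      have hν : HasFDerivAt (ν₁ t) (fderiv ℝ (ν₁ t) x) x := by
        have : ContDiff ℝ ∞ (ν₁ t) := ν₁s.comp
          (contDiff_const.prodMk contDiff_id : ContDiff ℝ ∞ fun z : ℂ × ℂ => (t, z))
        exact (this.differentiable (by simp) x).hasFDerivAt
      set N := fderiv ℝ (ν₁ t) x
      have hd2 := hν.add ((h₂d t (ν₁ t x)).comp x hν)
      have hd1 := hν.add ((h₁d t (ν₁ t x)).comp x hν)
      have hid : (ν₁ t + h₁ t ∘ ν₁ t) = id := funext fun z => ν₁r t z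
      rw [hid] at hd1
      have hN := hd1.unique (hasFDerivAt_id x)
      have hN' : ∀ w, w = N w - projIm ((σ t • fderiv ℝ X (ν₁ t x)) (N w)) := fun w => by
        have := congrArg (fun L : (ℂ × ℂ) →L[ℝ] ℂ × ℂ => L w) hN
        simp only [_root_.add_apply, ContinuousLinearMap.comp_apply,
          _root_.neg_apply, _root_.smul_apply,
          ContinuousLinearMap.coe_id', id_eq] at this
        rw [_root_.smul_apply, map_smul, sub_eq_add_neg]
        exact this.symm
      have hM : ∀ w, fderiv ℝ (fun z => ν₁ t z + h₂ t (ν₁ t z)) x w =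
          N w + projRe ((σ t • fderiv ℝ X (ν₁ t x)) (N w)) := fun w => by
        have : fderiv ℝ (fun z => ν₁ t z + h₂ t (ν₁ t z)) x = _ := hd2.fderiv
        rw [this, _root_.smul_apply, map_smul]
        rfl
      rw [hM, hM, stdSymplecticForm_add_projRe, ← hN', ← hN']
      intro a b
      simp only [_root_.smul_apply]
      rw [← symplecticBilin_apply, ← symplecticBilin_apply]
      simp only [map_smul, _root_.smul_apply, symplecticBilin_apply]
      rw [stdSymplecticForm_fderiv_gradient_comm hS]
    · intro z
      have h1 : ν₁ 0 z = z := by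
        have := ν₁r 0 z
        simpa [h₁, hσ0] using this
      simp [h1, h₂, hσ0]
    · intro t z hz
      have h0 : h₁ t z = 0 := by simp [h₁, hP z hz]
      have h1 : ν₁ t z = z := by
        have := ν₁l t z
        rwa [h0, add_zero] at this
      simp [h1, h₂, hP z hz]
  · intro w
    have h1 : w - projIm (X w) = w + h₁ 1 w := by simp [h₁, hσ11, sub_eq_add_neg]
    simp only [h1, ν₁l]
    simp [h₂, hσ11]

/-! ### The Hopf disc and its boundary circle -/

/-- The boundary circle of the Hopf disc of `E(1, a)`. -/
def hopfCircle : Set (ℂ × ℂ) :=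
  {z | Real.pi * ‖z.1‖ ^ 2 = 1 ∧ z.2 = 0}

theorem mem_hopfDisc {a : ℝ} {z : ℂ × ℂ} :
    z ∈ hopfDisc a ↔ Real.pi * ‖z.1‖ ^ 2 ≤ 1 ∧ z.2 = 0 := by
  constructor
  · rintro ⟨h1, h2⟩
    refine ⟨?_, h2⟩
    simpa [ellipsoid, h2] using h1
  · rintro ⟨h1, h2⟩
    refine ⟨?_, h2⟩
    simpa [ellipsoid, h2] using h1

theorem hopfCircle_subset (a : ℝ) : hopfCircle ⊆ hopfDisc a := fun _ hz =>
  mem_hopfDisc.mpr ⟨hz.1.le, hz.2⟩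

theorem norm_le_one_of_pi_mul_sq_le {z : ℂ} (h : Real.pi * ‖z‖ ^ 2 ≤ 2) : ‖z‖ ≤ 1 := by
  have := Real.pi_gt_three
  nlinarith [norm_nonneg z, sq_nonneg ‖z‖]

theorem isCompact_of_isClosed_of_subset_hopfDisc {a : ℝ} {K : Set (ℂ × ℂ)} (hK : IsClosed K)
    (h : K ⊆ hopfDisc a) : IsCompact K := by
  refine Metric.isCompact_of_isClosed_isBounded hK
    ((Metric.isBounded_closedBall (x := (0 : ℂ × ℂ)) (r := 1)).subset fun z hz => ?_)
  obtain ⟨h1, h2⟩ := mem_hopfDisc.mp (h hz)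
  rw [mem_closedBall_zero_iff, Prod.norm_def, h2, norm_zero]
  exact max_le (norm_le_one_of_pi_mul_sq_le (by linarith)) zero_le_one

theorem isClosed_hopfDisc (a : ℝ) : IsClosed (hopfDisc a) := by
  have : hopfDisc a = {z | Real.pi * ‖z.1‖ ^ 2 ≤ 1} ∩ {z | z.2 = 0} := by
    ext z; exact mem_hopfDisc
  rw [this]
  exact (isClosed_le (by fun_prop) (by fun_prop)).inter (isClosed_eq (by fun_prop) (by fun_prop))

theorem isClosed_hopfCircle : IsClosed hopfCircle :=
  (isClosed_eq (f := fun z : ℂ × ℂ => Real.pi * ‖z.1‖ ^ 2) (g := fun _ => 1)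
    (by fun_prop) (by fun_prop)).inter
    (isClosed_eq (f := fun z : ℂ × ℂ => z.2) (g := fun _ => 0) (by fun_prop) (by fun_prop))

/-! ### Cutoffs at scale ε and Taylor estimates -/

section Bounds

variable {E G : Type*} [NormedAddCommGroup E] [NormedSpace ℝ E] [NormedAddCommGroup G]
  [NormedSpace ℝ G]

/-- All derivatives of `k` are bounded. -/
def HasBoundedDerivs (k : ℝ → ℝ) : Prop :=
  ∀ n : ℕ, ∃ C, ∀ s, ‖iteratedFDeriv ℝ n k s‖ ≤ C

theorem HasCompactSupport.hasBoundedDerivs {k : ℝ → ℝ} (h : HasCompactSupport k)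
    (hk : ContDiff ℝ ∞ k) : HasBoundedDerivs k := fun n =>
  (hk.continuous_iteratedFDeriv (m := n) (by exact_mod_cast le_top)).bounded_above_of_compact_support
    (h.iteratedFDeriv n)

/-- A smooth function equal to `1` for `s ≤ 1 / 2` and to `0` for `s ≥ 1`. -/
noncomputable def stepDown (s : ℝ) : ℝ := Real.smoothTransition (2 - 2 * s)

/-- A smooth function equal to `1` for `|s| ≤ 1 / 2` and to `0` for `|s| ≥ 1`. -/
noncomputable def bumpAtZero (s : ℝ) : ℝ := stepDown s * stepDown (-s)

theorem contDiff_stepDown : ContDiff ℝ ∞ stepDown :=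
  Real.smoothTransition.contDiff.comp (by fun_prop)

theorem contDiff_bumpAtZero : ContDiff ℝ ∞ bumpAtZero :=
  contDiff_stepDown.mul (contDiff_stepDown.comp contDiff_neg)

theorem stepDown_eq_one {s : ℝ} (h : s ≤ 1 / 2) : stepDown s = 1 :=
  Real.smoothTransition.one_of_one_le (by linarith)

theorem stepDown_eq_zero {s : ℝ} (h : 1 ≤ s) : stepDown s = 0 :=
  Real.smoothTransition.zero_of_nonpos (by linarith)

theorem bumpAtZero_eq_one {s : ℝ} (h : |s| ≤ 1 / 2) : bumpAtZero s = 1 := by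
  rw [abs_le] at h
  rw [bumpAtZero, stepDown_eq_one h.2, stepDown_eq_one (by linarith), one_mul]

theorem bumpAtZero_eq_zero {s : ℝ} (h : 1 ≤ |s|) : bumpAtZero s = 0 := by
  rw [bumpAtZero]
  rcases le_abs.mp h with h | h
  · rw [stepDown_eq_zero h, zero_mul]
  · rw [stepDown_eq_zero h, mul_zero]

theorem hasBoundedDerivs_bumpAtZero : HasBoundedDerivs bumpAtZero := by
  refine HasCompactSupport.hasBoundedDerivs ?_ contDiff_bumpAtZero
  refine HasCompactSupport.of_support_subset_isCompact (isCompact_Icc (a := -1) (b := 1)) ?_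
  intro s hs
  rw [mem_Icc, ← abs_le]
  by_contra h
  exact hs (bumpAtZero_eq_zero (not_le.mp h).le)

/-- The function is constant for s < 1/2 and agrees with the compactly supported `bumpAtZero` for s
> −1/2. -/
theorem hasBoundedDerivs_stepDown : HasBoundedDerivs stepDown := fun n => by
  obtain ⟨C, hC⟩ := hasBoundedDerivs_bumpAtZero n
  refine ⟨max C ‖iteratedFDeriv ℝ n (fun _ : ℝ => (1 : ℝ)) 0‖, fun s => ?_⟩
  rcases lt_or_ge s (1 / 2) with h | h
  · have he : stepDown =ᶠ[𝓝 s] fun _ => 1 := by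
      filter_upwards [Iio_mem_nhds h] with x hx using stepDown_eq_one (le_of_lt hx)
    rw [he.iteratedFDeriv ℝ n |>.eq_of_nhds]
    refine le_max_of_le_right (le_of_eq ?_)
    rcases n with _ | n
    · simp
    · rw [iteratedFDeriv_succ_const, Pi.zero_apply, Pi.zero_apply]
  · have he : stepDown =ᶠ[𝓝 s] bumpAtZero := by
      filter_upwards [Ioi_mem_nhds (show -(1 / 2) < s by linarith)] with x hx
      rw [bumpAtZero, stepDown_eq_one (s := -x) (by linarith [mem_Ioi.mp hx]), mul_one]
    rw [he.iteratedFDeriv ℝ n |>.eq_of_nhds]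
    exact le_max_of_le_left (hC s)

/-- The derivatives up to order `m` of the family `χ ε` are bounded on `B` by powers of `1 / ε`. -/
def HasScaledBounds (m : ℕ) (B : Set E) (χ : ℝ → E → ℝ) : Prop :=
  ∃ C, ∀ ε, 0 < ε → ε ≤ 1 → ∀ n ≤ m, ∀ z ∈ B, ‖iteratedFDeriv ℝ n (χ ε) z‖ ≤ C / ε ^ n

theorem HasScaledBounds.mul {m : ℕ} {B : Set E} {χ χ' : ℝ → E → ℝ} (h : HasScaledBounds m B χ)
    (h' : HasScaledBounds m B χ') (hs : ∀ ε, ContDiff ℝ ∞ (χ ε)) (hs' : ∀ ε, ContDiff ℝ ∞ (χ' ε)) :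
    HasScaledBounds m B (fun ε z => χ ε z * χ' ε z) := by
  obtain ⟨C, hC⟩ := h
  obtain ⟨C', hC'⟩ := h'
  refine ⟨2 ^ m * (|C| * |C'|), fun ε h0 h1 n hn z hz => ?_⟩
  refine (norm_iteratedFDeriv_mul_le (hs ε) (hs' ε) z (n := n) (by exact_mod_cast le_top)).trans ?_
  calc _ ≤ ∑ i ∈ Finset.range (n + 1), (n.choose i : ℝ) * (|C| * |C'| / ε ^ n) := by
        refine Finset.sum_le_sum fun i hi => ?_
        have hi' : i ≤ n := Nat.lt_succ_iff.mp (Finset.mem_range.mp hi)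
        rw [mul_assoc]
        refine mul_le_mul_of_nonneg_left ?_ (Nat.cast_nonneg _)
        have e1 : ‖iteratedFDeriv ℝ i (χ ε) z‖ ≤ |C| / ε ^ i :=
          (hC ε h0 h1 i (hi'.trans hn) z hz).trans (by gcongr; exact le_abs_self C)
        have e2 : ‖iteratedFDeriv ℝ (n - i) (χ' ε) z‖ ≤ |C'| / ε ^ (n - i) :=
          (hC' ε h0 h1 (n - i) ((Nat.sub_le _ _).trans hn) z hz).trans
            (by gcongr; exact le_abs_self C')
        calc _ ≤ |C| / ε ^ i * (|C'| / ε ^ (n - i)) := by gcongr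
          _ = _ := by rw [div_mul_div_comm, ← pow_add, Nat.add_sub_of_le hi']
    _ = 2 ^ n * (|C| * |C'| / ε ^ n) := by
        rw [← Finset.sum_mul]
        congr 1
        exact_mod_cast Nat.sum_range_choose n
    _ ≤ 2 ^ m * (|C| * |C'| / ε ^ n) := by
        gcongr
        norm_num
    _ = _ := by ring

theorem HasBoundedDerivs.hasScaledBounds {k : ℝ → ℝ} (hk : HasBoundedDerivs k)
    (hks : ContDiff ℝ ∞ k) {φ : E → ℝ} (hφ : ContDiff ℝ ∞ φ) (m : ℕ) {B : Set E}
    (hB : IsCompact B) : HasScaledBounds m B (fun ε z => k (ε⁻¹ * φ z)) := by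
  choose C hC using hk
  have hbd : ∀ i : ℕ, ∃ D, ∀ z ∈ B, ‖iteratedFDeriv ℝ i φ z‖ ≤ D := fun i =>
    hB.exists_bound_of_continuousOn
      (hφ.continuous_iteratedFDeriv (m := i) (by exact_mod_cast le_top)).continuousOn
  choose D hD using hbd
  set C₀ := ∑ i ∈ Finset.range (m + 1), |C i| with hC₀
  -- The summand 1 ensures ε⁻¹ D₀ ≥ 1, so the bound ε⁻¹ D₀ on the i-th derivative is at most (ε⁻¹
  -- D₀)ⁱ, the form required by the estimate for compositions.
  set D₀ := 1 + ∑ i ∈ Finset.range (m + 1), |D i| with hD₀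
  have hC₀' : ∀ i ≤ m, C i ≤ C₀ := fun i hi => (le_abs_self _).trans
    (Finset.single_le_sum (f := fun i => |C i|) (fun _ _ => abs_nonneg _)
      (Finset.mem_range.mpr (Nat.lt_succ_of_le hi)))
  have hD₀' : ∀ i ≤ m, D i ≤ D₀ := fun i hi => by
    have := (le_abs_self _).trans (Finset.single_le_sum (f := fun i => |D i|)
      (fun _ _ => abs_nonneg _) (Finset.mem_range.mpr (Nat.lt_succ_of_le hi)))
    linarith
  have hD1 : 1 ≤ D₀ := by
    have : 0 ≤ ∑ i ∈ Finset.range (m + 1), |D i| := Finset.sum_nonneg fun _ _ => abs_nonneg _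
    linarith
  have hC0 : 0 ≤ C₀ := Finset.sum_nonneg fun _ _ => abs_nonneg _
  refine ⟨m.factorial * C₀ * D₀ ^ m, fun ε h0 h1 n hn z hz => ?_⟩
  have hφs : ContDiff ℝ ∞ (fun z => ε⁻¹ * φ z) := contDiff_const.mul hφ
  have hε : 1 ≤ ε⁻¹ := (one_le_inv₀ h0).mpr h1
  have := norm_iteratedFDeriv_comp_le (n := n) hks hφs (by exact_mod_cast le_top) z (C := C₀)
    (D := ε⁻¹ * D₀)
    (fun i hi => (hC i _).trans (hC₀' i (hi.trans hn))) (fun i hi1 hin => by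
      have he : iteratedFDeriv ℝ i (fun z => ε⁻¹ * φ z) z = ε⁻¹ • iteratedFDeriv ℝ i φ z := by
        have := iteratedFDeriv_const_smul_apply (𝕜 := ℝ) (a := ε⁻¹) (i := i) (f := φ) (x := z)
          (hφ.contDiffAt.of_le (by exact_mod_cast le_top))
        exact this
      rw [he, norm_smul, Real.norm_eq_abs, abs_of_pos (inv_pos.mpr h0)]
      calc ε⁻¹ * ‖iteratedFDeriv ℝ i φ z‖ ≤ ε⁻¹ * D₀ := by
            gcongr
            exact (hD i z hz).trans (hD₀' i (hin.trans hn))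
        _ ≤ (ε⁻¹ * D₀) ^ i := le_self_pow₀ (by nlinarith) (by omega))
  refine this.trans ?_
  rw [mul_pow, inv_pow, div_eq_mul_inv]
  have hf : (n.factorial : ℝ) ≤ m.factorial := by exact_mod_cast Nat.factorial_le hn
  have hDp : D₀ ^ n ≤ D₀ ^ m := pow_le_pow_right₀ hD1 hn
  have hD0 : 0 ≤ D₀ := by linarith
  calc _ = n.factorial * C₀ * D₀ ^ n * (ε ^ n)⁻¹ := by ring
    _ ≤ _ := by gcongr

/-- Taylor estimate at the points of a compact set where `h` vanishes to order `m`. -/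
theorem exists_flat_bound [FiniteDimensional ℝ E] {K : Set E} (hK : IsCompact K) {h : E → G}
    (hh : ContDiff ℝ ∞ h) (m : ℕ) (hflat : ∀ j ≤ m, ∀ z ∈ K, iteratedFDeriv ℝ j h z = 0) (R : ℝ) :
    ∃ M, 0 ≤ M ∧ ∀ i ≤ m + 1, ∀ k ∈ K, ∀ z, ‖z - k‖ ≤ R →
      ‖iteratedFDeriv ℝ (m + 1 - i) h z‖ ≤ M * ‖z - k‖ ^ i := by
  obtain ⟨ρ, hρ⟩ := hK.isBounded.subset_closedBall (0 : E)
  obtain ⟨M, hM⟩ := (isCompact_closedBall (0 : E) (ρ + R)).exists_bound_of_continuousOn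
    (hh.continuous_iteratedFDeriv (m := (m + 1 : ℕ)) (by exact_mod_cast le_top)).continuousOn
  refine ⟨|M|, abs_nonneg M, fun i => ?_⟩
  induction i with
  | zero =>
    intro _ k hk z hz
    rw [pow_zero, mul_one]
    refine (hM z ?_).trans (le_abs_self M)
    rw [mem_closedBall_zero_iff]
    have h1 : ‖k‖ ≤ ρ := mem_closedBall_zero_iff.mp (hρ hk)
    calc ‖z‖ = ‖k + (z - k)‖ := by rw [add_sub_cancel]
      _ ≤ ‖k‖ + ‖z - k‖ := norm_add_le _ _
      _ ≤ ρ + R := add_le_add h1 hz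
  | succ i ih =>
    intro hi k hk z hz
    have hj : m + 1 - i = (m + 1 - (i + 1)) + 1 := by omega
    have hd : Differentiable ℝ (iteratedFDeriv ℝ (m + 1 - (i + 1)) h) :=
      hh.differentiable_iteratedFDeriv (WithTop.coe_lt_coe.mpr (ENat.natCast_lt_top _))
    have hball : ∀ y ∈ Metric.closedBall k ‖z - k‖,
        ‖fderiv ℝ (iteratedFDeriv ℝ (m + 1 - (i + 1)) h) y‖ ≤ |M| * ‖z - k‖ ^ i := fun y hy => by
      rw [norm_fderiv_iteratedFDeriv, ← hj]
      rw [mem_closedBall_iff_norm] at hy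
      refine (ih (by omega) k hk y (hy.trans hz)).trans ?_
      gcongr
    -- The lower derivative vanishes at k, so the mean value inequality on the ball about k gains
    -- one power of the distance.
    have := (convex_closedBall k ‖z - k‖).norm_image_sub_le_of_norm_fderiv_le
      (fun y _ => hd y) hball (Metric.mem_closedBall_self (norm_nonneg _))
      (mem_closedBall_iff_norm.mpr le_rfl)
    rw [hflat _ (by omega) k hk, sub_zero] at this
    rw [pow_succ, ← mul_assoc]
    exact this

end Bounds

/-- The compact set `K` has smooth cutoff functions at every scale `ε`, whose derivatives of order
`n` are of size `ε ^ (-n)`. -/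
def HasCutoffs {E : Type*} [NormedAddCommGroup E] [NormedSpace ℝ E] (K : Set E) : Prop :=
  ∀ m : ℕ, ∃ C, 1 ≤ C ∧ ∀ ε, 0 < ε → ε ≤ 1 / 2 → ∃ χ : E → ℝ, ContDiff ℝ ∞ χ ∧
    (∃ W, IsOpen W ∧ K ⊆ W ∧ ∀ z ∈ W, χ z = 1) ∧
    ∀ z ∈ tsupport χ, (∃ k ∈ K, ‖z - k‖ ≤ C * ε) ∧
      ∀ n ≤ m, ‖iteratedFDeriv ℝ n χ z‖ ≤ C / ε ^ n

/-- A function that vanishes to order `m` along `K` can be cut off to an arbitrarily small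
neighbourhood of `K` with arbitrarily small derivative of order `m`. -/
theorem HasCutoffs.exists_cutoff {E G : Type*} [NormedAddCommGroup E] [NormedSpace ℝ E]
    [FiniteDimensional ℝ E] [NormedAddCommGroup G] [NormedSpace ℝ G] {K : Set E}
    (hK : IsCompact K) (hcut : HasCutoffs K) {h : E → G} (hh : ContDiff ℝ ∞ h) (m : ℕ)
    (hflat : ∀ j ≤ m, ∀ z ∈ K, iteratedFDeriv ℝ j h z = 0) {O : Set E} (hO : IsOpen O)
    (hKO : K ⊆ O) {δ : ℝ} (hδ : 0 < δ) :
    ∃ χ : E → ℝ, ContDiff ℝ ∞ χ ∧ tsupport χ ⊆ O ∧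
      (∃ W, IsOpen W ∧ K ⊆ W ∧ ∀ z ∈ W, χ z = 1) ∧
      ∀ z, ‖iteratedFDeriv ℝ m (fun y => χ y • h y) z‖ ≤ δ := by
  obtain ⟨C, hC1, hC⟩ := hcut m
  obtain ⟨M, hM0, hM⟩ := exists_flat_bound hK hh m hflat C
  obtain ⟨r, hr, hrO⟩ := hK.exists_thickening_subset_open hO hKO
  set T := 2 ^ m * (C * M * C ^ (m + 1)) with hT
  have hT0 : 0 ≤ T := by positivity
  obtain ⟨ε, hε0, hε1, hε2, hε3⟩ : ∃ ε : ℝ, 0 < ε ∧ ε ≤ 1 / 2 ∧ C * ε < r ∧ T * ε ≤ δ := by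
    refine ⟨min (1 / 2) (min (r / (2 * C)) (δ / (T + 1))), ?_, min_le_left _ _, ?_, ?_⟩
    · have : 0 < C := by linarith
      positivity
    · have hC0 : 0 < C := by linarith
      calc _ ≤ C * (r / (2 * C)) := by
            gcongr
            exact (min_le_right _ _).trans (min_le_left _ _)
        _ = r / 2 := by field_simp
        _ < r := by linarith
    · calc _ ≤ T * (δ / (T + 1)) := by
            gcongr
            exact (min_le_right _ _).trans (min_le_right _ _)
        _ = δ * (T / (T + 1)) := by ring
        _ ≤ δ * 1 := by
            gcongr
            exact div_le_one_of_le₀ (by linarith) (by linarith)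
        _ = δ := mul_one δ
  obtain ⟨χ, hχs, hχ1, hχ⟩ := hC ε hε0 hε1
  refine ⟨χ, hχs, fun z hz => ?_, hχ1, fun z => ?_⟩
  · obtain ⟨k, hk, hzk⟩ := (hχ z hz).1
    refine hrO (Metric.mem_thickening_iff.mpr ⟨k, hk, ?_⟩)
    rw [dist_eq_norm]; exact hzk.trans_lt hε2
  by_cases hz : z ∈ tsupport χ
  · obtain ⟨⟨k, hk, hzk⟩, hb⟩ := hχ z hz
    refine (norm_iteratedFDeriv_smul_le hχs hh z (n := m) (by exact_mod_cast le_top)).trans ?_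
    refine le_trans ?_ hε3
    -- In each Leibniz term the cutoff costs ε⁻ⁱ while flatness of `h` contributes εⁱ⁺¹, so one
    -- factor ε survives.
    calc _ ≤ ∑ i ∈ Finset.range (m + 1), (m.choose i : ℝ) * (C * M * C ^ (m + 1) * ε) := by
          refine Finset.sum_le_sum fun i hi => ?_
          have hi' : i ≤ m := Nat.lt_succ_iff.mp (Finset.mem_range.mp hi)
          rw [mul_assoc]
          refine mul_le_mul_of_nonneg_left ?_ (Nat.cast_nonneg _)
          have e1 := hb i hi'
          have e2 := hM (i + 1) (by omega) k hk z (hzk.trans (by nlinarith))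
          rw [show m + 1 - (i + 1) = m - i by omega] at e2
          have e3 : ‖z - k‖ ^ (i + 1) ≤ (C * ε) ^ (i + 1) := by gcongr
          have e4 : C ^ (i + 1) ≤ C ^ (m + 1) := pow_le_pow_right₀ hC1 (by omega)
          calc _ ≤ C / ε ^ i * (M * (C * ε) ^ (i + 1)) := by
                gcongr
                exact e2.trans (by gcongr)
            _ = C * M * C ^ (i + 1) * ε := by field_simp; ring
            _ ≤ _ := by gcongr
      _ = T * ε := by
          rw [← Finset.sum_mul, hT]
          have : (∑ i ∈ Finset.range (m + 1), (m.choose i : ℝ)) = 2 ^ m := by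
            exact_mod_cast Nat.sum_range_choose m
          rw [this]; ring
  · have : (fun y => χ y • h y) =ᶠ[𝓝 z] fun _ => 0 := by
      filter_upwards [(isClosed_tsupport χ).isOpen_compl.mem_nhds hz] with y hy
      rw [image_eq_zero_of_notMem_tsupport hy, zero_smul]
    rw [(this.iteratedFDeriv ℝ m).eq_of_nhds]
    have h0 : iteratedFDeriv ℝ m (fun _ : E => (0 : G)) z = 0 := by
      rw [iteratedFDeriv_fun_zero]; rfl
    rw [h0, norm_zero]
    exact hδ.le

/-- The nearest point of the circle `π |z|² = 1`. -/
theorem exists_norm_sub_le_of_pi_mul_sq {z : ℂ} (hz : z ≠ 0) :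
    ∃ k : ℂ, Real.pi * ‖k‖ ^ 2 = 1 ∧ ‖z - k‖ ≤ |Real.pi * ‖z‖ ^ 2 - 1| := by
  have hπ := Real.pi_gt_three
  set r := 1 / Real.sqrt Real.pi with hr
  have hsq : Real.sqrt Real.pi ^ 2 = Real.pi := Real.sq_sqrt Real.pi_pos.le
  have hs1 : 1 ≤ Real.sqrt Real.pi := Real.one_le_sqrt.mpr (by linarith)
  have hr0 : 0 < r := by positivity
  have hr2 : Real.pi * r ^ 2 = 1 := by rw [hr, div_pow, hsq]; field_simp
  have hn : 0 < ‖z‖ := norm_pos_iff.mpr hz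
  refine ⟨((r / ‖z‖ : ℝ) : ℂ) * z, ?_, ?_⟩
  · rw [norm_mul, Complex.norm_real, Real.norm_eq_abs, abs_of_pos (by positivity),
      div_mul_cancel₀ _ hn.ne', hr2]
  · have : z - ((r / ‖z‖ : ℝ) : ℂ) * z = ((1 - r / ‖z‖ : ℝ) : ℂ) * z := by push_cast; ring
    rw [this, norm_mul, Complex.norm_real, Real.norm_eq_abs]
    have h1 : |1 - r / ‖z‖| * ‖z‖ = |‖z‖ - r| := by
      rw [← abs_of_pos hn, ← abs_mul, abs_of_pos hn]
      congr 1
      field_simp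
    have h2 : Real.pi * ‖z‖ ^ 2 - 1 = (‖z‖ - r) * (Real.pi * (‖z‖ + r)) := by
      linear_combination hr2
    rw [h1, h2, abs_mul]
    refine le_mul_of_one_le_right (abs_nonneg _) ?_
    rw [abs_of_pos (by positivity)]
    have h3 : 1 ≤ Real.pi * r := by
      rw [hr]; nth_rewrite 1 [← hsq]
      field_simp
      exact hs1
    nlinarith

/-- The cutoff is the product of `k` applied to π|z₁|² − 1 with bumps in Re z₂ and Im z₂, all
rescaled by ε. The step profile produces cutoffs of the disc, the bump profile those of the circle;
`hKN` says that the support of the profile lies close to `K`. -/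
theorem hasCutoffs_of_profile {K : Set (ℂ × ℂ)} {k : ℝ → ℝ} (hk : HasBoundedDerivs k)
    (hks : ContDiff ℝ ∞ k) (hk1 : ∀ s, 1 ≤ s → k s = 0) {N : Set ℝ} (hN : IsClosed N)
    (hkN : ∀ s ∉ N, k s = 0) {I : Set ℝ} (hI : IsOpen I) (hkI : ∀ s ∈ I, k s = 1)
    (hKI : ∀ z ∈ K, ∀ ε : ℝ, 0 < ε → ε⁻¹ * (Real.pi * ‖z.1‖ ^ 2 - 1) ∈ I ∧ z.2 = 0)
    (hKN : ∀ z : ℂ, ∀ ε : ℝ, 0 < ε → ε ≤ 1 / 2 → Real.pi * ‖z‖ ^ 2 - 1 ≤ ε →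
      ε⁻¹ * (Real.pi * ‖z‖ ^ 2 - 1) ∈ N → ∃ w : ℂ, (w, 0) ∈ K ∧ ‖z - w‖ ≤ ε) :
    HasCutoffs K := by
  intro m
  let φ₁ : ℂ × ℂ → ℝ := fun z => Real.pi * ‖z.1‖ ^ 2 - 1
  let φ₂ : ℂ × ℂ → ℝ := fun z => z.2.re
  let φ₃ : ℂ × ℂ → ℝ := fun z => z.2.im
  have hφ₁ : ContDiff ℝ ∞ φ₁ :=
    (contDiff_const.mul ((contDiff_norm_sq ℝ).comp contDiff_fst)).sub contDiff_const
  have hφ₂ : ContDiff ℝ ∞ φ₂ := Complex.reCLM.contDiff.comp contDiff_snd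
  have hφ₃ : ContDiff ℝ ∞ φ₃ := Complex.imCLM.contDiff.comp contDiff_snd
  have hB := isCompact_closedBall (0 : ℂ × ℂ) 2
  have s₁ := hk.hasScaledBounds hks hφ₁ m hB
  have s₂ := hasBoundedDerivs_bumpAtZero.hasScaledBounds contDiff_bumpAtZero hφ₂ m hB
  have s₃ := hasBoundedDerivs_bumpAtZero.hasScaledBounds contDiff_bumpAtZero hφ₃ m hB
  have c₁ : ∀ ε : ℝ, ContDiff ℝ ∞ fun z => k (ε⁻¹ * φ₁ z) := fun ε =>
    hks.comp (contDiff_const.mul hφ₁)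
  have c₂ : ∀ ε : ℝ, ContDiff ℝ ∞ fun z => bumpAtZero (ε⁻¹ * φ₂ z) := fun ε =>
    contDiff_bumpAtZero.comp (contDiff_const.mul hφ₂)
  have c₃ : ∀ ε : ℝ, ContDiff ℝ ∞ fun z => bumpAtZero (ε⁻¹ * φ₃ z) := fun ε =>
    contDiff_bumpAtZero.comp (contDiff_const.mul hφ₃)
  obtain ⟨C, hC⟩ := s₁.mul (s₂.mul s₃ c₂ c₃) c₁ (fun ε => (c₂ ε).mul (c₃ ε))
  -- The 2 comes from |z₂| ≤ |Re z₂| + |Im z₂| ≤ 2ε on the support.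
  refine ⟨max C 2, le_max_of_le_right one_le_two, fun ε h0 h1 => ⟨_, (c₁ ε).mul ((c₂ ε).mul (c₃ ε)),
    ?_, ?_⟩⟩
  · refine ⟨{z | ε⁻¹ * φ₁ z ∈ I} ∩ ({z | |ε⁻¹ * φ₂ z| < 1 / 2} ∩ {z | |ε⁻¹ * φ₃ z| < 1 / 2}),
      ?_, ?_, ?_⟩
    · exact (hI.preimage (continuous_const.mul hφ₁.continuous)).inter
        ((isOpen_lt (continuous_const.mul hφ₂.continuous).abs continuous_const).inter
          (isOpen_lt (continuous_const.mul hφ₃.continuous).abs continuous_const))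
    · intro z hz
      obtain ⟨e1, e2⟩ := hKI z hz ε h0
      refine ⟨e1, ?_, ?_⟩ <;> simp [φ₂, φ₃, e2]
    · rintro z ⟨e1, e2, e3⟩
      simp only [hkI _ e1, bumpAtZero_eq_one (le_of_lt e2), bumpAtZero_eq_one (le_of_lt e3), mul_one]
  · have hsub : tsupport (fun z => k (ε⁻¹ * φ₁ z) *
        (bumpAtZero (ε⁻¹ * φ₂ z) * bumpAtZero (ε⁻¹ * φ₃ z))) ⊆
        ({z | ε⁻¹ * φ₁ z ≤ 1} ∩ {z | ε⁻¹ * φ₁ z ∈ N}) ∩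
          ({z | |ε⁻¹ * φ₂ z| ≤ 1} ∩ {z | |ε⁻¹ * φ₃ z| ≤ 1}) := by
      refine closure_minimal (fun z hz => ?_) ?_
      · refine ⟨⟨?_, ?_⟩, ?_, ?_⟩ <;> by_contra hcon <;> apply hz <;> dsimp only
        · rw [hk1 _ (not_le.mp hcon).le, zero_mul]
        · rw [hkN _ hcon, zero_mul]
        · rw [bumpAtZero_eq_zero (not_le.mp hcon).le, zero_mul, mul_zero]
        · rw [bumpAtZero_eq_zero (not_le.mp hcon).le, mul_zero, mul_zero]
      · exact ((isClosed_le (continuous_const.mul hφ₁.continuous) continuous_const).inter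
          (hN.preimage (continuous_const.mul hφ₁.continuous))).inter
          ((isClosed_le (continuous_const.mul hφ₂.continuous).abs continuous_const).inter
          (isClosed_le (continuous_const.mul hφ₃.continuous).abs continuous_const))
    intro z hz
    obtain ⟨⟨e1, e1'⟩, e2, e3⟩ := hsub hz
    simp only [mem_ofPred_eq] at e1 e1' e2 e3
    have scale : ∀ x : ℝ, ε⁻¹ * x ≤ 1 → x ≤ ε := fun x hx => by
      rwa [inv_mul_le_iff₀ h0, mul_one] at hx
    have f1 : φ₁ z ≤ ε := scale _ e1
    have f2 : |φ₂ z| ≤ ε := scale _ (by rwa [abs_mul, abs_of_pos (inv_pos.mpr h0)] at e2)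
    have f3 : |φ₃ z| ≤ ε := scale _ (by rwa [abs_mul, abs_of_pos (inv_pos.mpr h0)] at e3)
    have hz2 : ‖z.2‖ ≤ 2 * ε := (Complex.norm_le_abs_re_add_abs_im z.2).trans (by
      change |φ₂ z| + |φ₃ z| ≤ _
      linarith)
    refine ⟨?_, fun n hn => (hC ε h0 (by linarith) n hn z ?_).trans ?_⟩
    · obtain ⟨w, hw, hzw⟩ := hKN z.1 ε h0 h1 f1 e1'
      refine ⟨(w, 0), hw, ?_⟩
      refine le_trans ?_ (mul_le_mul_of_nonneg_right (le_max_right C 2) h0.le)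
      rw [Prod.norm_def]
      refine max_le (hzw.trans (by linarith)) ?_
      simpa using hz2
    · rw [mem_closedBall_zero_iff, Prod.norm_def]
      refine max_le ((norm_le_one_of_pi_mul_sq_le ?_).trans one_le_two) (by linarith)
      have : Real.pi * ‖z.1‖ ^ 2 - 1 ≤ ε := f1
      linarith
    · gcongr
      exact le_max_left C 2

theorem hasCutoffs_hopfDisc (a : ℝ) : HasCutoffs (hopfDisc a) := by
  refine hasCutoffs_of_profile hasBoundedDerivs_stepDown contDiff_stepDown
    (fun s => stepDown_eq_zero) isClosed_univ (fun s hs => (hs (mem_univ s)).elim)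
    (isOpen_Iio (a := (1 / 2 : ℝ))) (fun s hs => stepDown_eq_one (le_of_lt hs)) ?_ ?_
  · intro z hz ε hε
    obtain ⟨h1, h2⟩ := mem_hopfDisc.mp hz
    refine ⟨?_, h2⟩
    have : ε⁻¹ * (Real.pi * ‖z.1‖ ^ 2 - 1) ≤ 0 :=
      mul_nonpos_of_nonneg_of_nonpos (inv_pos.mpr hε).le (by linarith)
    exact lt_of_le_of_lt this (by norm_num)
  · intro z ε h0 _ hz _
    by_cases h : Real.pi * ‖z‖ ^ 2 ≤ 1
    · exact ⟨z, mem_hopfDisc.mpr ⟨h, rfl⟩, by simpa using h0.le⟩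
    · obtain ⟨w, hw, hzw⟩ := exists_norm_sub_le_of_pi_mul_sq (z := z) (by
        rintro rfl; simp at h)
      refine ⟨w, mem_hopfDisc.mpr ⟨hw.le, rfl⟩, hzw.trans ?_⟩
      rwa [abs_of_pos (by linarith)]

theorem hasCutoffs_hopfCircle : HasCutoffs hopfCircle := by
  refine hasCutoffs_of_profile hasBoundedDerivs_bumpAtZero contDiff_bumpAtZero
    (fun s hs => bumpAtZero_eq_zero (hs.trans (le_abs_self s))) (isClosed_Icc (a := -1) (b := 1))
    (fun s hs => bumpAtZero_eq_zero ?_) (isOpen_Ioo (a := (-(1 / 2) : ℝ)) (b := 1 / 2))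
    (fun s hs => bumpAtZero_eq_one (abs_lt.mpr hs).le) ?_ ?_
  · rw [mem_Icc, ← abs_le] at hs
    exact (not_le.mp hs).le
  · rintro z ⟨h1, h2⟩ ε _
    refine ⟨?_, h2⟩
    rw [h1]; norm_num
  · rintro z ε h0 h1 hz hN
    rw [mem_Icc, ← abs_le, abs_mul, abs_of_pos (inv_pos.mpr h0), inv_mul_le_iff₀ h0, mul_one] at hN
    obtain ⟨w, hw, hzw⟩ := exists_norm_sub_le_of_pi_mul_sq (z := z) (by
      rintro rfl
      norm_num at hN
      linarith)
    exact ⟨w, ⟨hw, rfl⟩, hzw.trans hN⟩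

/-! ### Geometry of the ellipsoid -/

/-- The function whose sublevel set is the ellipsoid `E(1, a)`. -/
noncomputable def ellipsoidLevel (a : ℝ) (z : ℂ × ℂ) : ℝ :=
  Real.pi * ‖z.1‖ ^ 2 / 1 + Real.pi * ‖z.2‖ ^ 2 / a

theorem continuous_ellipsoidLevel (a : ℝ) : Continuous (ellipsoidLevel a) := by
  unfold ellipsoidLevel; fun_prop

theorem isClosed_ellipsoid (a : ℝ) : IsClosed (ellipsoid 1 a) :=
  isClosed_le (continuous_ellipsoidLevel a) continuous_const

theorem ellipsoidLevel_smul (a t : ℝ) (z : ℂ × ℂ) :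
    ellipsoidLevel a (t • z) = t ^ 2 * ellipsoidLevel a z := by
  simp only [ellipsoidLevel, Prod.smul_fst, Prod.smul_snd, norm_smul, mul_pow, Real.norm_eq_abs,
    sq_abs]
  ring

theorem pi_mul_sq_le_of_mem_ellipsoid {a : ℝ} (ha : 0 < a) {z : ℂ × ℂ} (hz : z ∈ ellipsoid 1 a) :
    Real.pi * ‖z.1‖ ^ 2 ≤ 1 := by
  have h : Real.pi * ‖z.1‖ ^ 2 / 1 + Real.pi * ‖z.2‖ ^ 2 / a ≤ 1 := hz
  have : 0 ≤ Real.pi * ‖z.2‖ ^ 2 / a := by positivity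
  rw [div_one] at h
  linarith

theorem isCompact_ellipsoid {a : ℝ} (ha : 0 < a) : IsCompact (ellipsoid 1 a) := by
  refine Metric.isCompact_of_isClosed_isBounded (isClosed_ellipsoid a)
    ((Metric.isBounded_closedBall (x := (0 : ℂ × ℂ)) (r := 1 + a)).subset fun z hz => ?_)
  rw [mem_closedBall_zero_iff, Prod.norm_def]
  have h1 := norm_le_one_of_pi_mul_sq_le
    ((pi_mul_sq_le_of_mem_ellipsoid ha hz).trans one_le_two)
  refine max_le (by linarith) ?_
  have h : Real.pi * ‖z.1‖ ^ 2 / 1 + Real.pi * ‖z.2‖ ^ 2 / a ≤ 1 := hz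
  have h2 : Real.pi * ‖z.2‖ ^ 2 / a ≤ 1 := by
    have : 0 ≤ Real.pi * ‖z.1‖ ^ 2 / 1 := by positivity
    linarith
  rw [div_le_one ha] at h2
  have := Real.pi_gt_three
  nlinarith [norm_nonneg z.2, sq_nonneg (‖z.2‖ - 1)]

theorem convex_ellipsoid {a : ℝ} (ha : 0 < a) : Convex ℝ (ellipsoid 1 a) := by
  have h (f : (ℂ × ℂ) →L[ℝ] ℂ) (c : ℝ) (hc : 0 < c) :
      ConvexOn ℝ univ fun z : ℂ × ℂ => Real.pi * ‖f z‖ ^ 2 / c := by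
    have h1 : ConvexOn ℝ univ fun z : ℂ × ℂ => ‖f z‖ :=
      (convexOn_univ_norm (E := ℂ)).comp_linearMap f.toLinearMap
    have h2 := (h1.pow (fun z _ => norm_nonneg _) 2).smul (c := Real.pi / c) (by positivity)
    refine h2.congr fun z _ => ?_
    simp only [Pi.pow_apply, smul_eq_mul]; ring
  have := ((h (ContinuousLinearMap.fst ℝ ℂ ℂ) 1 one_pos).add
    (h (ContinuousLinearMap.snd ℝ ℂ ℂ) a ha)).convex_le 1
  convert this using 1
  ext z
  simp [ellipsoid]

theorem smul_mem_ellipsoid {a : ℝ} {z : ℂ × ℂ} (hz : z ∈ ellipsoid 1 a)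
    {t : ℝ} (ht : t ∈ Icc (0 : ℝ) 1) : t • z ∈ ellipsoid 1 a := by
  have hz' : ellipsoidLevel a z ≤ 1 := hz
  change ellipsoidLevel a (t • z) ≤ 1
  rw [ellipsoidLevel_smul]
  have h1 : t ^ 2 ≤ 1 := pow_le_one₀ ht.1 ht.2
  nlinarith [sq_nonneg t]

theorem zero_mem_interior_ellipsoid (a : ℝ) : (0 : ℂ × ℂ) ∈ interior (ellipsoid 1 a) := by
  refine mem_interior.mpr ⟨{z | ellipsoidLevel a z < 1}, fun z (hz : ellipsoidLevel a z < 1) => hz.le,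
    isOpen_lt (continuous_ellipsoidLevel a) continuous_const, ?_⟩
  simp [ellipsoidLevel]

theorem uniqueDiffOn_ellipsoid {a : ℝ} (ha : 0 < a) : UniqueDiffOn ℝ (ellipsoid 1 a) :=
  uniqueDiffOn_convex (convex_ellipsoid ha) ⟨0, zero_mem_interior_ellipsoid a⟩

theorem mem_frontier_ellipsoid {a : ℝ} {z : ℂ × ℂ} :
    z ∈ frontier (ellipsoid 1 a) ↔ ellipsoidLevel a z = 1 := by
  constructor
  · intro h
    exact frontier_le_subset_eq (continuous_ellipsoidLevel a) continuous_const h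
  · intro h
    rw [(isClosed_ellipsoid a).frontier_eq]
    refine ⟨le_of_eq h, fun hint => ?_⟩
    -- Scaling by t > 1 raises the level to t² > 1, so a point of level 1 cannot be interior.
    have hc : Tendsto (fun t : ℝ => t • z) (𝓝[>] 1) (𝓝 z) := by
      have : Tendsto (fun t : ℝ => t • z) (𝓝 1) (𝓝 ((1 : ℝ) • z)) :=
        (continuous_id.smul continuous_const).tendsto 1
      rw [one_smul] at this
      exact this.mono_left nhdsWithin_le_nhds
    obtain ⟨t, ht1, ht2⟩ := ((hc.eventually (mem_interior_iff_mem_nhds.mp hint)).and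
      self_mem_nhdsWithin).exists
    have h3 : ellipsoidLevel a (t • z) ≤ 1 := ht1
    rw [ellipsoidLevel_smul, h, mul_one] at h3
    have h4 : 1 < t := ht2
    nlinarith

/-- The part of the ellipsoid outside `V` is compact and misses z₂ = 0, so |z₂| has a positive
minimum there. -/
theorem exists_tube_subset {a : ℝ} (ha : 0 < a) {V : Set (ℂ × ℂ)} (hV : IsOpen V)
    (hDV : hopfDisc a ⊆ V) : ∃ ε > 0, ∀ z ∈ ellipsoid 1 a, ‖z.2‖ < ε → z ∈ V := by
  have hc : IsCompact (ellipsoid 1 a \ V) := (isCompact_ellipsoid ha).diff hV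
  rcases (ellipsoid 1 a \ V).eq_empty_or_nonempty with he | hne
  · exact ⟨1, one_pos, fun z hz _ => by_contra fun h => by
      have : z ∈ ellipsoid 1 a \ V := ⟨hz, h⟩
      rw [he] at this; exact this⟩
  · obtain ⟨w, hw, hmin⟩ := hc.exists_isMinOn hne
      (f := fun z : ℂ × ℂ => ‖z.2‖) (by fun_prop)
    refine ⟨‖w.2‖, norm_pos_iff.mpr fun h => hw.2 (hDV ⟨hw.1, h⟩), fun z hz hlt => ?_⟩
    by_contra h
    exact absurd hlt (not_lt.mpr (hmin ⟨hz, h⟩))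

/-! ### Smooth extensions that are symplectic near the disc -/

/-- A map that is smooth on a set agrees on each closed subset with a smooth map of `ℂ²`. -/
theorem SmoothOnSubset.exists_contDiff_extension {f : ℂ × ℂ → ℂ × ℂ} {A T : Set (ℂ × ℂ)}
    (hf : SmoothOnSubset f A) (hT : IsClosed T) (hTA : T ⊆ A) :
    ∃ F : ℂ × ℂ → ℂ × ℂ, ContDiff ℝ ∞ F ∧ EqOn F f T := by
  classical
  -- The constraint on the value at each point is convex, and void off `T`, so local extensions can
  -- be glued by a partition of unity.
  let t : ℂ × ℂ → Set (ℂ × ℂ) := fun x => {y | x ∈ T → y = f x}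
  obtain ⟨g, hg⟩ := exists_contMDiffMap_forall_mem_convex_of_local (n := (⊤ : ℕ∞)) (t := t)
    (modelWithCornersSelf ℝ (ℂ × ℂ)) (fun x => by
      intro y hy z hz p q hp hq hpq hx
      rw [hy hx, hz hx, ← add_smul, hpq, one_smul]) (fun x => by
      by_cases hx : x ∈ T
      · obtain ⟨W, F, hW, hxW, hF, hEq⟩ := hf x (hTA hx)
        exact ⟨W, hW.mem_nhds hxW, F, hF.contMDiffOn,
          fun y hy hyT => (hEq ⟨hTA hyT, hy⟩).symm⟩
      · exact ⟨Tᶜ, hT.isOpen_compl.mem_nhds hx, fun _ => 0, contMDiffOn_const,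
          fun y hy hyT => (hy hyT).elim⟩)
  exact ⟨g, g.contMDiff.contDiff, fun x hx => hg x hx⟩

/-- Maps that are symplectic along a neighbourhood of the Hopf disc in `E(1, a)` and fix the points
of `P` there. -/
structure IsSymplecticNearDisc (a : ℝ) (P : Set (ℂ × ℂ)) (F : ℂ × ℂ → ℂ × ℂ) : Prop where
  smooth : ContDiff ℝ ∞ F
  tube : ∃ ε > 0, ∀ z ∈ ellipsoid 1 a, ‖z.2‖ < ε →
    (∀ u v, stdSymplecticForm (fderiv ℝ F z u) (fderiv ℝ F z v) = stdSymplecticForm u v) ∧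
      (z ∈ P → F z = z)

theorem IsSymplecticNearDisc.comp {a : ℝ} {P : Set (ℂ × ℂ)} {F : ℂ × ℂ → ℂ × ℂ}
    (hF : IsSymplecticNearDisc a P F) {Φ Ψ : ℝ → ℂ × ℂ → ℂ × ℂ}
    (hΦ : IsSymplecticIsotopyFixing P Φ Ψ) (t : ℝ) :
    IsSymplecticNearDisc a P (fun z => Φ t (F z)) where
  smooth := (hΦ.contDiff_apply t).comp hF.smooth
  tube := by
    obtain ⟨ε, hε, h⟩ := hF.tube
    refine ⟨ε, hε, fun z hz hz2 => ⟨fun u v => ?_, fun hP => ?_⟩⟩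
    · have h1 : fderiv ℝ (fun z => Φ t (F z)) z = (fderiv ℝ (Φ t) (F z)).comp (fderiv ℝ F z) :=
        fderiv_comp z (hΦ.differentiableAt t _) (hF.smooth.differentiable (by simp) z)
      rw [h1]
      simp only [ContinuousLinearMap.comp_apply, hΦ.symplectic, (h z hz hz2).1]
    · rw [(h z hz hz2).2 hP, hΦ.fixes t z hP]

/-- A local symplectic embedding extends to a smooth map of `ℂ²`. -/
theorem IsLocalSymplecticEmbedding.exists_extension {a : ℝ} (ha : 0 < a) {U : Set (ℂ × ℂ)}
    {ψ : ℂ × ℂ → ℂ × ℂ} (hψ : IsLocalSymplecticEmbedding a U ψ) {P : Set (ℂ × ℂ)}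
    (hP : ∀ z ∈ U ∩ P, ψ z = z) :
    ∃ F, IsSymplecticNearDisc a P F ∧
      ∃ W, IsOpen W ∧ hopfDisc a ⊆ W ∧ ∀ z ∈ U ∩ W, F z = ψ z := by
  obtain ⟨V, hV, hDV, rfl⟩ := hψ.nhd
  obtain ⟨ε, hε, htube⟩ := exists_tube_subset ha hV hDV
  have hT : IsClosed (ellipsoid 1 a ∩ {z | ‖z.2‖ ≤ ε / 2}) :=
    (isClosed_ellipsoid a).inter (isClosed_le (by fun_prop) (by fun_prop))
  have hTU : ellipsoid 1 a ∩ {z | ‖z.2‖ ≤ ε / 2} ⊆ ellipsoid 1 a ∩ V := fun z hz =>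
    ⟨hz.1, htube z hz.1 (lt_of_le_of_lt hz.2 (by linarith))⟩
  obtain ⟨F, hFs, hFe⟩ := hψ.symplecticEmbedding.smooth.exists_contDiff_extension hT hTU
  have hWo : IsOpen {z : ℂ × ℂ | ‖z.2‖ < ε / 2} := isOpen_lt (by fun_prop) (by fun_prop)
  have hFψ : ∀ z ∈ (ellipsoid 1 a ∩ V) ∩ {z | ‖z.2‖ < ε / 2}, F z = ψ z := fun z hz =>
    hFe ⟨hz.1.1, (show ‖z.2‖ < ε / 2 from hz.2).le⟩
  refine ⟨F, ⟨hFs, ε / 2, by linarith, fun z hz hz2 => ?_⟩, _, hWo, fun z hz => ?_, hFψ⟩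
  · have hzU : z ∈ ellipsoid 1 a ∩ V := hTU ⟨hz, hz2.le⟩
    refine ⟨fun u v => ?_, fun hzP => by rw [hFψ z ⟨hzU, hz2⟩, hP z ⟨hzU, hzP⟩]⟩
    -- Derivatives within the ellipsoid are unique up to the boundary, so the derivative of ψ within
    -- U is the full derivative of the extension.
    have hu : UniqueDiffWithinAt ℝ (ellipsoid 1 a ∩ V) z :=
      (uniqueDiffOn_ellipsoid ha).inter hV z hzU
    have hd : fderivWithin ℝ ψ (ellipsoid 1 a ∩ V) z = fderiv ℝ F z := by
      rw [← (hFs.differentiable (by simp) z).fderivWithin hu]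
      refine Filter.EventuallyEq.fderivWithin_eq ?_ (hFψ z ⟨hzU, hz2⟩).symm
      filter_upwards [inter_mem_nhdsWithin _ (hWo.mem_nhds hz2)] with y hy
      exact (hFψ y hy).symm
    rw [← hd]
    exact hψ.symplecticEmbedding.symplectic z hzU u v
  · change ‖z.2‖ < ε / 2
    rw [hz.2, norm_zero]; linarith

/-! ### Maps tangent to the identity: the displacement form and its primitive -/

/-- Every point of `P` near the Hopf disc can be joined to the disc inside `P`. -/
def JoinsHopfDisc (a : ℝ) (P : Set (ℂ × ℂ)) : Prop :=
  ∃ r > 0, ∀ z ∈ P, ‖z.2‖ < r → ∃ γ : ℝ → ℂ × ℂ,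
    (∀ s ∈ Icc (0 : ℝ) 1, γ s ∈ P ∧ ‖(γ s).2‖ ≤ ‖z.2‖ ∧ DifferentiableAt ℝ γ s) ∧
      γ 0 ∈ hopfDisc a ∧ γ 1 = z

/-- The 1-form `ω(h, d(z + i Im h))`, where `h` is the displacement of a map; it is closed where the
map is symplectic. -/
noncomputable def displacementForm (h : ℂ × ℂ → ℂ × ℂ) (z : ℂ × ℂ) : (ℂ × ℂ) →L[ℝ] ℝ :=
  (symplecticBilin (h z)).comp (ContinuousLinearMap.id ℝ (ℂ × ℂ) + projIm.comp (fderiv ℝ h z))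

theorem contDiff_displacementForm {h : ℂ × ℂ → ℂ × ℂ} (hh : ContDiff ℝ ∞ h) :
    ContDiff ℝ ∞ (displacementForm h) :=
  (symplecticBilin.contDiff.comp hh).clm_comp
    (contDiff_const.add (contDiff_const.clm_comp (hh.fderiv_right (by simp))))

/-- Since the real and imaginary planes are Lagrangian, ω(Au, i Im Av) + ω(i Im Au, Av) = ω(Au, Av);
the claim is then `hA` with ω(u, v) cancelled. -/
theorem stdSymplecticForm_projIm_comm {A : (ℂ × ℂ) →L[ℝ] ℂ × ℂ} {u v : ℂ × ℂ}
    (hA : stdSymplecticForm (u + A u) (v + A v) = stdSymplecticForm u v) :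
    stdSymplecticForm (A u) (v + projIm (A v)) = stdSymplecticForm (A v) (u + projIm (A u)) := by
  simp only [stdSymplecticForm_eq, projIm_apply] at hA ⊢
  simp at hA ⊢
  linarith

/-- The derivative has two terms: one contains the second derivative of `h` and is symmetric for
that reason, the other is symmetric because id + dh is symplectic. -/
theorem fderiv_displacementForm_comm {h : ℂ × ℂ → ℂ × ℂ} (hh : ContDiff ℝ ∞ h) {z : ℂ × ℂ}
    (hz : ∀ u v, stdSymplecticForm (u + fderiv ℝ h z u) (v + fderiv ℝ h z v) =
      stdSymplecticForm u v) (u v : ℂ × ℂ) :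
    fderiv ℝ (displacementForm h) z u v = fderiv ℝ (displacementForm h) z v u := by
  have hd : HasFDerivAt h (fderiv ℝ h z) z := (hh.differentiable (by simp) z).hasFDerivAt
  have hdd : HasFDerivAt (fderiv ℝ h) (fderiv ℝ (fderiv ℝ h) z) z :=
    ((hh.fderiv_right (m := ∞) (by simp)).differentiable (by simp) z).hasFDerivAt
  have hval : ∀ u v : ℂ × ℂ, fderiv ℝ (displacementForm h) z u v =
      symplecticBilin (fderiv ℝ h z u) (v + projIm (fderiv ℝ h z v)) +
        symplecticBilin (h z) (projIm (fderiv ℝ (fderiv ℝ h) z u v)) := by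
    intro u v
    have e1 : HasFDerivAt (displacementForm h) (fderiv ℝ (displacementForm h) z) z :=
      ((contDiff_displacementForm hh).differentiable (by simp) z).hasFDerivAt
    have e2 : HasFDerivAt (fun y => displacementForm h y v)
        ((ContinuousLinearMap.apply ℝ ℝ v).comp (fderiv ℝ (displacementForm h) z)) z :=
      (ContinuousLinearMap.apply ℝ ℝ v).hasFDerivAt.comp z e1
    have e3 : HasFDerivAt (fun y => v + projIm (fderiv ℝ h y v))
        (projIm.comp ((ContinuousLinearMap.apply ℝ (ℂ × ℂ) v).comp (fderiv ℝ (fderiv ℝ h) z))) z :=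
      (projIm.hasFDerivAt.comp z
        ((ContinuousLinearMap.apply ℝ (ℂ × ℂ) v).hasFDerivAt.comp z hdd)).const_add v
    have e4 : HasFDerivAt (fun y => symplecticBilin (h y) (v + projIm (fderiv ℝ h y v))) _ z :=
      (symplecticBilin.hasFDerivAt.comp z hd).clm_apply e3
    have e5 := congrArg (fun L : (ℂ × ℂ) →L[ℝ] ℝ => L u) (e2.unique e4)
    refine e5.trans ?_
    simp only [_root_.add_apply, ContinuousLinearMap.comp_apply, ContinuousLinearMap.flip_apply,
      ContinuousLinearMap.apply_apply, Function.comp_apply]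
    rw [add_comm]
  have hsymm : fderiv ℝ (fderiv ℝ h) z u v = fderiv ℝ (fderiv ℝ h) z v u :=
    (hh.contDiffAt.isSymmSndFDerivAt (by
      simp only [minSmoothness_of_isRCLikeNormedField]
      exact WithTop.coe_le_coe.mpr le_top)).eq u v
  rw [hval u v, hval v u, hsymm]
  simp only [symplecticBilin_apply]
  rw [stdSymplecticForm_projIm_comm (hz u v)]

/-- A primitive of the displacement form of a map that is symplectic near the Hopf disc. -/
theorem IsSymplecticNearDisc.exists_primitive {a : ℝ} {P : Set (ℂ × ℂ)}
    (hPE : P ⊆ ellipsoid 1 a) (hDP : hopfDisc a ⊆ P) (hjoin : JoinsHopfDisc a P)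
    {F : ℂ × ℂ → ℂ × ℂ} (hF : IsSymplecticNearDisc a P F) :
    ∃ f : ℂ × ℂ → ℝ, ContDiff ℝ ∞ f ∧ ∃ ε > 0, ∀ z ∈ ellipsoid 1 a, ‖z.2‖ < ε →
      HasFDerivAt f (displacementForm (fun z => F z - z) z) z ∧
        (z ∈ P → F z = z ∧ f z = 0) := by
  obtain ⟨ε, hε, htube⟩ := hF.tube
  obtain ⟨r, hr, hjoin⟩ := hjoin
  set h : ℂ × ℂ → ℂ × ℂ := fun z => F z - z with hh
  have hs : ContDiff ℝ ∞ h := hF.smooth.sub contDiff_id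
  have hd : ∀ z, fderiv ℝ h z = fderiv ℝ F z - ContinuousLinearMap.id ℝ (ℂ × ℂ) := fun z =>
    ((hF.smooth.differentiable (by simp) z).hasFDerivAt.sub (hasFDerivAt_id z)).fderiv
  have hβs := contDiff_displacementForm hs
  have hβ0 : ∀ z, h z = 0 → displacementForm h z = 0 := fun z hz => by
    rw [displacementForm, hz, map_zero, ContinuousLinearMap.zero_comp]
  set f : ℂ × ℂ → ℝ := fun x => ∫ t in (0 : ℝ)..1, displacementForm h (t • x) x with hf
  have hfd : ∀ z ∈ ellipsoid 1 a, ‖z.2‖ < ε → HasFDerivAt f (displacementForm h z) z := by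
    intro z hz hz2
    refine hasFDerivAt_integral_of_closed_on_ray hβs fun t ht u v => ?_
    refine fderiv_displacementForm_comm hs (fun u v => ?_) u v
    have h1 : ‖(t • z).2‖ < ε := by
      rw [Prod.smul_snd, norm_smul, Real.norm_eq_abs, abs_of_nonneg ht.1]
      exact (mul_le_of_le_one_left (norm_nonneg _) ht.2).trans_lt hz2
    have h2 := (htube _ (smul_mem_ellipsoid hz ht) h1).1 u v
    rw [← h2, hd]
    simp
  have hD : ∀ z ∈ hopfDisc a, h z = 0 := fun z hz => by
    have := (htube z (hPE (hDP hz)) (by rw [hz.2, norm_zero]; exact hε)).2 (hDP hz)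
    rw [hh]; simp only [this, sub_self]
  have hfD : ∀ z ∈ hopfDisc a, f z = 0 := fun z hz => by
    rw [hf]
    have : ∀ t ∈ uIcc (0 : ℝ) 1, displacementForm h (t • z) z = (fun _ => (0 : ℝ)) t := by
      intro t ht
      rw [uIcc_of_le zero_le_one] at ht
      have : t • z ∈ hopfDisc a := ⟨smul_mem_ellipsoid hz.1 ht, by simp [hz.2]⟩
      rw [hβ0 _ (hD _ this)]; rfl
    simp only [intervalIntegral.integral_congr this]
    simp
  refine ⟨f, contDiff_intervalIntegral ((hβs.comp
    (contDiff_snd.smul contDiff_fst)).clm_apply contDiff_fst), min ε r, lt_min hε hr,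
    fun z hz hz2 => ⟨hfd z hz (hz2.trans_le (min_le_left _ _)), fun hzP => ?_⟩⟩
  have hz2' := hz2.trans_le (min_le_left ε r)
  refine ⟨(htube z hz hz2').2 hzP, ?_⟩
  obtain ⟨γ, hγ, hγ0, hγ1⟩ := hjoin z hzP (hz2.trans_le (min_le_right _ _))
  -- The displacement vanishes on `P`, hence so does df along the path; f is constant there and
  -- starts with the value 0 on the disc.
  have hder : ∀ s ∈ uIcc (0 : ℝ) 1, HasDerivAt (fun s => f (γ s)) 0 s := by
    intro s hs
    rw [uIcc_of_le zero_le_one] at hs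
    obtain ⟨g1, g2, g3⟩ := hγ s hs
    have g4 := hfd (γ s) (hPE g1) (g2.trans_lt hz2')
    have g5 : h (γ s) = 0 := by
      have := (htube (γ s) (hPE g1) (g2.trans_lt hz2')).2 g1
      rw [hh]; simp only [this, sub_self]
    rw [hβ0 _ g5] at g4
    have := g4.comp_hasDerivAt s g3.hasDerivAt
    exact this
  have := intervalIntegral.integral_eq_sub_of_hasDerivAt hder intervalIntegrable_const
  rw [intervalIntegral.integral_zero, hγ1, hfD _ hγ0, sub_zero] at this
  exact this.symm

theorem iteratedFDeriv_one_eq_zero {E G : Type*} [NormedAddCommGroup E] [NormedSpace ℝ E]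
    [NormedAddCommGroup G] [NormedSpace ℝ G] {h : E → G} {z : E} (hz : fderiv ℝ h z = 0) :
    iteratedFDeriv ℝ 1 h z = 0 := by
  rw [← norm_eq_zero, norm_iteratedFDeriv_one, hz, norm_zero]

theorem iteratedFDeriv_zero_eq_zero {E G : Type*} [NormedAddCommGroup E] [NormedSpace ℝ E]
    [NormedAddCommGroup G] [NormedSpace ℝ G] {h : E → G} {z : E} (hz : h z = 0) :
    iteratedFDeriv ℝ 0 h z = 0 := by
  rw [← norm_eq_zero, norm_iteratedFDeriv_zero, hz, norm_zero]

theorem norm_iteratedFDeriv_two {E G : Type*} [NormedAddCommGroup E] [NormedSpace ℝ E]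
    [NormedAddCommGroup G] [NormedSpace ℝ G] {h : E → G} {z : E} :
    ‖iteratedFDeriv ℝ 2 h z‖ = ‖fderiv ℝ (fderiv ℝ h) z‖ := by
  rw [← norm_iteratedFDeriv_one, norm_iteratedFDeriv_fderiv]

theorem iteratedFDeriv_two_eq_zero {E G : Type*} [NormedAddCommGroup E] [NormedSpace ℝ E]
    [NormedAddCommGroup G] [NormedSpace ℝ G] {h : E → G} {z : E}
    (hz : fderiv ℝ (fderiv ℝ h) z = 0) : iteratedFDeriv ℝ 2 h z = 0 := by
  rw [← norm_eq_zero, norm_iteratedFDeriv_two, hz]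
  exact norm_zero (E := E →L[ℝ] E →L[ℝ] G)

/-- A map that is symplectic near the Hopf disc and tangent to the identity along `K` agrees near
`K` with a symplectic isotopy. -/
theorem IsSymplecticNearDisc.exists_isotopy {a : ℝ} (ha : 0 < a) {P : Set (ℂ × ℂ)}
    (hPE : P ⊆ ellipsoid 1 a) (hDP : hopfDisc a ⊆ P) (hjoin : JoinsHopfDisc a P)
    {F : ℂ × ℂ → ℂ × ℂ} (hF : IsSymplecticNearDisc a P F) {K : Set (ℂ × ℂ)} (hKc : IsClosed K)
    (hKD : K ⊆ hopfDisc a) (hcut : HasCutoffs K)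
    (hdF : ∀ z ∈ K, fderiv ℝ F z = ContinuousLinearMap.id ℝ (ℂ × ℂ)) :
    ∃ Φ Ψ, IsSymplecticIsotopyFixing P Φ Ψ ∧
      ∃ W, IsOpen W ∧ K ⊆ W ∧ ∀ z ∈ ellipsoid 1 a ∩ W, Φ 1 z = F z := by
  obtain ⟨f, hfs, ε, hε, hf⟩ := hF.exists_primitive hPE hDP hjoin
  have hKcomp := isCompact_of_isClosed_of_subset_hopfDisc hKc hKD
  set h : ℂ × ℂ → ℂ × ℂ := fun z => F z - z with hh
  have hs : ContDiff ℝ ∞ h := hF.smooth.sub contDiff_id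
  have hd : ∀ z, HasFDerivAt h (fderiv ℝ h z) z := fun z =>
    (hs.differentiable (by simp) z).hasFDerivAt
  have hKE : ∀ z ∈ K, z ∈ ellipsoid 1 a := fun z hz => (hKD hz).1
  have hKε : ∀ z ∈ K, ‖z.2‖ < ε := fun z hz => by rw [(hKD hz).2, norm_zero]; exact hε
  have hKh : ∀ z ∈ K, h z = 0 := fun z hz => by
    have := ((hf z (hKE z hz) (hKε z hz)).2 (hDP (hKD hz))).1
    rw [hh]; simp only [this, sub_self]
  have hKdh : ∀ z ∈ K, fderiv ℝ h z = 0 := fun z hz => by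
    have := ((hF.smooth.differentiable (by simp) z).hasFDerivAt.sub (hasFDerivAt_id z)).fderiv
    rw [hdF z hz, sub_self] at this
    exact this
  -- Flatness of order 1 lets h be cut off with derivative at most 1/2, which makes the coordinate
  -- change below a global diffeomorphism.
  obtain ⟨χ₁, χ₁s, -, ⟨W₁, hW₁, hKW₁, hχ₁⟩, hb₁⟩ := hcut.exists_cutoff hKcomp hs 1
    (fun j hj z hz => by
      interval_cases j
      · exact iteratedFDeriv_zero_eq_zero (hKh z hz)
      · exact iteratedFDeriv_one_eq_zero (hKdh z hz)) isOpen_univ (subset_univ K)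
    (show (0 : ℝ) < 1 / 2 by norm_num)
  -- the map `μ z = z + i Im (h z)` to mixed coordinates, cut off away from `K`
  set h₁ : ℂ × ℂ → ℂ × ℂ := fun z => projIm (χ₁ z • h z) with hh₁
  have h₁s : ContDiff ℝ ∞ h₁ := projIm.contDiff.comp (χ₁s.smul hs)
  obtain ⟨ν, νs, νl, νr⟩ := exists_contDiff_inverse_family (h := fun _ => h₁)
    (h₁s.comp contDiff_snd) fun _ z => by
      have e1 : HasFDerivAt (fun y => χ₁ y • h y) (fderiv ℝ (fun y => χ₁ y • h y) z) z :=
        ((χ₁s.smul hs).differentiable (by simp) z).hasFDerivAt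
      have e2 : HasFDerivAt h₁ _ z := projIm.hasFDerivAt.comp z e1
      rw [e2.fderiv]
      refine (ContinuousLinearMap.opNorm_comp_le _ _).trans ?_
      have e3 := hb₁ z
      rw [norm_iteratedFDeriv_one] at e3
      calc _ ≤ 1 * (1 / 2 : ℝ) := mul_le_mul norm_projIm_le e3 (norm_nonneg _) zero_le_one
        _ = 1 / 2 := one_mul _
  have ν₀s : ContDiff ℝ ∞ (ν 0) :=
    νs.comp (contDiff_const.prodMk contDiff_id : ContDiff ℝ ∞ fun z : ℂ × ℂ => ((0 : ℝ), z))
  set μ : ℂ × ℂ → ℂ × ℂ := fun z => z + h₁ z with hμ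
  have μs : ContDiff ℝ ∞ μ := contDiff_id.add h₁s
  have μ_fix : ∀ z, h z = 0 → μ z = z := fun z hz => by simp [hμ, hh₁, hz]
  -- Here `ν 0` is the inverse of `μ`, and `S₀` is the primitive expressed in the mixed coordinates.
  set S₀ : ℂ × ℂ → ℝ := fun w => f (ν 0 w) with hS₀
  have S₀s : ContDiff ℝ ∞ S₀ := hfs.comp ν₀s
  have S₀d : ∀ w, HasFDerivAt S₀ (fderiv ℝ S₀ w) w := fun w =>
    (S₀s.differentiable (by simp) w).hasFDerivAt
  set O : Set (ℂ × ℂ) := W₁ ∩ {z | ‖z.2‖ < ε} with hO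
  have hOo : IsOpen O := hW₁.inter (isOpen_lt (by fun_prop) (by fun_prop))
  have hKO : K ⊆ O := fun z hz => ⟨hKW₁ hz, hKε z hz⟩
  have μd : ∀ z ∈ O, HasFDerivAt μ
      (ContinuousLinearMap.id ℝ (ℂ × ℂ) + projIm.comp (fderiv ℝ h z)) z := fun z hz => by
    have e1 : HasFDerivAt (fun y => y + projIm (h y))
        (ContinuousLinearMap.id ℝ (ℂ × ℂ) + projIm.comp (fderiv ℝ h z)) z :=
      (hasFDerivAt_id z).add (projIm.hasFDerivAt.comp z (hd z))
    refine e1.congr_of_eventuallyEq ?_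
    filter_upwards [hW₁.mem_nhds hz.1] with y hy
    simp only [hμ, hh₁, hχ₁ y hy, one_smul]
  -- Both dS₀ ∘ dμ and ω(h, dμ) equal df at z, and dμ cancels because it is invertible.
  have S₀grad : ∀ z ∈ ellipsoid 1 a ∩ O, fderiv ℝ S₀ (μ z) = symplecticBilin (h z) := by
    rintro z ⟨hzE, hzO⟩
    have e1 := (S₀d (μ z)).comp z (μd z hzO)
    have e2 : S₀ ∘ μ = f := funext fun y => congrArg f (νl 0 y)
    rw [e2] at e1
    have e3 := e1.unique (hf z hzE hzO.2).1
    have e4 : HasFDerivAt (ν 0) (fderiv ℝ (ν 0) (μ z)) (μ z) :=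
      (ν₀s.differentiable (by simp) _).hasFDerivAt
    have hνμ : ν 0 (μ z) = z := νl 0 z
    have e5 : HasFDerivAt μ (ContinuousLinearMap.id ℝ (ℂ × ℂ) + projIm.comp (fderiv ℝ h z))
        (ν 0 (μ z)) := by rw [hνμ]; exact μd z hzO
    have e6 := e5.comp (μ z) e4
    have e7 : μ ∘ ν 0 = id := funext fun y => νr 0 y
    rw [e7] at e6
    have e8 := e6.unique (hasFDerivAt_id (μ z))
    calc fderiv ℝ S₀ (μ z) = (fderiv ℝ S₀ (μ z)).comp ((ContinuousLinearMap.id ℝ (ℂ × ℂ) +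
          projIm.comp (fderiv ℝ h z)).comp (fderiv ℝ (ν 0) (μ z))) := by
          rw [e8, ContinuousLinearMap.comp_id]
      _ = (displacementForm h z).comp (fderiv ℝ (ν 0) (μ z)) := by
          rw [← e3, ContinuousLinearMap.comp_assoc]
      _ = symplecticBilin (h z) := by
          rw [displacementForm, ContinuousLinearMap.comp_assoc, e8, ContinuousLinearMap.comp_id]
  have νP : ∀ z ∈ P ∩ O, S₀ z = 0 ∧ fderiv ℝ S₀ z = 0 := by
    rintro z ⟨hzP, hzO⟩
    obtain ⟨g1, g2⟩ := (hf z (hPE hzP) hzO.2).2 hzP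
    have g3 : h z = 0 := by rw [hh]; simp only [g1, sub_self]
    have g4 := S₀grad z ⟨hPE hzP, hzO⟩
    rw [μ_fix z g3, g3, map_zero] at g4
    refine ⟨?_, g4⟩
    have g5 : ν 0 (μ z) = z := νl 0 z
    rw [μ_fix z g3] at g5
    rw [hS₀]; simp only [g5, g2]
  -- The identity dS₀ ∘ μ = ω(h, ·) holds only on the ellipsoid, but derivatives within it are
  -- unique. Differentiating at z with dμ = id and dh = 0 gives the claim.
  have S₀snd : ∀ z ∈ K, fderiv ℝ (fderiv ℝ S₀) z = 0 := by
    intro z hz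
    have e1 : HasFDerivAt (fderiv ℝ S₀) (fderiv ℝ (fderiv ℝ S₀) z) (μ z) := by
      rw [μ_fix z (hKh z hz)]
      exact ((S₀s.fderiv_right (m := ∞) (by simp)).differentiable (by simp) z).hasFDerivAt
    have e2 := e1.comp z (μd z (hKO hz))
    rw [hKdh z hz, ContinuousLinearMap.comp_zero, add_zero, ContinuousLinearMap.comp_id] at e2
    have e3 := symplecticBilin.hasFDerivAt.comp z (hd z)
    rw [hKdh z hz, ContinuousLinearMap.comp_zero] at e3
    have hu : UniqueDiffWithinAt ℝ (ellipsoid 1 a) z := uniqueDiffOn_ellipsoid ha z (hKE z hz)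
    refine hu.eq e2.hasFDerivWithinAt (e3.hasFDerivWithinAt.congr_of_eventuallyEq ?_ ?_)
    · filter_upwards [inter_mem_nhdsWithin (ellipsoid 1 a) (hOo.mem_nhds (hKO hz))] with y hy
      exact S₀grad y hy
    · exact S₀grad z ⟨hKE z hz, hKO hz⟩
  -- The bound on the second derivative is chosen so that the derivative of the symplectic gradient
  -- has norm at most 1/2 after applying `symplecticSharp`.
  obtain ⟨χ₂, χ₂s, hsupp, ⟨W₂, hW₂, hKW₂, hχ₂⟩, hb₂⟩ := hcut.exists_cutoff hKcomp S₀s 2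
    (fun j hj z hz => by
      interval_cases j
      · exact iteratedFDeriv_zero_eq_zero (νP z ⟨hDP (hKD hz), hKO hz⟩).1
      · exact iteratedFDeriv_one_eq_zero (νP z ⟨hDP (hKD hz), hKO hz⟩).2
      · exact iteratedFDeriv_two_eq_zero (S₀snd z hz)) hOo hKO
    (show (0 : ℝ) < 1 / (2 * (‖symplecticSharp‖ + 1)) by positivity)
  set S : ℂ × ℂ → ℝ := fun y => χ₂ y • S₀ y with hS
  have Ss : ContDiff ℝ ∞ S := χ₂s.smul S₀s
  obtain ⟨Φ, Ψ, hΦ, hgen⟩ := exists_isotopy_of_generatingFunction (P := P) Ss (fun z => by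
      rw [fderiv_symplecticGradient Ss]
      refine (ContinuousLinearMap.opNorm_comp_le _ _).trans ?_
      have e := hb₂ z
      rw [norm_iteratedFDeriv_two] at e
      calc _ ≤ (‖symplecticSharp‖ + 1) * (1 / (2 * (‖symplecticSharp‖ + 1))) :=
            mul_le_mul (by linarith) e (by positivity) (by positivity)
        _ = 1 / 2 := by
            have : ‖symplecticSharp‖ + 1 ≠ 0 := by positivity
            field_simp) (fun z hz => by
      have : fderiv ℝ S z = 0 := by
        by_cases hzs : z ∈ tsupport χ₂
        · obtain ⟨g1, g2⟩ := νP z ⟨hz, hsupp hzs⟩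
          have e := ((χ₂s.differentiable (by simp) z).hasFDerivAt.smul (S₀d z)).fderiv
          rw [g1, g2, smul_zero, zero_add] at e
          refine e.trans ?_
          exact ContinuousLinearMap.ext fun v => by simp
        · have e : S =ᶠ[𝓝 z] fun _ => 0 := by
            filter_upwards [(isClosed_tsupport χ₂).isOpen_compl.mem_nhds hzs] with y hy
            simp only [hS, image_eq_zero_of_notMem_tsupport hy, zero_smul]
          rw [e.fderiv_eq, fderiv_const_apply]
      rw [symplecticGradient, this, map_zero])
  refine ⟨Φ, Ψ, hΦ, O ∩ μ ⁻¹' W₂, hOo.inter (hW₂.preimage μs.continuous), fun z hz => ⟨hKO hz, ?_⟩,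
    fun z hz => ?_⟩
  · rw [mem_preimage, μ_fix z (hKh z hz)]; exact hKW₂ hz
  · obtain ⟨hzE, hzO, hzW⟩ := hz
    have e1 : S =ᶠ[𝓝 (μ z)] S₀ := by
      filter_upwards [hW₂.mem_nhds hzW] with y hy
      simp only [hS, hχ₂ y hy, one_smul]
    have e2 : symplecticGradient S (μ z) = h z := by
      refine eq_of_stdSymplecticForm_eq fun v => ?_
      rw [stdSymplecticForm_gradient, e1.fderiv_eq, S₀grad z ⟨hzE, hzO⟩, symplecticBilin_apply]
    have e3 : μ z = z + projIm (h z) := by simp only [hμ, hh₁, hχ₁ z hzO.1, one_smul]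
    -- The generating relation reads Φ₁(μ z − i Im h) = μ z + Re h, that is, Φ₁ z = z + h z.
    have e4 := hgen (μ z)
    rw [e2, e3, add_sub_cancel_right, add_assoc, add_comm (projIm (h z)),
      projRe_add_projIm] at e4
    rw [e4, hh]
    simp

/-! ### Shears as normal derivatives -/

/-- Smooth functions with compact support in `O`. -/
structure IsTestFunctionOn (O : Set ℂ) (b : ℂ → ℝ) : Prop where
  smooth : ContDiff ℝ ∞ b
  compact : HasCompactSupport b
  subset : tsupport b ⊆ O

namespace IsTestFunctionOn

variable {O : Set ℂ} {b : ℂ → ℝ}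

theorem mul_left (hb : IsTestFunctionOn O b) {f : ℂ → ℝ} (hf : ContDiff ℝ ∞ f) :
    IsTestFunctionOn O (fun z => f z * b z) where
  smooth := hf.mul hb.smooth
  compact := hb.compact.mul_left
  subset := (tsupport_mul_subset_right (f := f) (g := b)).trans hb.subset

theorem comp_left (hb : IsTestFunctionOn O b) {f : ℝ → ℝ} (hf : ContDiff ℝ ∞ f) (h0 : f 0 = 0) :
    IsTestFunctionOn O (fun z => f (b z)) where
  smooth := hf.comp hb.smooth
  compact := hb.compact.comp_left h0
  subset := (tsupport_comp_subset h0 b).trans hb.subset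

end IsTestFunctionOn

theorem exists_testFunction_eq_one {O T : Set ℂ} (hO : IsOpen O) (hT : IsCompact T) (hTO : T ⊆ O) :
    ∃ β, IsTestFunctionOn O β ∧ ∀ z ∈ T, β z = 1 := by
  obtain ⟨K, hK, hTK, hKO⟩ := exists_compact_between hT hO hTO
  obtain ⟨f, hf0, hf1, -⟩ := exists_contMDiffMap_zero_one_of_isClosed (n := (⊤ : ℕ∞))
    (modelWithCornersSelf ℝ ℂ) isOpen_interior.isClosed_compl hT.isClosed
    (s := (interior K)ᶜ) (t := T) (disjoint_left.mpr fun z hz hzT => hz (hTK hzT))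
  have hsupp : tsupport f ⊆ K := closure_minimal (fun z hz => by
    by_contra h
    exact hz (hf0 fun hi => h (interior_subset hi))) hK.isClosed
  exact ⟨f, ⟨f.contMDiff.contDiff, HasCompactSupport.of_support_subset_isCompact hK
    ((subset_tsupport _).trans hsupp), hsupp.trans hKO⟩, fun z hz => hf1 hz⟩

/-- Over compact subsets of `O`, the set `P` stays away from `{z₂ = 0}`, except for its points in
`{z₂ = 0}`. -/
def IsIsolatedOver (O : Set ℂ) (P : Set (ℂ × ℂ)) : Prop :=
  ∀ T ⊆ O, IsCompact T → ∃ r > 0, ∀ z ∈ P, z.1 ∈ T → z.2 = 0 ∨ r ≤ ‖z.2‖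

/-- The family of maps `M z` is the normal derivative along the Hopf disc of a symplectic isotopy
that fixes `P`. -/
def IsNormalDerivative (a : ℝ) (P : Set (ℂ × ℂ)) (M : ℂ → ℂ → ℂ) : Prop :=
  ∃ Φ Ψ, IsSymplecticIsotopyFixing P Φ Ψ ∧
    ∀ z, (z, 0) ∈ hopfDisc a → ∀ v, fderiv ℝ (Φ 1) (z, 0) (0, v) = (0, M z v)

theorem IsNormalDerivative.comp {a : ℝ} {P : Set (ℂ × ℂ)} (hDP : hopfDisc a ⊆ P)
    {M M' : ℂ → ℂ → ℂ} (h : IsNormalDerivative a P M) (h' : IsNormalDerivative a P M') :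
    IsNormalDerivative a P (fun z v => M z (M' z v)) := by
  obtain ⟨Φ, Ψ, hΦ, hM⟩ := h
  obtain ⟨Φ', Ψ', hΦ', hM'⟩ := h'
  refine ⟨_, _, hΦ.comp hΦ', fun z hz v => ?_⟩
  have h1 : fderiv ℝ (fun y => Φ 1 (Φ' 1 y)) (z, 0) =
      (fderiv ℝ (Φ 1) (Φ' 1 (z, 0))).comp (fderiv ℝ (Φ' 1) (z, 0)) :=
    fderiv_comp _ (hΦ.differentiableAt 1 _) (hΦ'.differentiableAt 1 _)
  rw [h1, ContinuousLinearMap.comp_apply, hM' z hz, hΦ'.fixes 1 _ (hDP hz), hM z hz]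

theorem IsNormalDerivative.id (a : ℝ) (P : Set (ℂ × ℂ)) :
    IsNormalDerivative a P (fun _ v => v) :=
  ⟨_, _, IsSymplecticIsotopyFixing.refl P, fun z _ v => by simp⟩

/-- Shears of the normal planes are normal derivatives. -/
theorem isNormalDerivative_shear {a : ℝ} {P : Set (ℂ × ℂ)} {O : Set ℂ} (hDP : hopfDisc a ⊆ P)
    (hPO : IsIsolatedOver O P) (ℓ : ℂ →L[ℝ] ℝ) (hℓ : ℓ 1 * ℓ Complex.I = 0) {b : ℂ → ℝ}
    (hb : IsTestFunctionOn O b) :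
    IsNormalDerivative a P
      (fun z v => v + (b z * ℓ v) • ((ℓ Complex.I : ℂ) - ℓ 1 * Complex.I)) := by
  obtain ⟨r, hr, hiso⟩ := hPO _ hb.subset hb.compact
  -- The cutoff k vanishes for |w| > 2ρ = r/2, hence near all points of `P` with |z₂| ≥ r.
  set ρ := r / 4 with hρ
  have hρ0 : 0 < ρ := by positivity
  let k : ℂ → ℝ := fun w => bumpAtZero (w.re / ρ) * bumpAtZero (w.im / ρ)
  have hk : ContDiff ℝ ∞ k :=
    (contDiff_bumpAtZero.comp (Complex.reCLM.contDiff.div_const ρ)).mul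
      (contDiff_bumpAtZero.comp (Complex.imCLM.contDiff.div_const ρ))
  have hk0 : ∀ w, 2 * ρ < ‖w‖ → k w = 0 := by
    intro w hw
    by_contra hne
    have h1 : |w.re / ρ| < 1 := by
      by_contra h; exact hne (by simp only [k, bumpAtZero_eq_zero (not_lt.mp h), zero_mul])
    have h2 : |w.im / ρ| < 1 := by
      by_contra h; exact hne (by simp only [k, bumpAtZero_eq_zero (not_lt.mp h), mul_zero])
    rw [abs_div, abs_of_pos hρ0, div_lt_one hρ0] at h1 h2
    have := Complex.norm_le_abs_re_add_abs_im w
    linarith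
  have hk1 : ∀ w, ‖w‖ < ρ / 2 → k w = 1 := by
    intro w hw
    have h1 : |w.re / ρ| ≤ 1 / 2 := by
      rw [abs_div, abs_of_pos hρ0, div_le_iff₀ hρ0]
      linarith [Complex.abs_re_le_norm w]
    have h2 : |w.im / ρ| ≤ 1 / 2 := by
      rw [abs_div, abs_of_pos hρ0, div_le_iff₀ hρ0]
      linarith [Complex.abs_im_le_norm w]
    simp only [k, bumpAtZero_eq_one h1, bumpAtZero_eq_one h2, mul_one]
  -- the generating function, before scaling
  let S : ℂ × ℂ → ℝ := fun z => b z.1 * (k z.2 * (ℓ z.2 ^ 2 / 2))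
  have hS : ContDiff ℝ ∞ S := (hb.smooth.comp contDiff_fst).mul
    ((hk.comp contDiff_snd).mul (((ℓ.contDiff.comp contDiff_snd).pow 2).div_const 2))
  have hSsupp : HasCompactSupport S := by
    refine HasCompactSupport.of_support_subset_isCompact
      (hb.compact.isCompact.prod (isCompact_closedBall (0 : ℂ) (2 * ρ))) fun z hz => ⟨?_, ?_⟩
    · by_contra h
      exact hz (by simp only [S, image_eq_zero_of_notMem_tsupport h, zero_mul])
    · by_contra h
      rw [mem_closedBall_zero_iff, not_le] at h
      exact hz (by simp only [S, hk0 _ h, zero_mul, mul_zero])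
  have hSnear : ∀ z : ℂ × ℂ, ‖z.2‖ < ρ / 2 → fderiv ℝ S z =
      (ℓ z.2 ^ 2 / 2) • (fderiv ℝ b z.1).comp (ContinuousLinearMap.fst ℝ ℂ ℂ) +
        (b z.1 * ℓ z.2) • ℓ.comp (ContinuousLinearMap.snd ℝ ℂ ℂ) := by
    intro z hz
    have hbd : HasFDerivAt (fun y : ℂ × ℂ => b y.1)
        ((fderiv ℝ b z.1).comp (ContinuousLinearMap.fst ℝ ℂ ℂ)) z :=
      HasFDerivAt.comp (g := b) z ((hb.smooth.differentiable (by simp) z.1).hasFDerivAt)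
        hasFDerivAt_fst
    have hld : HasFDerivAt (fun y : ℂ × ℂ => ℓ y.2) (ℓ.comp (ContinuousLinearMap.snd ℝ ℂ ℂ)) z :=
      HasFDerivAt.comp (g := ℓ) z ℓ.hasFDerivAt hasFDerivAt_snd
    have hq : HasFDerivAt (fun y : ℂ × ℂ => b y.1 * ((1 / 2 : ℝ) * (ℓ y.2 * ℓ y.2))) _ z :=
      hbd.mul ((hld.mul hld).const_mul (1 / 2 : ℝ))
    have he : S =ᶠ[𝓝 z] fun y : ℂ × ℂ => b y.1 * ((1 / 2 : ℝ) * (ℓ y.2 * ℓ y.2)) := by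
      have : IsOpen {y : ℂ × ℂ | ‖y.2‖ < ρ / 2} := isOpen_lt (by fun_prop) (by fun_prop)
      filter_upwards [this.mem_nhds hz] with y hy
      simp only [S, hk1 _ hy]
      ring
    rw [he.fderiv_eq, hq.fderiv]
    refine ContinuousLinearMap.ext fun v => ?_
    simp
    ring
  have hS2 : ∀ (z v : ℂ), fderiv ℝ (fderiv ℝ S) (z, 0) (0, v) =
      (b z * ℓ v) • ℓ.comp (ContinuousLinearMap.snd ℝ ℂ ℂ) := by
    intro z v
    have hdd : HasFDerivAt (fderiv ℝ S) (fderiv ℝ (fderiv ℝ S) (z, 0)) (z, 0) :=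
      ((hS.fderiv_right (m := ∞) (by simp)).differentiable (by simp) _).hasFDerivAt
    have hline : HasDerivAt (fun t : ℝ => ((z, t • v) : ℂ × ℂ)) (0, v) 0 := by
      have h1 : HasDerivAt (fun t : ℝ => t • v) ((1 : ℝ) • v) 0 :=
        (hasDerivAt_id (0 : ℝ)).smul_const v
      rw [one_smul] at h1
      exact (hasDerivAt_const (0 : ℝ) z).prodMk h1
    have h0 : ((z, (0 : ℝ) • v) : ℂ × ℂ) = (z, 0) := by rw [zero_smul]
    have hdd' : HasFDerivAt (fderiv ℝ S) (fderiv ℝ (fderiv ℝ S) (z, 0)) (z, (0 : ℝ) • v) := by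
      rw [h0]; exact hdd
    have h2 : HasDerivAt (fun t : ℝ => fderiv ℝ S (z, t • v))
        (fderiv ℝ (fderiv ℝ S) (z, 0) (0, v)) 0 := hdd'.comp_hasDerivAt (0 : ℝ) hline
    have hlin : HasDerivAt (fun t : ℝ => t * (b z * ℓ v)) (1 * (b z * ℓ v)) 0 :=
      (hasDerivAt_id (0 : ℝ)).mul_const _
    have h3 : HasDerivAt (fun t : ℝ =>
        (t ^ 2 * (ℓ v ^ 2 / 2)) • (fderiv ℝ b z).comp (ContinuousLinearMap.fst ℝ ℂ ℂ) +
        (t * (b z * ℓ v)) • ℓ.comp (ContinuousLinearMap.snd ℝ ℂ ℂ))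
        ((((2 : ℕ) : ℝ) * (0 : ℝ) ^ (2 - 1) * (ℓ v ^ 2 / 2)) •
          (fderiv ℝ b z).comp (ContinuousLinearMap.fst ℝ ℂ ℂ) +
        (1 * (b z * ℓ v)) • ℓ.comp (ContinuousLinearMap.snd ℝ ℂ ℂ)) 0 :=
      (((hasDerivAt_pow 2 (0 : ℝ)).mul_const (ℓ v ^ 2 / 2)).smul_const _).add
        (hlin.smul_const (ℓ.comp (ContinuousLinearMap.snd ℝ ℂ ℂ)))
    have h4 : (fun t : ℝ => fderiv ℝ S (z, t • v)) =ᶠ[𝓝 0] fun t : ℝ =>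
        (t ^ 2 * (ℓ v ^ 2 / 2)) • (fderiv ℝ b z).comp (ContinuousLinearMap.fst ℝ ℂ ℂ) +
        (t * (b z * ℓ v)) • ℓ.comp (ContinuousLinearMap.snd ℝ ℂ ℂ) := by
      have : IsOpen {t : ℝ | ‖t • v‖ < ρ / 2} := isOpen_lt (by fun_prop) (by fun_prop)
      filter_upwards [this.mem_nhds (by simp [hρ0])] with t ht
      rw [hSnear _ ht]
      simp only [map_smul, smul_eq_mul]
      congr 2 <;> ring
    have h5 := h2.unique (h3.congr_of_eventuallyEq h4)
    rw [h5]
    simp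
  have hSP : ∀ z ∈ P, fderiv ℝ S z = 0 := by
    intro z hz
    by_cases h1 : z.1 ∈ tsupport b
    · rcases hiso z hz h1 with h2 | h2
      · rw [hSnear z (by rw [h2, norm_zero]; positivity), h2]
        simp
      · have : S =ᶠ[𝓝 z] fun _ => 0 := by
          have ho : IsOpen {y : ℂ × ℂ | 2 * ρ < ‖y.2‖} := isOpen_lt (by fun_prop) (by fun_prop)
          filter_upwards [ho.mem_nhds (show 2 * ρ < ‖z.2‖ by linarith)] with y hy
          simp only [S, hk0 _ hy, zero_mul, mul_zero]
        rw [this.fderiv_eq, fderiv_const_apply]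
    · have : S =ᶠ[𝓝 z] fun _ => 0 := by
        have ho : IsOpen {y : ℂ × ℂ | y.1 ∉ tsupport b} :=
          (isClosed_tsupport b).isOpen_compl.preimage continuous_fst
        filter_upwards [ho.mem_nhds h1] with y hy
        simp only [S, image_eq_zero_of_notMem_tsupport hy, zero_mul]
      rw [this.fderiv_eq, fderiv_const_apply]
  obtain ⟨C, hC⟩ : ∃ C, ∀ z, ‖fderiv ℝ (symplecticGradient S) z‖ ≤ C := by
    refine (hS.symplecticGradient.continuous_fderiv (by simp)).bounded_above_of_compact_support ?_
    refine HasCompactSupport.fderiv ℝ ?_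
    exact (hSsupp.fderiv ℝ).comp_left (map_zero symplecticSharp)
  obtain ⟨n, hn⟩ := exists_nat_ge (2 * C + 1)
  have hn0 : (0 : ℝ) < n := by
    have : 0 ≤ C := (norm_nonneg _).trans (hC 0)
    linarith
  -- An n-th part of the generating function satisfies the smallness condition; the full shear is
  -- recovered as an n-th power.
  set c : ℝ := (n : ℝ)⁻¹ with hc
  have hc0 : 0 < c := inv_pos.mpr hn0
  have hSc : ContDiff ℝ ∞ (fun z => c * S z) := contDiff_const.mul hS
  have hgrad : ∀ z, symplecticGradient (fun z => c * S z) z = c • symplecticGradient S z := by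
    intro z
    rw [symplecticGradient, fderiv_const_mul (hS.differentiable (by simp) z), map_smul]
    rfl
  have hgradd : ∀ z, HasFDerivAt (symplecticGradient S) (fderiv ℝ (symplecticGradient S) z) z :=
    fun z => (hS.symplecticGradient.differentiable (by simp) z).hasFDerivAt
  have hgradc : ∀ z, HasFDerivAt (fun z => c • symplecticGradient S z)
      (c • fderiv ℝ (symplecticGradient S) z) z := fun z => (hgradd z).const_smul c
  have hgrad' : symplecticGradient (fun z => c * S z) = fun z => c • symplecticGradient S z :=
    funext hgrad
  obtain ⟨Φ, Ψ, hΦ, hgen⟩ := exists_isotopy_of_generatingFunction (P := P) hSc (fun z => by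
      rw [hgrad', (hgradc z).fderiv, norm_smul, Real.norm_eq_abs, abs_of_pos hc0, hc,
        inv_mul_le_iff₀ hn0]
      linarith [hC z]) (fun z hz => by
      rw [hgrad, symplecticGradient, hSP z hz, map_zero, smul_zero])
  set e : ℂ := (ℓ Complex.I : ℂ) - ℓ 1 * Complex.I with he
  -- The shear direction lies in the kernel of ℓ, so coefficients add under composition.
  have hℓe : ℓ e = 0 := by
    have h1 : e = ℓ Complex.I • (1 : ℂ) - ℓ 1 • Complex.I := by simp [he]
    rw [h1, map_sub, map_smul, map_smul, smul_eq_mul, smul_eq_mul]; ring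
  have hstep : IsNormalDerivative a P (fun z v => v + (c * b z * ℓ v) • e) := by
    refine ⟨Φ, Ψ, hΦ, fun z hz v => ?_⟩
    set X := symplecticGradient (fun z => c * S z) with hX
    have hX0 : X (z, 0) = 0 := by
      rw [hgrad, symplecticGradient, hSP _ (hDP hz), map_zero, smul_zero]
    set A := fderiv ℝ X (z, 0) with hA
    have hXd : HasFDerivAt X A (z, 0) :=
      (hSc.symplecticGradient.differentiable (by simp) _).hasFDerivAt
    have hAv : ∀ v : ℂ, A (0, v) = (c * b z * ℓ v) • ((0, e) : ℂ × ℂ) := by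
      intro v
      have : A = c • fderiv ℝ (symplecticGradient S) (z, 0) := by
        rw [hA, hgrad', (hgradc (z, 0)).fderiv]
      rw [this, _root_.smul_apply, fderiv_symplecticGradient hS, ContinuousLinearMap.comp_apply,
        hS2, map_smul, smul_smul, mul_assoc, symplecticSharp_apply]
      simp [he]
    have h1 : HasFDerivAt (fun w => w - projIm (X w))
        (ContinuousLinearMap.id ℝ (ℂ × ℂ) - projIm.comp A) (z, 0) :=
      (hasFDerivAt_id _).sub (projIm.hasFDerivAt.comp _ hXd)
    have h2 : HasFDerivAt (fun w => w + projRe (X w))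
        (ContinuousLinearMap.id ℝ (ℂ × ℂ) + projRe.comp A) (z, 0) :=
      (hasFDerivAt_id _).add (projRe.hasFDerivAt.comp _ hXd)
    have h3 : HasFDerivAt (Φ 1) (fderiv ℝ (Φ 1) (z, 0))
        ((fun w => w - projIm (X w)) (z, 0)) := by
      simp only [hX0, map_zero, sub_zero]
      exact (hΦ.differentiableAt 1 _).hasFDerivAt
    have h4 := h3.comp (z, 0) h1
    have h5 : (Φ 1 ∘ fun w => w - projIm (X w)) = fun w => w + projRe (X w) := funext hgen
    rw [h5] at h4
    have h6 : ∀ u : ℂ, fderiv ℝ (Φ 1) (z, 0) ((0, u) - projIm (A (0, u))) =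
        (0, u) + projRe (A (0, u)) := fun u =>
      congrArg (fun L : (ℂ × ℂ) →L[ℝ] ℂ × ℂ => L (0, u)) (h4.unique h2)
    have hIm : ∀ t : ℝ, projIm (t • ((0, e) : ℂ × ℂ)) = (0, -(t * ℓ 1) • Complex.I) := by
      intro t
      rw [projIm_apply]
      simp [he]
    have hRe : ∀ t : ℝ, projRe (t • ((0, e) : ℂ × ℂ)) = (0, ((t * ℓ Complex.I : ℝ) : ℂ)) := by
      intro t
      rw [projRe_apply]
      simp [he]
    -- This vector u solves u − i Im(Au) = v, where Au denotes the second component of A(0, u); `hℓ`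
    -- gives ℓ(u) = ℓ(v).
    have h7 := h6 (v - (c * b z * ℓ v * ℓ 1) • Complex.I)
    have h8 : ℓ (v - (c * b z * ℓ v * ℓ 1) • Complex.I) = ℓ v := by
      rw [map_sub, map_smul, smul_eq_mul, mul_assoc, hℓ, mul_zero, sub_zero]
    rw [hAv, h8, hIm, hRe] at h7
    convert h7 using 1
    · congr 1
      ext <;> simp
    · refine Prod.ext (by simp) ?_
      simp [he]
      ring
  have hiter : ∀ m : ℕ, IsNormalDerivative a P (fun z v => v + (m * (c * b z * ℓ v)) • e) := by
    intro m
    induction m with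
    | zero => simpa using IsNormalDerivative.id a P
    | succ m ih =>
      convert ih.comp hDP hstep using 3 with z v
      rw [map_add, map_smul, hℓe, smul_zero, add_zero, add_assoc, ← add_smul]
      congr 2
      push_cast; ring
  convert hiter n using 5 with z v
  rw [hc]
  field_simp

/-! ### Factorization of unimodular matrices into shears -/

/-- The action of real `2 × 2` matrices on `ℂ = ℝ²`. -/
def matrixAction (m : Matrix (Fin 2) (Fin 2) ℝ) (v : ℂ) : ℂ :=
  ⟨m 0 0 * v.re + m 0 1 * v.im, m 1 0 * v.re + m 1 1 * v.im⟩

theorem matrixAction_mul (m n : Matrix (Fin 2) (Fin 2) ℝ) (v : ℂ) :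
    matrixAction (m * n) v = matrixAction m (matrixAction n v) := by
  simp only [matrixAction, Matrix.mul_apply, Fin.sum_univ_two]
  refine Complex.ext ?_ ?_ <;> simp <;> ring

theorem matrixAction_one (v : ℂ) : matrixAction 1 v = v := by
  refine Complex.ext ?_ ?_ <;> simp [matrixAction]

theorem IsNormalDerivative.congr {a : ℝ} {P : Set (ℂ × ℂ)} {M M' : ℂ → ℂ → ℂ}
    (h : IsNormalDerivative a P M) (hM : ∀ z, (z, 0) ∈ hopfDisc a → ∀ v, M' z v = M z v) :
    IsNormalDerivative a P M' := by
  obtain ⟨Φ, Ψ, hΦ, h⟩ := h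
  exact ⟨Φ, Ψ, hΦ, fun z hz v => by rw [h z hz, hM z hz]⟩

/-- The family of matrices `M z` is the normal derivative of a symplectic isotopy fixing `P`. -/
def IsNormalMatrix (a : ℝ) (P : Set (ℂ × ℂ)) (M : ℂ → Matrix (Fin 2) (Fin 2) ℝ) : Prop :=
  IsNormalDerivative a P (fun z => matrixAction (M z))

section

variable {a : ℝ} {P : Set (ℂ × ℂ)} {O : Set ℂ}

theorem IsNormalMatrix.mul (hDP : hopfDisc a ⊆ P) {M N : ℂ → Matrix (Fin 2) (Fin 2) ℝ}
    (hM : IsNormalMatrix a P M) (hN : IsNormalMatrix a P N) :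
    IsNormalMatrix a P (fun z => M z * N z) := by
  exact (IsNormalDerivative.comp hDP hM hN).congr fun z _ v => matrixAction_mul _ _ v

theorem IsNormalMatrix.pow (hDP : hopfDisc a ⊆ P) {M : ℂ → Matrix (Fin 2) (Fin 2) ℝ}
    (hM : IsNormalMatrix a P M) (n : ℕ) : IsNormalMatrix a P (fun z => M z ^ n) := by
  induction n with
  | zero =>
    refine (IsNormalDerivative.id a P).congr fun z _ v => ?_
    simp only [pow_zero, matrixAction_one]
  | succ n ih => simpa only [pow_succ] using ih.mul hDP hM

theorem isNormalMatrix_upper (hDP : hopfDisc a ⊆ P) (hPO : IsIsolatedOver O P) {b : ℂ → ℝ}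
    (hb : IsTestFunctionOn O b) : IsNormalMatrix a P (fun z => !![1, b z; 0, 1]) := by
  refine (isNormalDerivative_shear (a := a) hDP hPO Complex.imCLM (by simp) hb).congr
    fun z _ v => ?_
  refine Complex.ext ?_ ?_ <;> simp [matrixAction]

theorem isNormalMatrix_lower (hDP : hopfDisc a ⊆ P) (hPO : IsIsolatedOver O P) {b : ℂ → ℝ}
    (hb : IsTestFunctionOn O b) : IsNormalMatrix a P (fun z => !![1, 0; b z, 1]) := by
  -- For ℓ = Re the shear direction is −i, hence the sign in front of b.
  refine (isNormalDerivative_shear (a := a) hDP hPO Complex.reCLM (by simp)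
    (hb.mul_left (f := fun _ => -1) contDiff_const)).congr fun z _ v => ?_
  refine Complex.ext ?_ ?_ <;> simp [matrixAction]
  ring

/-- Unimodular matrices with positive upper left entry are products of shears. -/
theorem isNormalMatrix_of_pos (hO : IsOpen O) (hDP : hopfDisc a ⊆ P) (hPO : IsIsolatedOver O P)
    {p q r : ℂ → ℝ} (hp0 : ∀ z, 0 < p z) (hp : IsTestFunctionOn O (fun z => p z - 1))
    (hq : IsTestFunctionOn O q) (hr : IsTestFunctionOn O r) :
    IsNormalMatrix a P (fun z => !![p z, q z; r z, (1 + q z * r z) / p z]) := by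
  -- The factorization of diag(p, 1/p) uses a shear with constant coefficient 1; β replaces it by a
  -- compactly supported one without effect where p = 1.
  obtain ⟨β, hβ, hβ1⟩ := exists_testFunction_eq_one hO hp.compact.isCompact hp.subset
  have hps : ContDiff ℝ ∞ p := by
    have := hp.smooth.add (contDiff_const (c := (1 : ℝ)))
    simpa using this
  have hinv : ContDiff ℝ ∞ (fun z => (p z)⁻¹) := hps.inv fun z => (hp0 z).ne'
  have hβp : ∀ z, β z * (p z - 1) = p z - 1 := fun z => by
    by_cases hz : z ∈ tsupport (fun z => p z - 1)
    · rw [hβ1 z hz, one_mul]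
    · have : p z - 1 = 0 := image_eq_zero_of_notMem_tsupport (f := fun z => p z - 1) hz
      rw [this, mul_zero]
  -- Gauss decomposition: a lower shear by r/p, then diag(p, 1/p), then an upper shear by q/p. The
  -- four middle factors multiply to the diagonal matrix.
  have m1 := isNormalMatrix_lower (a := a) hDP hPO (hr.mul_left hinv)
  have m2 := isNormalMatrix_lower (a := a) hDP hPO (hp.mul_left hinv.neg)
  have m3 := isNormalMatrix_upper (a := a) hDP hPO hβ
  have m4 := isNormalMatrix_lower (a := a) hDP hPO hp
  have m5 := isNormalMatrix_upper (a := a) hDP hPO (hβ.mul_left hinv.neg)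
  have m6 := isNormalMatrix_upper (a := a) hDP hPO (hq.mul_left hinv)
  have := ((((m1.mul hDP m2).mul hDP m3).mul hDP m4).mul hDP m5).mul hDP m6
  convert this using 2 with z
  have h0 := (hp0 z).ne'
  have hβ' := hβp z
  simp only [Matrix.mul_fin_two]
  have e1 : β z * (p z - 1) = p z - 1 := hβ'
  ext i j
  fin_cases i <;> fin_cases j <;> simp <;> field_simp
  · linear_combination -e1
  · linear_combination (β z - q z) * e1
  · linear_combination (p z - 1 - r z) * e1
  · linear_combination (r z * β z + 1 - p z * β z - q z * r z + q z * p z - q z + β z + p z - 1) * e1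

/-- The matrix of the rotation by `θ`. -/
noncomputable def rotationMatrix (θ : ℝ) : Matrix (Fin 2) (Fin 2) ℝ :=
  !![Real.cos θ, -Real.sin θ; Real.sin θ, Real.cos θ]

theorem rotationMatrix_pow (θ : ℝ) (n : ℕ) : rotationMatrix θ ^ n = rotationMatrix (n * θ) := by
  induction n with
  | zero => simp [rotationMatrix, Matrix.one_fin_two]
  | succ n ih =>
    rw [pow_succ, ih, rotationMatrix, rotationMatrix, rotationMatrix, Matrix.mul_fin_two]
    push_cast
    rw [add_mul, one_mul, Real.cos_add, Real.sin_add]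
    congr 1
    ext i j
    fin_cases i <;> fin_cases j <;> simp <;> ring

theorem isNormalMatrix_rotation (hO : IsOpen O) (hDP : hopfDisc a ⊆ P) (hPO : IsIsolatedOver O P)
    {θ : ℂ → ℝ} (hθ : IsTestFunctionOn O θ) :
    IsNormalMatrix a P (fun z => rotationMatrix (θ z)) := by
  obtain ⟨C, hC⟩ := hθ.smooth.continuous.bounded_above_of_compact_support hθ.compact
  -- The rotation is the n-th power of one with angle at most 1 in absolute value, whose cosine is
  -- positive.
  obtain ⟨n, hn⟩ := exists_nat_ge (C + 1)
  have hn0 : (0 : ℝ) < n := by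
    have : 0 ≤ C := (norm_nonneg _).trans (hC 0)
    linarith
  have hcos : ∀ z, 0 < Real.cos ((n : ℝ)⁻¹ * θ z) := fun z => by
    have h1 : |(n : ℝ)⁻¹ * θ z| ≤ 1 := by
      rw [abs_mul, abs_of_pos (inv_pos.mpr hn0), inv_mul_le_iff₀ hn0]
      have := hC z
      rw [Real.norm_eq_abs] at this
      linarith
    rw [abs_le] at h1
    have := Real.pi_gt_three
    exact Real.cos_pos_of_mem_Ioo ⟨by linarith, by linarith⟩
  have hθn : IsTestFunctionOn O (fun z => (n : ℝ)⁻¹ * θ z) := hθ.mul_left contDiff_const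
  have := isNormalMatrix_of_pos (a := a) hO hDP hPO hcos
    (hθn.comp_left (f := fun x => Real.cos x - 1) (Real.contDiff_cos.sub contDiff_const) (by simp))
    (hθn.comp_left (f := fun x => -Real.sin x) Real.contDiff_sin.neg (by simp))
    (hθn.comp_left Real.contDiff_sin Real.sin_zero)
  convert this.pow hDP n using 2 with z
  have h1 : rotationMatrix (θ z) = rotationMatrix ((n : ℝ)⁻¹ * θ z) ^ n := by
    rw [rotationMatrix_pow, mul_inv_cancel_left₀ hn0.ne']
  rw [h1, rotationMatrix]
  congr 2
  have := (hcos z).ne'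
  have h2 := Real.sin_sq_add_cos_sq ((n : ℝ)⁻¹ * θ z)
  have h3 : Real.cos ((n : ℝ)⁻¹ * θ z) = (1 + -Real.sin ((n : ℝ)⁻¹ * θ z) *
      Real.sin ((n : ℝ)⁻¹ * θ z)) / Real.cos ((n : ℝ)⁻¹ * θ z) := by
    rw [eq_div_iff this]; linear_combination h2
  rw [← h3]

end

/-! ### Logarithms on star-shaped sets -/

/-- With u the logarithm obtained by integrating γ'/γ, the product γ exp(−u) is constant; `g` plays
the role of 1/γ on [0, 1]. -/
theorem exp_log_add_integral_eq {γ γ' g : ℝ → ℂ} (hγ : ∀ s, HasDerivAt γ (γ' s) s)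
    (hI : Continuous fun t => g t * γ' t) (hg : ∀ s ∈ Icc (0 : ℝ) 1, g s * γ s = 1) :
    Complex.exp (Complex.log (γ 0) + ∫ t in (0 : ℝ)..1, g t * γ' t) = γ 1 := by
  have hγ0 : γ 0 ≠ 0 := right_ne_zero_of_mul_eq_one (hg 0 ⟨le_rfl, zero_le_one⟩)
  set u : ℝ → ℂ := fun s => Complex.log (γ 0) + ∫ t in (0 : ℝ)..s, g t * γ' t with hu'
  have hu : ∀ s, HasDerivAt u (g s * γ' s) s := fun s =>
    (hI.integral_hasStrictDerivAt 0 s).hasDerivAt.const_add _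
  have hprod : ∀ s ∈ uIcc (0 : ℝ) 1, HasDerivAt (fun s : ℝ => γ s * Complex.exp (-u s)) 0 s := by
    intro s hs
    rw [uIcc_of_le zero_le_one] at hs
    refine ((hγ s).mul ((hu s).neg.cexp)).congr_deriv ?_
    linear_combination (-(γ' s) * Complex.exp (-u s)) * hg s hs
  have h3 := intervalIntegral.integral_eq_sub_of_hasDerivAt hprod intervalIntegrable_const
  have h4 : u 0 = Complex.log (γ 0) := by simp [hu']
  rw [intervalIntegral.integral_zero, h4, Complex.exp_neg (Complex.log _), Complex.exp_log hγ0,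
    mul_inv_cancel₀ hγ0] at h3
  have h5 : γ 1 * Complex.exp (-u 1) = 1 := by linear_combination -h3
  rw [Complex.exp_neg, ← div_eq_mul_inv, div_eq_one_iff_eq (Complex.exp_ne_zero _)] at h5
  exact h5.symm

/-- Smooth logarithms on the disc, normalized to vanish on a connected set where `c = 1`. -/
theorem exists_contDiff_log {c : ℂ → ℂ} (hc : ContDiff ℝ ∞ c) {B : Set ℂ} (hB : IsClosed B)
    (hBs : ∀ z ∈ B, ∀ t ∈ Icc (0 : ℝ) 1, t • z ∈ B) (hc0 : ∀ z ∈ B, c z ≠ 0)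
    {C : Set ℂ} (hC : IsPreconnected C) (hCB : C ⊆ B) (hc1 : ∀ z ∈ C, c z = 1) :
    ∃ w : ℂ → ℂ, ContDiff ℝ ∞ w ∧ (∀ z ∈ B, Complex.exp (w z) = c z) ∧ ∀ z ∈ C, w z = 0 := by
  obtain ⟨τ, hτ, hτs, hτr⟩ := hB.isOpen_compl.exists_contDiff_support_eq (n := ⊤)
  have hτ0 : ∀ z, 0 ≤ τ z := fun z => (hτr (mem_range_self z)).1
  have hτB : ∀ z ∈ B, τ z = 0 := fun z hz => by
    by_contra h
    have : z ∈ Bᶜ := by rw [← hτ]; exact h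
    exact this hz
  -- a smooth function on `ℂ` that equals `1 / c` on `B`
  let g : ℂ → ℂ := fun z => ((‖c z‖ ^ 2 + τ z)⁻¹ : ℝ) • (starRingEnd ℂ) (c z)
  have hpos : ∀ z, ‖c z‖ ^ 2 + τ z ≠ 0 := fun z => by
    by_cases hz : z ∈ B
    · have := norm_pos_iff.mpr (hc0 z hz)
      have := hτ0 z
      positivity
    · have h1 : τ z ≠ 0 := by
        have : z ∈ Function.support τ := by rw [hτ]; exact hz
        exact this
      have := lt_of_le_of_ne (hτ0 z) h1.symm
      positivity
  have hg : ContDiff ℝ ∞ g :=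
    ((((contDiff_norm_sq ℝ).comp hc).add hτs).inv hpos).smul
      (Complex.conjCLE.contDiff.comp hc)
  have hgc : ∀ z ∈ B, g z * c z = 1 := fun z hz => by
    have h1 : ((‖c z‖ ^ 2 : ℝ) : ℂ) ≠ 0 := by
      have := norm_pos_iff.mpr (hc0 z hz)
      exact_mod_cast (by positivity : ‖c z‖ ^ 2 ≠ 0)
    simp only [g, hτB z hz, add_zero, Complex.real_smul]
    rw [mul_assoc, mul_comm ((starRingEnd ℂ) (c z)), Complex.mul_conj, Complex.normSq_eq_norm_sq,
      Complex.ofReal_inv, inv_mul_cancel₀ h1]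
  have hcd : ∀ z, HasFDerivAt c (fderiv ℝ c z) z := fun z =>
    (hc.differentiable (by simp) z).hasFDerivAt
  have hdc : ContDiff ℝ ∞ (fderiv ℝ c) := hc.fderiv_right (by simp)
  let I : ℂ → ℝ → ℂ := fun z t => g (t • z) * fderiv ℝ c (t • z) z
  have hIs : ContDiff ℝ ∞ (fun p : ℂ × ℝ => I p.1 p.2) := by
    have h1 : ContDiff ℝ ∞ fun p : ℂ × ℝ => p.2 • p.1 := contDiff_snd.smul contDiff_fst
    exact (hg.comp h1).mul ((hdc.comp h1).clm_apply contDiff_fst)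
  let w₀ : ℂ → ℂ := fun z => Complex.log (c 0) + ∫ t in (0 : ℝ)..1, I z t
  have hw₀ : ContDiff ℝ ∞ w₀ := contDiff_const.add (contDiff_intervalIntegral hIs)
  have hexp₀ : ∀ z ∈ B, Complex.exp (w₀ z) = c z := by
    intro z hz
    have hcs : ∀ s : ℝ, HasDerivAt (fun s : ℝ => c (s • z)) (fderiv ℝ c (s • z) z) s := fun s => by
      have h1 := (hcd (s • z)).comp_hasDerivAt s ((hasDerivAt_id s).smul_const z)
      rw [one_smul] at h1
      exact h1
    have h1 : Continuous fun t : ℝ => t • z := by fun_prop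
    have h2 := exp_log_add_integral_eq (g := fun t => g (t • z)) hcs
      ((hg.continuous.comp h1).mul ((hdc.continuous.comp h1).clm_apply continuous_const))
      fun s hs => hgc _ (hBs z hz s hs)
    rw [one_smul, zero_smul] at h2
    exact h2
  rcases C.eq_empty_or_nonempty with rfl | ⟨z₀, hz₀⟩
  · exact ⟨w₀, hw₀, hexp₀, fun z hz => hz.elim⟩
  · have hw1 : ∀ z ∈ C, Complex.exp (w₀ z) = 1 := fun z hz => by rw [hexp₀ z (hCB hz), hc1 z hz]
    -- On C the logarithm takes values in the countable, hence totally disconnected, set 2πiℤ, so it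
    -- is constant there and can be normalized to 0.
    have hcount : (range fun n : ℤ => (n : ℂ) * (2 * Real.pi * Complex.I)).Countable :=
      countable_range _
    have hconst : ∀ z ∈ C, w₀ z = w₀ z₀ := fun z hz => by
      refine hcount.isTotallyDisconnected (w₀ '' C) ?_ (hC.image _ hw₀.continuous.continuousOn)
        (mem_image_of_mem _ hz) (mem_image_of_mem _ hz₀)
      rintro _ ⟨y, hy, rfl⟩
      obtain ⟨n, hn⟩ := Complex.exp_eq_one_iff.mp (hw1 y hy)
      exact ⟨n, hn.symm⟩
    refine ⟨fun z => w₀ z - w₀ z₀, hw₀.sub contDiff_const, fun z hz => ?_, fun z hz => ?_⟩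
    · rw [Complex.exp_sub, hw1 z₀ hz₀, div_one, hexp₀ z hz]
    · simp only [hconst z hz, sub_self]

/-! ### The normal derivative along the Hopf disc -/

/-- The closed unit-area disc, the projection of the Hopf disc. -/
def unitAreaDisc : Set ℂ := {z | Real.pi * ‖z‖ ^ 2 ≤ 1}

theorem mem_hopfDisc_iff_mem_unitAreaDisc {a : ℝ} {z : ℂ} :
    ((z, 0) : ℂ × ℂ) ∈ hopfDisc a ↔ z ∈ unitAreaDisc := by
  rw [mem_hopfDisc]; simp [unitAreaDisc]

theorem isClosed_unitAreaDisc : IsClosed unitAreaDisc :=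
  isClosed_le (by fun_prop) (by fun_prop)

theorem isCompact_unitAreaDisc : IsCompact unitAreaDisc :=
  Metric.isCompact_of_isClosed_isBounded isClosed_unitAreaDisc
    ((Metric.isBounded_closedBall (x := (0 : ℂ)) (r := 1)).subset fun z hz => by
      rw [mem_closedBall_zero_iff]
      exact norm_le_one_of_pi_mul_sq_le (le_trans hz one_le_two))

theorem smul_mem_unitAreaDisc {z : ℂ} (hz : z ∈ unitAreaDisc) {t : ℝ} (ht : t ∈ Icc (0 : ℝ) 1) :
    t • z ∈ unitAreaDisc := by
  change Real.pi * ‖t • z‖ ^ 2 ≤ 1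
  have hz' : Real.pi * ‖z‖ ^ 2 ≤ 1 := hz
  rw [norm_smul, Real.norm_eq_abs, mul_pow, sq_abs]
  have h1 : t ^ 2 ≤ 1 := pow_le_one₀ ht.1 ht.2
  have h2 : 0 ≤ Real.pi * ‖z‖ ^ 2 := by positivity
  nlinarith [sq_nonneg t]

theorem uniqueDiffOn_unitAreaDisc : UniqueDiffOn ℝ unitAreaDisc := by
  have h : unitAreaDisc = Metric.closedBall (0 : ℂ) (1 / Real.sqrt Real.pi) := by
    ext z
    have hs : 0 < Real.sqrt Real.pi := Real.sqrt_pos.mpr Real.pi_pos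
    rw [mem_closedBall_zero_iff, le_div_iff₀ hs]
    change Real.pi * ‖z‖ ^ 2 ≤ 1 ↔ _
    rw [← sq_le_one_iff₀ (a := ‖z‖ * Real.sqrt Real.pi) (by positivity), mul_pow,
      Real.sq_sqrt Real.pi_pos.le, mul_comm]
  rw [h]
  refine uniqueDiffOn_convex (convex_closedBall _ _) ⟨0, ?_⟩
  rw [interior_closedBall _ (by positivity)]
  exact Metric.mem_ball_self (by positivity)

section NormalPart

variable {a : ℝ} {P : Set (ℂ × ℂ)} {F : ℂ × ℂ → ℂ × ℂ}

theorem IsSymplecticNearDisc.eq_on_disc (hF : IsSymplecticNearDisc a P F) (hDP : hopfDisc a ⊆ P)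
    {z : ℂ × ℂ} (hz : z ∈ hopfDisc a) : F z = z ∧
      ∀ u v, stdSymplecticForm (fderiv ℝ F z u) (fderiv ℝ F z v) = stdSymplecticForm u v := by
  obtain ⟨ε, hε, h⟩ := hF.tube
  obtain ⟨h1, h2⟩ := h z hz.1 (by rw [hz.2, norm_zero]; exact hε)
  exact ⟨h2 (hDP hz), h1⟩

/-- F is the identity on the disc, where derivatives are unique even at boundary points. -/
theorem IsSymplecticNearDisc.fderiv_tangent (hF : IsSymplecticNearDisc a P F)
    (hDP : hopfDisc a ⊆ P) {z : ℂ} (hz : z ∈ unitAreaDisc) (v : ℂ) :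
    fderiv ℝ F (z, 0) (v, 0) = (v, 0) := by
  have h1 : HasFDerivAt (fun y : ℂ => F (y, 0))
      ((fderiv ℝ F (z, 0)).comp (ContinuousLinearMap.inl ℝ ℂ ℂ)) z :=
    HasFDerivAt.comp (f := fun y : ℂ => ((y, 0) : ℂ × ℂ)) z
      (hF.smooth.differentiable (by simp) _).hasFDerivAt (hasFDerivAt_prodMk_left z 0)
  have h2 : HasFDerivWithinAt (fun y : ℂ => F (y, 0)) (ContinuousLinearMap.inl ℝ ℂ ℂ)
      unitAreaDisc z := by
    refine (hasFDerivAt_prodMk_left (𝕜 := ℝ) z (0 : ℂ)).hasFDerivWithinAt.congr (fun y hy => ?_) ?_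
    · exact (hF.eq_on_disc hDP (mem_hopfDisc_iff_mem_unitAreaDisc.mpr hy)).1
    · exact (hF.eq_on_disc hDP (mem_hopfDisc_iff_mem_unitAreaDisc.mpr hz)).1
  have h3 := (uniqueDiffOn_unitAreaDisc z hz).eq h1.hasFDerivWithinAt h2
  have h4 := congrArg (fun L : ℂ →L[ℝ] ℂ × ℂ => L v) h3
  simpa using h4

/-- The derivative preserves ω and fixes the tangent plane of the disc, so it preserves the
ω-complement of that plane. -/
theorem IsSymplecticNearDisc.fderiv_normal_fst (hF : IsSymplecticNearDisc a P F)
    (hDP : hopfDisc a ⊆ P) {z : ℂ} (hz : z ∈ unitAreaDisc) (v : ℂ) :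
    (fderiv ℝ F (z, 0) (0, v)).1 = 0 := by
  have hω := (hF.eq_on_disc hDP (mem_hopfDisc_iff_mem_unitAreaDisc.mpr hz)).2
  have h1 := hω (1, 0) (0, v)
  have h2 := hω (Complex.I, 0) (0, v)
  rw [hF.fderiv_tangent hDP hz] at h1 h2
  simp only [stdSymplecticForm_eq] at h1 h2
  norm_num at h1 h2
  exact Complex.ext h2 h1

/-- The matrix of the derivative of `F` in the normal direction of the Hopf disc. -/
noncomputable def normalMatrix (F : ℂ × ℂ → ℂ × ℂ) (z : ℂ) : Matrix (Fin 2) (Fin 2) ℝ :=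
  !![(fderiv ℝ F (z, 0) (0, 1)).2.re, (fderiv ℝ F (z, 0) (0, Complex.I)).2.re;
    (fderiv ℝ F (z, 0) (0, 1)).2.im, (fderiv ℝ F (z, 0) (0, Complex.I)).2.im]

theorem matrixAction_normalMatrix (F : ℂ × ℂ → ℂ × ℂ) (z v : ℂ) :
    matrixAction (normalMatrix F z) v = (fderiv ℝ F (z, 0) (0, v)).2 := by
  have hv : ((0, v) : ℂ × ℂ) = v.re • ((0, 1) : ℂ × ℂ) + v.im • ((0, Complex.I) : ℂ × ℂ) := by
    refine Prod.ext ?_ ?_ <;> simp [Complex.re_add_im]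
  rw [hv, map_add, map_smul, map_smul]
  refine Complex.ext ?_ ?_ <;> simp [matrixAction, normalMatrix] <;> ring

theorem contDiff_normalMatrix (hF : ContDiff ℝ ∞ F) (i j : Fin 2) :
    ContDiff ℝ ∞ (fun z => normalMatrix F z i j) := by
  have h : ∀ v : ℂ × ℂ, ContDiff ℝ ∞ (fun z : ℂ => (fderiv ℝ F (z, 0) v).2) := fun v =>
    contDiff_snd.comp (((hF.fderiv_right (m := ∞) (by simp)).comp
      (contDiff_id.prodMk contDiff_const)).clm_apply contDiff_const)
  fin_cases i <;> fin_cases j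
  · exact Complex.reCLM.contDiff.comp (h (0, 1))
  · exact Complex.reCLM.contDiff.comp (h (0, Complex.I))
  · exact Complex.imCLM.contDiff.comp (h (0, 1))
  · exact Complex.imCLM.contDiff.comp (h (0, Complex.I))

theorem IsSymplecticNearDisc.det_normalMatrix (hF : IsSymplecticNearDisc a P F)
    (hDP : hopfDisc a ⊆ P) {z : ℂ} (hz : z ∈ unitAreaDisc) :
    normalMatrix F z 0 0 * normalMatrix F z 1 1 - normalMatrix F z 0 1 * normalMatrix F z 1 0
      = 1 := by
  have hω := (hF.eq_on_disc hDP (mem_hopfDisc_iff_mem_unitAreaDisc.mpr hz)).2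
    (0, 1) (0, Complex.I)
  simp only [stdSymplecticForm_eq, hF.fderiv_normal_fst hDP hz] at hω
  simp at hω
  simp only [normalMatrix]
  simp
  linarith

/-- The normal derivative of a symplectic map along the Hopf disc is the normal derivative of a
symplectic isotopy, supported where it differs from the identity. -/
theorem IsSymplecticNearDisc.isNormalMatrix (hF : IsSymplecticNearDisc a P F)
    (hDP : hopfDisc a ⊆ P) {O : Set ℂ} (hO : IsOpen O) (hPO : IsIsolatedOver O P) {C : Set ℂ}
    (hC : IsPreconnected C) (hCB : C ⊆ unitAreaDisc) (hC1 : ∀ z ∈ C, normalMatrix F z = 1)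
    {χ : ℂ → ℝ} (hχ : IsTestFunctionOn O χ) (hχ1 : ∀ z ∈ unitAreaDisc, z ∉ C → χ z = 1) :
    IsNormalMatrix a P (normalMatrix F) := by
  set A := normalMatrix F with hA
  have hAs : ∀ i j, ContDiff ℝ ∞ (fun z => A z i j) := contDiff_normalMatrix hF.smooth
  have hdet : ∀ z ∈ unitAreaDisc, A z 0 0 * A z 1 1 - A z 0 1 * A z 1 0 = 1 := fun z hz =>
    hF.det_normalMatrix hDP hz
  -- The first column, read as a complex number, is nonzero on the disc since det A = 1. If its
  -- logarithm is ρ + iθ, then A is the rotation by θ times an upper triangular matrix with diagonal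
  -- (e^ρ, e^(−ρ)).
  let c : ℂ → ℂ := fun z => (A z 0 0 : ℂ) + A z 1 0 * Complex.I
  have hcre : ∀ z, (c z).re = A z 0 0 := fun z => by simp [c]
  have hcim : ∀ z, (c z).im = A z 1 0 := fun z => by simp [c]
  have hc : ContDiff ℝ ∞ c :=
    (Complex.ofRealCLM.contDiff.comp (hAs 0 0)).add
      ((Complex.ofRealCLM.contDiff.comp (hAs 1 0)).mul contDiff_const)
  obtain ⟨w, hw, hexp, hwC⟩ := exists_contDiff_log hc isClosed_unitAreaDisc
    (fun z hz t ht => smul_mem_unitAreaDisc hz ht) (fun z hz h0 => by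
      have h1 := hdet z hz
      rw [← hcre, ← hcim, h0] at h1
      simp at h1) hC hCB (fun z hz => by simp [c, hC1 z hz])
  let ρ : ℂ → ℝ := fun z => (w z).re * χ z
  let θ : ℂ → ℝ := fun z => (w z).im * χ z
  let m : ℂ → ℝ := fun z => (Real.cos (θ z) * A z 0 1 + Real.sin (θ z) * A z 1 1) * χ z
  have hρ : IsTestFunctionOn O ρ := hχ.mul_left (Complex.reCLM.contDiff.comp hw)
  have hθ : IsTestFunctionOn O θ := hχ.mul_left (Complex.imCLM.contDiff.comp hw)
  have hm : IsTestFunctionOn O m := hχ.mul_left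
    (((Real.contDiff_cos.comp hθ.smooth).mul (hAs 0 1)).add
      ((Real.contDiff_sin.comp hθ.smooth).mul (hAs 1 1)))
  have hzero : IsTestFunctionOn O (fun _ => 0) := by
    simpa using hχ.mul_left (f := fun _ => 0) contDiff_const
  have h1 := isNormalMatrix_rotation (a := a) hO hDP hPO hθ
  have h2 := isNormalMatrix_of_pos (a := a) hO hDP hPO (p := fun z => Real.exp (ρ z))
    (fun z => Real.exp_pos _)
    (hρ.comp_left (f := fun x => Real.exp x - 1) (Real.contDiff_exp.sub contDiff_const) (by simp))
    hm hzero
  refine IsNormalDerivative.congr (h1.mul hDP h2) fun z hz v => ?_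
  have hz' := mem_hopfDisc_iff_mem_unitAreaDisc.mp hz
  congr 1
  beta_reduce
  -- On C the logarithm is 0 and A = 1, so multiplying by χ there changes nothing; elsewhere on the
  -- disc χ = 1.
  by_cases hzC : z ∈ C
  · have e1 : ρ z = 0 := by simp [ρ, hwC z hzC]
    have e2 : θ z = 0 := by simp [θ, hwC z hzC]
    have e3 : m z = 0 := by simp [m, e2, hC1 z hzC]
    rw [hC1 z hzC, e1, e2, e3]
    simp [rotationMatrix, Matrix.one_fin_two]
  · have hχz := hχ1 z hz' hzC
    have e1 : ρ z = (w z).re := by simp [ρ, hχz]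
    have e2 : θ z = (w z).im := by simp [θ, hχz]
    have e3 : m z = Real.cos (θ z) * A z 0 1 + Real.sin (θ z) * A z 1 1 := by simp [m, hχz]
    have e4 : A z 0 0 = Real.exp (ρ z) * Real.cos (θ z) := by
      rw [e1, e2, ← Complex.exp_re, hexp z hz', hcre]
    have e5 : A z 1 0 = Real.exp (ρ z) * Real.sin (θ z) := by
      rw [e1, e2, ← Complex.exp_im, hexp z hz', hcim]
    have e6 := hdet z hz'
    have e7 := Real.sin_sq_add_cos_sq (θ z)
    have e8 := Real.exp_pos (ρ z)
    rw [e4, e5] at e6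
    have e9 : (1 + m z * 0) / Real.exp (ρ z) =
        Real.cos (θ z) * A z 1 1 - Real.sin (θ z) * A z 0 1 := by
      rw [div_eq_iff e8.ne']; linear_combination -e6
    rw [e9, e3, rotationMatrix, Matrix.mul_fin_two]
    ext i j
    fin_cases i <;> fin_cases j <;> simp
    · rw [e4]; ring
    · linear_combination (-(A z 0 1)) * e7
    · rw [e5]; ring
    · linear_combination (-(A z 1 1)) * e7

/-- After composition with a symplectic isotopy, the derivative along the Hopf disc is the
identity. -/
theorem IsSymplecticNearDisc.exists_isotopy_fderiv_eq_id (hF : IsSymplecticNearDisc a P F)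
    (hDP : hopfDisc a ⊆ P) (hN : IsNormalMatrix a P (normalMatrix F)) :
    ∃ Φ Ψ, IsSymplecticIsotopyFixing P Φ Ψ ∧ ∀ z ∈ hopfDisc a,
      fderiv ℝ (fun z => Φ 1 (F z)) z = ContinuousLinearMap.id ℝ (ℂ × ℂ) := by
  obtain ⟨Φ, Ψ, hΦ, h⟩ := hN
  refine ⟨Ψ, Φ, hΦ.symm, ?_⟩
  have hF' := hF.comp hΦ.symm 1
  rintro ⟨z, z₂⟩ hz
  obtain rfl : z₂ = 0 := hz.2
  have hz' := mem_hopfDisc_iff_mem_unitAreaDisc.mp hz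
  have hchain : fderiv ℝ (fun z => Ψ 1 (F z)) (z, 0) =
      (fderiv ℝ (Ψ 1) (F (z, 0))).comp (fderiv ℝ F (z, 0)) :=
    fderiv_comp _ (hΦ.differentiableAt_inv 1 _) (hF.smooth.differentiable (by simp) _)
  have hnormal : ∀ v, fderiv ℝ (fun z => Ψ 1 (F z)) (z, 0) (0, v) = (0, v) := fun v => by
    have e1 : fderiv ℝ F (z, 0) (0, v) = fderiv ℝ (Φ 1) (z, 0) (0, v) := by
      rw [h z hz]
      simp only [matrixAction_normalMatrix]
      exact Prod.ext (hF.fderiv_normal_fst hDP hz' v) rfl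
    have e2 := hΦ.symm.fderiv_comp_fderiv_inv 1 (z, 0) (0, v)
    rw [hΦ.fixes 1 _ (hDP hz)] at e2
    rw [hchain, ContinuousLinearMap.comp_apply, e1, (hF.eq_on_disc hDP hz).1, e2]
  refine ContinuousLinearMap.ext fun u => ?_
  have hu : u = (u.1, 0) + (0, u.2) := by simp
  rw [hu, map_add, hnormal, hF'.fderiv_tangent hDP hz']
  rfl

end NormalPart

/-! ### Conclusion and the absolute version -/

section FinalIsotopy

variable {a : ℝ} {P : Set (ℂ × ℂ)} {F : ℂ × ℂ → ℂ × ℂ}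

theorem IsSymplecticNearDisc.exists_isotopy_comp_eq_id (ha : 0 < a) (hPE : P ⊆ ellipsoid 1 a)
    (hDP : hopfDisc a ⊆ P) (hjoin : JoinsHopfDisc a P) (hF : IsSymplecticNearDisc a P F)
    (hN : IsNormalMatrix a P (normalMatrix F)) :
    ∃ Φ Ψ, IsSymplecticIsotopyFixing P Φ Ψ ∧
      ∃ W, IsOpen W ∧ hopfDisc a ⊆ W ∧ ∀ z ∈ ellipsoid 1 a ∩ W, Φ 1 (F z) = z := by
  obtain ⟨Φ, Ψ, hΦ, hd⟩ := hF.exists_isotopy_fderiv_eq_id hDP hN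
  obtain ⟨Φ', Ψ', hΦ', W, hW, hDW, hWF⟩ := (hF.comp hΦ 1).exists_isotopy ha hPE hDP hjoin
    (isClosed_hopfDisc a) subset_rfl (hasCutoffs_hopfDisc a) hd
  refine ⟨_, _, hΦ'.symm.comp hΦ, W, hW, hDW, fun z hz => ?_⟩
  rw [← hWF z hz, hΦ'.left_inv]

theorem IsLocalSymplecticEmbedding.isotopsToId {U : Set (ℂ × ℂ)} {ψ : ℂ × ℂ → ℂ × ℂ}
    (hψ : IsLocalSymplecticEmbedding a U ψ) (hDP : hopfDisc a ⊆ P)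
    (hFψ : ∃ W, IsOpen W ∧ hopfDisc a ⊆ W ∧ ∀ z ∈ U ∩ W, F z = ψ z)
    {Φ Ψ : ℝ → ℂ × ℂ → ℂ × ℂ} (hΦ : IsSymplecticIsotopyFixing P Φ Ψ)
    (hΦF : ∃ W, IsOpen W ∧ hopfDisc a ⊆ W ∧ ∀ z ∈ ellipsoid 1 a ∩ W, Φ 1 (F z) = z) :
    IsotopsToId a U ψ Φ where
  isotopy := hΦ.isSymplecticIsotopy
  id_on_disc t _ z hz := hΦ.fixes t z (hDP hz)
  comp_eq_id := by
    obtain ⟨W, hW, hDW, hWF⟩ := hFψ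
    obtain ⟨W', hW', hDW', hWF'⟩ := hΦF
    obtain ⟨V, -, -, rfl⟩ := hψ.nhd
    refine ⟨W ∩ W', hW.inter hW', subset_inter hDW hDW', fun z hz => ?_⟩
    rw [← hWF z ⟨hz.1, hz.2.1⟩, hWF' z ⟨hz.1.1, hz.2.2⟩]

end FinalIsotopy

theorem hopfDisc_subset_ellipsoid (a : ℝ) : hopfDisc a ⊆ ellipsoid 1 a := fun _ hz => hz.1

theorem joinsHopfDisc_hopfDisc (a : ℝ) : JoinsHopfDisc a (hopfDisc a) :=
  ⟨1, one_pos, fun z hz _ => ⟨fun _ => z, fun _ _ => ⟨hz, le_rfl, differentiableAt_const z⟩, hz, rfl⟩⟩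

theorem isIsolatedOver_hopfDisc (a : ℝ) (O : Set ℂ) : IsIsolatedOver O (hopfDisc a) :=
  fun _ _ _ => ⟨1, one_pos, fun _ hz _ => Or.inl hz.2⟩

theorem exists_isotopsToId {a : ℝ} (ha : 0 < a) {U : Set (ℂ × ℂ)} {ψ : ℂ × ℂ → ℂ × ℂ}
    (hψ : IsLocalSymplecticEmbedding a U ψ) (hD : ∀ z ∈ hopfDisc a, ψ z = z) :
    ∃ Φ : ℝ → ℂ × ℂ → ℂ × ℂ, IsotopsToId a U ψ Φ := by
  obtain ⟨F, hF, hFψ⟩ := hψ.exists_extension ha (P := hopfDisc a) fun z hz => hD z hz.2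
  obtain ⟨χ, hχ, hχ1⟩ := exists_testFunction_eq_one isOpen_univ isCompact_unitAreaDisc
    (subset_univ _)
  -- All of `P` lies in z₂ = 0, so the shears need no restriction on their support: C is empty and χ
  -- = 1 on the whole disc.
  have hN := hF.isNormalMatrix subset_rfl isOpen_univ (isIsolatedOver_hopfDisc a univ)
    isPreconnected_empty (empty_subset _) (fun _ h => h.elim) hχ fun z hz _ => hχ1 z hz
  obtain ⟨Φ, Ψ, hΦ, hΦF⟩ := hF.exists_isotopy_comp_eq_id ha (hopfDisc_subset_ellipsoid a)
    subset_rfl (joinsHopfDisc_hopfDisc a) hN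
  exact ⟨Φ, hψ.isotopsToId subset_rfl hFψ hΦ hΦF⟩

/-! ### The relative version -/

/-- The union of the Hopf disc and the boundary of the ellipsoid. -/
def discWithBoundary (a : ℝ) : Set (ℂ × ℂ) := hopfDisc a ∪ frontier (ellipsoid 1 a)

theorem discWithBoundary_subset_ellipsoid (a : ℝ) : discWithBoundary a ⊆ ellipsoid 1 a :=
  union_subset (hopfDisc_subset_ellipsoid a) (isClosed_ellipsoid a).frontier_subset

theorem hopfDisc_subset_discWithBoundary (a : ℝ) : hopfDisc a ⊆ discWithBoundary a :=
  subset_union_left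

theorem cos_smul_sin_smul_mem_frontier {a : ℝ} (ha : 0 < a) {u v : ℂ}
    (hu : Real.pi * ‖u‖ ^ 2 = 1) (hv : Real.pi * ‖v‖ ^ 2 = a) (s : ℝ) :
    (Real.cos s • u, Real.sin s • v) ∈ frontier (ellipsoid 1 a) := by
  rw [mem_frontier_ellipsoid]
  simp only [ellipsoidLevel, norm_smul, Real.norm_eq_abs, mul_pow, sq_abs]
  have h1 : Real.pi * (Real.cos s ^ 2 * ‖u‖ ^ 2) = Real.cos s ^ 2 := by
    linear_combination Real.cos s ^ 2 * hu
  have h2 : Real.pi * (Real.sin s ^ 2 * ‖v‖ ^ 2) = Real.sin s ^ 2 * a := by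
    linear_combination Real.sin s ^ 2 * hv
  rw [h1, h2, div_one, mul_div_cancel_right₀ _ ha.ne', Real.cos_sq_add_sin_sq]

theorem differentiable_cos_smul_sin_smul (u v : ℂ) (α : ℝ) :
    Differentiable ℝ fun s : ℝ => (Real.cos (s * α) • u, Real.sin (s * α) • v) := by
  fun_prop

theorem joinsHopfDisc_discWithBoundary {a : ℝ} (ha : 0 < a) :
    JoinsHopfDisc a (discWithBoundary a) := by
  -- Below this radius π|z₂|²/a < 1, so z₁ ≠ 0 at boundary points and the angle α is less than π/2.
  refine ⟨Real.sqrt (a / Real.pi), Real.sqrt_pos.mpr (div_pos ha Real.pi_pos), ?_⟩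
  rintro ⟨z₁, z₂⟩ (hz | hz) hzr
  · exact ⟨fun _ => (z₁, z₂), fun _ _ => ⟨Or.inl hz, le_rfl, differentiableAt_const _⟩, hz, rfl⟩
  simp only at hzr
  rcases eq_or_ne z₂ 0 with rfl | hz₂
  · have hE := (isClosed_ellipsoid a).frontier_subset hz
    exact ⟨fun _ => (z₁, 0), fun _ _ => ⟨Or.inr hz, le_rfl, differentiableAt_const _⟩,
      ⟨hE, rfl⟩, rfl⟩
  have hn := norm_pos_iff.mpr hz₂
  have hlev := mem_frontier_ellipsoid.mp hz
  simp only [ellipsoidLevel, div_one] at hlev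
  set t : ℝ := Real.sqrt (Real.pi / a) * ‖z₂‖ with ht
  have hπa : 0 < Real.pi / a := div_pos Real.pi_pos ha
  have ht2 : t ^ 2 = Real.pi * ‖z₂‖ ^ 2 / a := by
    rw [ht, mul_pow, Real.sq_sqrt hπa.le]; ring
  have ht0 : 0 < t := mul_pos (Real.sqrt_pos.mpr hπa) hn
  have ht1 : t < 1 := by
    have h1 : ‖z₂‖ ^ 2 < a / Real.pi := (Real.lt_sqrt hn.le).mp hzr
    rw [lt_div_iff₀ Real.pi_pos] at h1
    rw [← sq_lt_one_iff₀ ht0.le, ht2, div_lt_one ha]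
    linarith
  set α := Real.arcsin t with hα
  have hsin : Real.sin α = t := Real.sin_arcsin (by linarith) ht1.le
  have hcos : 0 < Real.cos α := by
    rw [hα, Real.cos_arcsin]
    exact Real.sqrt_pos.mpr (by nlinarith)
  have hα0 : 0 ≤ α := Real.arcsin_nonneg.mpr ht0.le
  have hα1 : α ≤ Real.pi / 2 := Real.arcsin_le_pi_div_two t
  have hsc := Real.sin_sq_add_cos_sq α
  rw [hsin] at hsc
  have hu : Real.pi * ‖(Real.cos α)⁻¹ • z₁‖ ^ 2 = 1 := by
    rw [norm_smul, norm_inv, Real.norm_of_nonneg hcos.le]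
    field_simp
    linarith
  have hv : Real.pi * ‖t⁻¹ • z₂‖ ^ 2 = a := by
    rw [norm_smul, norm_inv, Real.norm_of_nonneg ht0.le, mul_pow, inv_pow, ht2]
    field_simp
  -- The path runs along a meridian of the boundary from the circle z₂ = 0 to z, with |z₂| never
  -- exceeding its final value.
  refine ⟨fun s => (Real.cos (s * α) • (Real.cos α)⁻¹ • z₁, Real.sin (s * α) • t⁻¹ • z₂),
    fun s hs => ⟨Or.inr (cos_smul_sin_smul_mem_frontier ha hu hv _), ?_,
      differentiable_cos_smul_sin_smul _ _ α s⟩, ?_, ?_⟩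
  · have h1 : 0 ≤ s * α := mul_nonneg hs.1 hα0
    have h2 : s * α ≤ α := mul_le_of_le_one_left hα0 hs.2
    have h3 : Real.sin (s * α) ≤ t := by
      rw [← hsin]
      exact Real.sin_le_sin_of_le_of_le_pi_div_two (by linarith) hα1 h2
    have h4 : 0 ≤ Real.sin (s * α) :=
      Real.sin_nonneg_of_nonneg_of_le_pi h1 (by linarith [Real.pi_pos])
    simp only [norm_smul, norm_inv, Real.norm_of_nonneg h4, Real.norm_of_nonneg ht0.le]
    rw [← mul_assoc, ← div_eq_mul_inv]
    exact mul_le_of_le_one_left (norm_nonneg _) ((div_le_one ht0).mpr h3)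
  · rw [mem_hopfDisc]
    simp only [zero_mul, Real.cos_zero, Real.sin_zero, one_smul, zero_smul]
    exact ⟨hu.le, trivial⟩
  · simp only [one_mul, hsin]
    rw [smul_inv_smul₀ hcos.ne', smul_inv_smul₀ ht0.ne']

theorem exists_bound_of_isCompact_of_lt {T : Set ℂ} (hT : IsCompact T)
    (h : T ⊆ {z | Real.pi * ‖z‖ ^ 2 < 1}) :
    ∃ c, 0 ≤ c ∧ c < 1 ∧ ∀ z ∈ T, Real.pi * ‖z‖ ^ 2 ≤ c := by
  rcases T.eq_empty_or_nonempty with rfl | hne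
  · exact ⟨0, le_rfl, one_pos, fun _ h => h.elim⟩
  · obtain ⟨z₀, hz₀, hmax⟩ := hT.exists_isMaxOn hne
      (f := fun z : ℂ => Real.pi * ‖z‖ ^ 2) (by fun_prop)
    exact ⟨Real.pi * ‖z₀‖ ^ 2, by positivity, h hz₀, fun z hz => hmax hz⟩

/-- On a compact subset of the open disc π|z₁|² ≤ c < 1, so boundary points over it satisfy π|z₂|² ≥
(1 − c) a. -/
theorem isIsolatedOver_discWithBoundary {a : ℝ} (ha : 0 < a) :
    IsIsolatedOver {z | Real.pi * ‖z‖ ^ 2 < 1} (discWithBoundary a) := by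
  intro T hTO hT
  obtain ⟨c, -, hc, hTc⟩ := exists_bound_of_isCompact_of_lt hT hTO
  refine ⟨Real.sqrt ((1 - c) * a / Real.pi),
    Real.sqrt_pos.mpr (div_pos (mul_pos (by linarith) ha) Real.pi_pos), fun z hz hzT => ?_⟩
  rcases hz with hz | hz
  · exact Or.inl hz.2
  · right
    have hlev := mem_frontier_ellipsoid.mp hz
    simp only [ellipsoidLevel, div_one] at hlev
    have h1 : 1 - c ≤ Real.pi * ‖z.2‖ ^ 2 / a := by linarith [hTc _ hzT]
    rw [le_div_iff₀ ha] at h1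
    rw [Real.sqrt_le_left (norm_nonneg _), div_le_iff₀ Real.pi_pos]
    linarith

/-- In polar coordinates this is the image of an interval of radii times a line. Connectedness is
what normalizes the logarithm near the circle. -/
theorem isPreconnected_annulus (κ : ℝ) :
    IsPreconnected {z : ℂ | κ ≤ Real.pi * ‖z‖ ^ 2 ∧ Real.pi * ‖z‖ ^ 2 ≤ 1} := by
  let S : Set ℝ := {r | 0 ≤ r ∧ κ ≤ Real.pi * r ^ 2 ∧ Real.pi * r ^ 2 ≤ 1}
  have hS : S.OrdConnected := ⟨fun x hx y hy r hr => by
    have h0 : 0 ≤ r := hx.1.trans hr.1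
    have h1 : x ^ 2 ≤ r ^ 2 := pow_le_pow_left₀ hx.1 hr.1 2
    have h2 : r ^ 2 ≤ y ^ 2 := pow_le_pow_left₀ h0 hr.2 2
    exact ⟨h0, hx.2.1.trans (mul_le_mul_of_nonneg_left h1 Real.pi_pos.le),
      (mul_le_mul_of_nonneg_left h2 Real.pi_pos.le).trans hy.2.2⟩⟩
  have h : {z : ℂ | κ ≤ Real.pi * ‖z‖ ^ 2 ∧ Real.pi * ‖z‖ ^ 2 ≤ 1} =
      (fun p : ℝ × ℝ => (p.1 : ℂ) * Complex.exp (p.2 * Complex.I)) '' (S ×ˢ univ) := by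
    ext z
    constructor
    · intro hz
      exact ⟨(‖z‖, Complex.arg z), ⟨⟨norm_nonneg _, hz⟩, mem_univ _⟩,
        Complex.norm_mul_exp_arg_mul_I z⟩
    · rintro ⟨⟨r, θ⟩, ⟨hr, -⟩, rfl⟩
      have : ‖(r : ℂ) * Complex.exp (θ * Complex.I)‖ = r := by
        rw [norm_mul, Complex.norm_exp_ofReal_mul_I, mul_one, Complex.norm_real,
          Real.norm_of_nonneg hr.1]
      simp only [mem_ofPred_eq, this]
      exact hr.2
  rw [h]
  exact (hS.isPreconnected.prod isPreconnected_univ).image _ (by fun_prop)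

section BoundaryCircle

variable {a : ℝ} {F : ℂ × ℂ → ℂ × ℂ}

/-- Meridians of the boundary leave the circle in every normal direction, and F fixes their points
near the circle; scaling treats vectors of arbitrary length. -/
theorem IsSymplecticNearDisc.fderiv_normal_of_circle (ha : 0 < a)
    (hF : IsSymplecticNearDisc a (discWithBoundary a) F) {z : ℂ} (hz : Real.pi * ‖z‖ ^ 2 = 1)
    (u : ℂ) : fderiv ℝ F (z, 0) (0, u) = (0, u) := by
  have key : ∀ v : ℂ, Real.pi * ‖v‖ ^ 2 = a → fderiv ℝ F (z, 0) (0, v) = (0, v) := fun v hv => by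
    let γ : ℝ → ℂ × ℂ := fun s => (Real.cos s • z, Real.sin s • v)
    have hγ0 : γ 0 = (z, 0) := by simp [γ]
    have hγ : HasDerivAt γ (0, v) 0 := by
      have h1 := ((Real.hasDerivAt_cos 0).smul_const z).prodMk
        ((Real.hasDerivAt_sin 0).smul_const v)
      rw [Real.sin_zero, Real.cos_zero, neg_zero, zero_smul, one_smul] at h1
      exact h1
    have hγF : ∀ s, γ s ∈ frontier (ellipsoid 1 a) :=
      cos_smul_sin_smul_mem_frontier ha hz hv
    obtain ⟨ε, hε, htube⟩ := hF.tube
    have hev : ∀ᶠ s in 𝓝 (0 : ℝ), ‖(γ s).2‖ < ε :=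
      (hγ.continuousAt.snd.norm).eventually_lt_const (by simpa [hγ0] using hε)
    have hFγ : (fun s => F (γ s)) =ᶠ[𝓝 0] γ := hev.mono fun s hs =>
      (htube _ ((isClosed_ellipsoid a).frontier_subset (hγF s)) hs).2 (Or.inr (hγF s))
    have hd : HasFDerivAt F (fderiv ℝ F (z, 0)) (γ 0) := by
      rw [hγ0]; exact (hF.smooth.differentiable (by simp) _).hasFDerivAt
    exact (hd.comp_hasDerivAt (0 : ℝ) hγ).unique (hγ.congr_of_eventuallyEq hFγ)
  rcases eq_or_ne u 0 with rfl | hu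
  · exact map_zero _
  have hn := norm_pos_iff.mpr hu
  have hs : 0 < Real.sqrt (a / Real.pi) := Real.sqrt_pos.mpr (div_pos ha Real.pi_pos)
  have hs2 := Real.sq_sqrt (div_pos ha Real.pi_pos).le
  set s := ‖u‖ / Real.sqrt (a / Real.pi) with hsdef
  have hs0 : 0 < s := div_pos hn hs
  have hv := key (s⁻¹ • u) (by
    rw [norm_smul, norm_inv, Real.norm_of_nonneg hs0.le, hsdef, inv_div,
      div_mul_cancel₀ _ hn.ne', hs2, mul_div_cancel₀ _ Real.pi_pos.ne'])
  have hus : ((0, u) : ℂ × ℂ) = s • ((0, s⁻¹ • u) : ℂ × ℂ) := by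
    rw [Prod.smul_mk, smul_zero, smul_inv_smul₀ hs0.ne']
  rw [hus, map_smul, hv]

theorem IsSymplecticNearDisc.fderiv_of_circle (ha : 0 < a)
    (hF : IsSymplecticNearDisc a (discWithBoundary a) F) {z : ℂ × ℂ} (hz : z ∈ hopfCircle) :
    fderiv ℝ F z = ContinuousLinearMap.id ℝ (ℂ × ℂ) := by
  obtain ⟨z₁, z₂⟩ := z
  obtain ⟨hz₁, rfl⟩ : Real.pi * ‖z₁‖ ^ 2 = 1 ∧ z₂ = 0 := hz
  refine ContinuousLinearMap.ext fun u => ?_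
  have hu : u = (u.1, 0) + (0, u.2) := by simp
  have hz' : z₁ ∈ unitAreaDisc := hz₁.le
  rw [hu, map_add, hF.fderiv_normal_of_circle ha hz₁,
    hF.fderiv_tangent (hopfDisc_subset_discWithBoundary a) hz']
  rfl

theorem normalMatrix_eq_one (ha : 0 < a) (hF : ContDiff ℝ ∞ F) {W : Set (ℂ × ℂ)} (hW : IsOpen W)
    (hFW : ∀ z ∈ ellipsoid 1 a ∩ W, F z = z) {z : ℂ} (hz : z ∈ unitAreaDisc)
    (hzW : ((z, 0) : ℂ × ℂ) ∈ W) : normalMatrix F z = 1 := by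
  have hzE : ((z, 0) : ℂ × ℂ) ∈ ellipsoid 1 a := (mem_hopfDisc_iff_mem_unitAreaDisc.mpr hz).1
  have h1 : HasFDerivWithinAt F (ContinuousLinearMap.id ℝ (ℂ × ℂ)) (ellipsoid 1 a ∩ W) (z, 0) :=
    (hasFDerivWithinAt_id _ _).congr hFW (hFW _ ⟨hzE, hzW⟩)
  have h2 := ((uniqueDiffOn_ellipsoid ha).inter hW _ ⟨hzE, hzW⟩).eq
    (hF.differentiable (by simp) _).hasFDerivAt.hasFDerivWithinAt h1
  simp [normalMatrix, h2, Matrix.one_fin_two]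

/-- After an isotopy relative to the boundary that makes the map the identity near the boundary
circle of the Hopf disc, its normal derivative along the disc is realized by an isotopy relative
to the boundary. -/
theorem IsSymplecticNearDisc.isNormalMatrix_of_eq_id (ha : 0 < a)
    (hF : IsSymplecticNearDisc a (discWithBoundary a) F) {W : Set (ℂ × ℂ)} (hW : IsOpen W)
    (hKW : hopfCircle ⊆ W) (hFW : ∀ z ∈ ellipsoid 1 a ∩ W, F z = z) :
    IsNormalMatrix a (discWithBoundary a) (normalMatrix F) := by
  have hcont : Continuous fun z : ℂ => ((z, 0) : ℂ × ℂ) := by fun_prop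
  have hT : IsCompact (unitAreaDisc \ (fun z : ℂ => ((z, 0) : ℂ × ℂ)) ⁻¹' W) :=
    isCompact_unitAreaDisc.diff (hW.preimage hcont)
  obtain ⟨c, hc0, hc1, hTc⟩ := exists_bound_of_isCompact_of_lt hT fun z hz =>
    lt_of_le_of_ne hz.1 fun h => hz.2 (hKW ⟨h, rfl⟩)
  -- The disc points outside W satisfy π|z|² ≤ c. So the normal matrix is 1 for π|z|² ≥ κ > c, and κ
  -- < 1 leaves room for χ to equal 1 up to κ with compact support in the open disc.
  obtain ⟨κ, hcκ, hκ1⟩ := exists_between hc1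
  have hO : IsOpen {z : ℂ | Real.pi * ‖z‖ ^ 2 < 1} := isOpen_lt (by fun_prop) (by fun_prop)
  have hTκ : IsCompact {z : ℂ | Real.pi * ‖z‖ ^ 2 ≤ κ} :=
    isCompact_unitAreaDisc.of_isClosed_subset (isClosed_le (by fun_prop) (by fun_prop))
      fun z hz => le_trans hz hκ1.le
  obtain ⟨χ, hχ, hχ1⟩ := exists_testFunction_eq_one hO hTκ fun z hz => lt_of_le_of_lt hz hκ1
  refine hF.isNormalMatrix (hopfDisc_subset_discWithBoundary a) hO
    (isIsolatedOver_discWithBoundary ha) (isPreconnected_annulus κ) (fun z hz => hz.2)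
    (fun z hz => normalMatrix_eq_one ha hF.smooth hW hFW hz.2 ?_) hχ fun z hz hzC => hχ1 z ?_
  · by_contra hzW
    exact absurd (hTc z ⟨hz.2, hzW⟩) (not_le.mpr (hcκ.trans_le hz.1))
  · by_contra hzκ
    exact hzC ⟨(not_le.mp hzκ).le, hz⟩

end BoundaryCircle

theorem exists_isotopsToId_rel_frontier {a : ℝ} (ha : 0 < a) {U : Set (ℂ × ℂ)}
    {ψ : ℂ × ℂ → ℂ × ℂ} (hψ : IsLocalSymplecticEmbedding a U ψ)
    (hD : ∀ z ∈ hopfDisc a, ψ z = z) (hψb : ∀ z ∈ U ∩ frontier (ellipsoid 1 a), ψ z = z) :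
    ∃ Φ : ℝ → ℂ × ℂ → ℂ × ℂ, IsotopsToId a U ψ Φ ∧
      ∀ t ∈ Icc (0 : ℝ) 1, ∀ z ∈ frontier (ellipsoid 1 a), Φ t z = z := by
  have hPE := discWithBoundary_subset_ellipsoid a
  have hDP := hopfDisc_subset_discWithBoundary a
  have hjoin := joinsHopfDisc_discWithBoundary ha
  obtain ⟨F, hF, hFψ⟩ := hψ.exists_extension ha (P := discWithBoundary a) fun z hz =>
    hz.2.elim (hD z) fun h => hψb z ⟨hz.1, h⟩
  -- On the circle the derivative of F is already the identity, so the tangent correction applies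
  -- there without a normal correction; composing F with the inverse isotopy gives the identity near
  -- the circle.
  obtain ⟨Φ, Ψ, hΦ, W, hW, hKW, hWF⟩ := hF.exists_isotopy ha hPE hDP hjoin isClosed_hopfCircle
    (hopfCircle_subset a) hasCutoffs_hopfCircle fun z hz => hF.fderiv_of_circle ha hz
  have hF' := hF.comp hΦ.symm 1
  have hN := hF'.isNormalMatrix_of_eq_id ha hW hKW fun z hz => by
    rw [← hWF z hz, hΦ.left_inv]
  obtain ⟨Φ', Ψ', hΦ', hΦF⟩ := hF'.exists_isotopy_comp_eq_id ha hPE hDP hjoin hN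
  have hcomp := hΦ'.comp hΦ.symm
  exact ⟨_, hψ.isotopsToId hDP hFψ hcomp hΦF, fun t _ z hz => hcomp.fixes t z (Or.inr hz)⟩

theorem mainTheorem9 (a : ℝ) (ha : 0 < a) (U : Set (ℂ × ℂ)) (ψ : ℂ × ℂ → ℂ × ℂ)
    (hψ : IsLocalSymplecticEmbedding a U ψ) (hD : ∀ z ∈ hopfDisc a, ψ z = z) :
    (∃ Φ : ℝ → ℂ × ℂ → ℂ × ℂ, IsotopsToId a U ψ Φ) ∧
    ((∀ z ∈ U ∩ frontier (ellipsoid 1 a), ψ z = z) →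
      ∃ Φ : ℝ → ℂ × ℂ → ℂ × ℂ, IsotopsToId a U ψ Φ ∧
        ∀ t ∈ Icc (0 : ℝ) 1, ∀ z ∈ frontier (ellipsoid 1 a), Φ t z = z) :=
  ⟨exists_isotopsToId ha hψ hD, exists_isotopsToId_rel_frontier ha hψ hD⟩
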